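/- **Setting.** Write $\lambda_i(\Sigma)$ for the $i$-th largest eigenvalue of a symmetric matrix $\Sigma\in\mathbb{R}^{d\times d}$ (with $\lambda_{d+1}:=0$). The *general sparse $k$-PCA model* with parameters $s,k\in\{1,\dots,d\}$, $\gamma\in(0,\tfrac12)$, $\sigma>0$ consists of a positive semidefinite $\Sigma\in\mathbb{R}^{d\times d}$ with $\lambda_k(\Sigma)>0$ and $\lambda_{k+1}(\Sigma)/\lambda_k(\Sigma)\le 1-\gamma$; orthonormal vectors $v_1,\dots,v_k\in\mathbb{R}^d$ that span the top-$k$ eigenspace of $\Sigma$ and satisfy $|\bigcup_{i}\mathrm{supp}(v_i)|\le s$; and a probability distribution $\mathcal D$ on $\mathbb{R}^d$ with covariance $\Sigma$ that is $\sigma$-sub-Gaussian, i.e. $\mathbb{E}_{x\sim\mathcal D}[\exp(u^\top x)]\le\exp(\tfrac12\sigma^2\|u\|_2^2)$ for all $u\in\mathbb{R}^d$. Let $V=(v_1\,\cdots\,v_k)\in\mathbb{R}^{d\times k}$. The data are $x_1,\dots,x_n\sim_{\rm i.i.d.}\mathcal D$. **Algorithm** $\mathsf{RTPM}(x_1,\dots,x_n;r,T)$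 (restarted truncated power method), $r\in\{1,\dots,d\}$. Let $\mathrm{top}_r(w)$ keep $r$ entries of $w$ that are largest in magnitude and set the others to $0$ (ties are broken by any fixed rule for which $\mathrm{top}_r$ is a measurable map). Let $B=\lfloor n/T\rfloor$ and, for $t=1,\dots,T$, $\widehat\Sigma_t=\frac1B\sum_{j=B(t-1)+1}^{Bt}x_jx_j^\top$; let $\widehat\Sigma=\frac1n\sum_{j=1}^n x_jx_j^\top$. For each $i\in\{1,\dots,d\}$ put $u^{(i)}_0=e_i$ and $u^{(i)}_t=\mathrm{top}_r(\widehat\Sigma_tu^{(i)}_{t-1})/\|\mathrm{top}_r(\widehat\Sigma_tu^{(i)}_{t-1})\|_2$ (and $u^{(i)}_t=0$ if the denominator vanishes). Return $u=u^{(i)}_T$ for some $i$ that maximizes $\langle u^{(i)}_T,\widehat\Sigma u^{(i)}_T\rangle$. **Theorem.** There are universal constants $C_r,C_T,C_{\rm time}>0$ and, for each $K\ge1$, a constant $C_n=C_n(K)>0$ such that the following holds. Let $\delta,\Delta\in(0,1)$, assume the general sparse $k$-PCA model, and let the integers $n$, $r\le d$ and $T$ satisfy $$C_r\,\frac{s^2k^2}{\Delta^2\gamma^2}\le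 r\le K\,C_r\,\frac{s^2k^2}{\Delta^2\gamma^2},\qquad C_T\,\frac{k\log(s/(\Delta\gamma))}{\Delta\gamma}\le T\le K\,C_T\,\frac{k\log(s/(\Delta\gamma))}{\Delta\gamma},$$ $$n\ge C_n\Big(\frac{\sigma^2}{\lambda_k(\Sigma)}\Big)^2s^2\Big(\frac{k^5}{\Delta^6\gamma^6}+\frac{k^2}{\Delta^2\gamma^6}\Big)\log\Big(\frac{dT}{\delta}\Big)\log\Big(\frac{s}{\Delta\gamma}\Big).$$ 1. *(Running time.)* There are a single program for a real RAM and a single choice of tie-breaking rules for $\mathrm{top}_r$ (one for each $d,r$), none of them depending on the instance or on $K$, such that for all data $x_1,\dots,x_n\in\mathbb{R}^d$ the program halts after at most $C_{\rm time}\,nd^2$ steps and returns an output of $\mathsf{RTPM}(x_1,\dots,x_n;r,T)$. (Real RAM with unit cost: addition, truncated subtraction and comparison of nonnegative integers; exact $+,-,\times,\div,\sqrt{\ }$ and comparison of reals; conversion of integers to reals; and access to one-dimensional integer arrays and two-dimensional real arrays.) 2. *(Accuracy.)* For every measurable tie-breaking rule, with probability at least $1-\delta$ every vector $u$ that $\mathsf{RTPM}(x_1,\dots,x_n;r,T)$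 may return is an $r$-sparse unit vector with $\|V^\top u\|_2^2\ge1-\Delta$. 3. *(Special case $k=1$, $\gamma=\Delta=\tfrac1{10}$.)* With the same program, tie-breaking rules and $C_{\rm time}$, and possibly other constants $C_r',C_T'>0$ and $C_n'(K)>0$: if $k=1$, $\gamma=\tfrac1{10}$, $v=v_1$, $s\ge2$, $r\le d$, $C_r's^2\le r\le KC_r's^2$, $C_T'\log s\le T\le KC_T'\log s$ and $n\ge C_n'\big(\sigma^2/\lambda_1(\Sigma)\big)^2s^2\log(s)\log(d/\delta)$, then the running time claim of part 1 holds and, for every measurable tie-breaking rule, with probability at least $1-\delta$ every possible output $u$ is an $r$-sparse unit vector with $\langle v,u\rangle^2\ge\tfrac9{10}$. -/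

import Mathlib

open MeasureTheory

noncomputable section

namespace SparsePCA

/-- `ℝ^d` with its Euclidean norm and inner product. -/
abbrev Vec (d : ℕ) : Type := EuclideanSpace ℝ (Fin d)

/-- Number of nonzero entries. -/
def nnz {d : ℕ} (v : Vec d) : ℕ := (Finset.univ.filter fun j => v j ≠ 0).card

/-- `matVec M v` is the matrix-vector product `M v`. -/
def matVec {d : ℕ} (M : Matrix (Fin d) (Fin d) ℝ) (v : Vec d) : Vec d :=
  WithLp.toLp 2 (M.mulVec v.ofLp)

/-- The `i`-th largest eigenvalue (counted with multiplicity, `1 ≤ i ≤ d`) of a real symmetric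
`d × d` matrix; it is set to `0` outside this range. -/
def eigval {d : ℕ} (M : Matrix (Fin d) (Fin d) ℝ) (i : ℕ) : ℝ :=
  if h : M.IsHermitian ∧ 1 ≤ i ∧ i ≤ d then
    h.1.eigenvalues₀ ⟨i - 1, by rw [Fintype.card_fin]; omega⟩
  else 0

/-- `D` is `σ`-sub-Gaussian: `E exp ⟨u, x⟩ ≤ exp (σ² ‖u‖² / 2)` for all `u`. -/
def IsSubGaussian {d : ℕ} (σ : ℝ) (D : Measure (Vec d)) : Prop :=
  ∀ u : Vec d, Integrable (fun x => Real.exp (inner ℝ u x)) D ∧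
    ∫ x, Real.exp (inner ℝ u x) ∂D ≤ Real.exp (1 / 2 * σ ^ 2 * ‖u‖ ^ 2)

/-- The general sparse `k`-PCA model, for the distribution `D` of one sample. -/
structure Model (s d k : ℕ) (γ σ : ℝ) (D : Measure (Vec d))
    (Sig : Matrix (Fin d) (Fin d) ℝ) (v : Fin k → Vec d) : Prop where
  s_pos : 1 ≤ s
  s_le : s ≤ d
  k_pos : 1 ≤ k
  k_le : k ≤ d
  gap_pos : 0 < γ
  gap_lt : γ < 1 / 2
  sigma_pos : 0 < σ
  posSemidef : Sig.PosSemidef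
  orthonormal : Orthonormal ℝ v
  /-- The `v i` span the top-`k` eigenspace, i.e. the sum of the eigenspaces of all eigenvalues
  that are at least the `k`-th largest one. -/
  span_eq : Submodule.span ℝ (Set.range v) =
    ⨆ μ ∈ Set.Ici (eigval Sig k), Module.End.eigenspace (Matrix.toLpLin 2 2 Sig) μ
  /-- The eigenvalue ratio in `gap` is well defined. -/
  eigval_pos : 0 < eigval Sig k
  gap : eigval Sig (k + 1) / eigval Sig k ≤ 1 - γ
  support : (Finset.univ.filter fun j => ∃ i, v i j ≠ 0).card ≤ s
  isProbability : IsProbabilityMeasure D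
  subGaussian : IsSubGaussian σ D
  covariance : ∀ i j, Sig i j = ProbabilityTheory.covariance (fun x => x i) (fun x => x j) D

/-! ### The restarted truncated power method -/

/-- `w` keeps `r` entries of `v` that are largest in magnitude (with some choice among ties) and
zeroes out the others. -/
def IsTopTruncation {d : ℕ} (r : ℕ) (v w : Vec d) : Prop :=
  ∃ A : Finset (Fin d), A.card = r ∧ (∀ i ∈ A, ∀ j ∉ A, |v j| ≤ |v i|) ∧
    ∀ i, w i = if i ∈ A then v i else 0

/-- `top` is one version of `top_r`: a measurable map that truncates every vector to its `r`
largest entries, breaking ties in some way. -/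
def IsTopRule {d : ℕ} (r : ℕ) (top : Vec d → Vec d) : Prop :=
  Measurable top ∧ ∀ v, IsTopTruncation r v (top v)

/-- The empirical second moment matrix `(1/|J|) ∑_{j ∈ J} x_j x_jᵀ` of the samples in `J`. -/
def empCov {n d : ℕ} (x : Fin n → Vec d) (J : Finset (Fin n)) : Matrix (Fin d) (Fin d) ℝ :=
  (J.card : ℝ)⁻¹ • ∑ j ∈ J, Matrix.vecMulVec (x j).ofLp (x j).ofLp

/-- The `t`-th (`t = 0, …, T - 1`) of `T` disjoint consecutive batches of `⌊n / T⌋` samples. -/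
def batch (n T t : ℕ) : Finset (Fin n) :=
  Finset.univ.filter fun j => n / T * t ≤ (j : ℕ) ∧ (j : ℕ) < n / T * (t + 1)

/-- The iterates `u_t` for the start `u_0 = e_i`:
`u_{t+1} = top_r(Σ̂_{t+1} u_t) / ‖top_r(Σ̂_{t+1} u_t)‖`, which is `0` if the numerator is `0`. -/
def iterate {n d : ℕ} (top : Vec d → Vec d) (x : Fin n → Vec d) (T : ℕ) (i : Fin d) : ℕ → Vec d
  | 0 => EuclideanSpace.single i 1
  | t + 1 =>
    let w := top (matVec (empCov x (batch n T t)) (iterate top x T i t))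
    ‖w‖⁻¹ • w

/-- The Rayleigh objective `⟨u, Σ̂ u⟩` for the second moment matrix of all samples. -/
def rayleigh {n d : ℕ} (x : Fin n → Vec d) (u : Vec d) : ℝ :=
  inner ℝ u (matVec (empCov x Finset.univ) u)

/-- `u` is an output of the restarted truncated power method: the last iterate of a restart `i`
that maximizes the Rayleigh objective (any maximizer may be chosen). -/
def IsOutput {n d : ℕ} (top : Vec d → Vec d) (x : Fin n → Vec d) (T : ℕ) (u : Vec d) : Prop :=
  ∃ i : Fin d, u = iterate top x T i T ∧
    ∀ j : Fin d, rayleigh x (iterate top x T j T) ≤ rayleigh x (iterate top x T i T)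

/-- The event that every output of the method with truncation map `top` is an `r`-sparse unit
vector `u` with `‖Vᵀ u‖² ≥ 1 - Δ`, where `V` has the columns `v i`. -/
def successEvent {n d k : ℕ} (top : Vec d → Vec d) (r T : ℕ) (v : Fin k → Vec d) (Δ : ℝ) :
    Set (Fin n → Vec d) :=
  {x | ∀ u, IsOutput top x T u → nnz u ≤ r ∧ ‖u‖ = 1 ∧ 1 - Δ ≤ ∑ i, (inner ℝ (v i) u) ^ 2}

/-! ### A real RAM with unit costs

Memory: integer registers, real registers, one-dimensional integer arrays and two-dimensional
real arrays, each addressed by the contents of integer registers. A program is a finite text that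
does not depend on the input. -/

structure RAMState where
  int : ℕ → ℕ
  real : ℕ → ℝ
  intArr : ℕ → ℕ → ℕ
  realArr : ℕ → ℕ → ℕ → ℝ

/-- Elementary instructions; the arguments are names of registers and arrays (in `iconst`, the
second argument is a constant). -/
inductive Instr where
  | iconst (a c : ℕ)
  | iadd (a b c : ℕ)
  | isub (a b c : ℕ)
  | iload (a A i : ℕ)
  | istore (A i a : ℕ)
  | ofInt (x a : ℕ)
  | radd (x y z : ℕ)
  | rsub (x y z : ℕ)
  | rmul (x y z : ℕ)
  | rdiv (x y z : ℕ)
  | rsqrt (x y : ℕ)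
  | rload (x A i j : ℕ)
  | rstore (A i j x : ℕ)

/-- Effect of an elementary instruction (subtraction of integers is truncated at `0`). -/
def Instr.step : Instr → RAMState → RAMState
  | .iconst a c, m => { m with int := Function.update m.int a c }
  | .iadd a b c, m => { m with int := Function.update m.int a (m.int b + m.int c) }
  | .isub a b c, m => { m with int := Function.update m.int a (m.int b - m.int c) }
  | .iload a A i, m => { m with int := Function.update m.int a (m.intArr A (m.int i)) }
  | .istore A i a, m =>
    { m with
      intArr := Function.update m.intArr A
        (Function.update (m.intArr A) (m.int i) (m.int a)) }
  | .ofInt x a, m => { m with real := Function.update m.real x (m.int a : ℝ) }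
  | .radd x y z, m => { m with real := Function.update m.real x (m.real y + m.real z) }
  | .rsub x y z, m => { m with real := Function.update m.real x (m.real y - m.real z) }
  | .rmul x y z, m => { m with real := Function.update m.real x (m.real y * m.real z) }
  | .rdiv x y z, m => { m with real := Function.update m.real x (m.real y / m.real z) }
  | .rsqrt x y, m => { m with real := Function.update m.real x (Real.sqrt (m.real y)) }
  | .rload x A i j, m =>
    { m with real := Function.update m.real x (m.realArr A (m.int i) (m.int j)) }
  | .rstore A i j x, m =>
    { m with
      realArr := Function.update m.realArr A
        (Function.update (m.realArr A) (m.int i)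
          (Function.update (m.realArr A (m.int i)) (m.int j) (m.real x))) }

/-- Comparisons of two integer registers or of two real registers. -/
inductive Test where
  | ilt (a b : ℕ)
  | rlt (x y : ℕ)

def Test.holds : Test → RAMState → Prop
  | .ilt a b, m => m.int a < m.int b
  | .rlt x y, m => m.real x < m.real y

inductive Prog where
  | instr (c : Instr)
  | seq (p q : Prog)
  | branch (b : Test) (p q : Prog)
  | loop (b : Test) (p : Prog)

/-- `Runs p m c m'`: started in the state `m`, the program `p` halts in the state `m'` after `c`
steps, where each instruction and each evaluation of a test is one step; `loop b p` executes `p`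
as long as `b` holds. -/
inductive Runs : Prog → RAMState → ℕ → RAMState → Prop where
  | instr (c : Instr) (m : RAMState) : Runs (.instr c) m 1 (c.step m)
  | seq {p q : Prog} {m m' m'' : RAMState} {c c' : ℕ} :
      Runs p m c m' → Runs q m' c' m'' → Runs (.seq p q) m (c + c') m''
  | branch_true {b : Test} {p q : Prog} {m m' : RAMState} {c : ℕ} :
      b.holds m → Runs p m c m' → Runs (.branch b p q) m (c + 1) m'
  | branch_false {b : Test} {p q : Prog} {m m' : RAMState} {c : ℕ} :
      ¬ b.holds m → Runs q m c m' → Runs (.branch b p q) m (c + 1) m'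
  | loop_true {b : Test} {p : Prog} {m m' m'' : RAMState} {c c' : ℕ} :
      b.holds m → Runs p m c m' → Runs (.loop b p) m' c' m'' →
        Runs (.loop b p) m (c + c' + 1) m''
  | loop_false {b : Test} {p : Prog} {m : RAMState} :
      ¬ b.holds m → Runs (.loop b p) m 1 m

/-- The input: integer registers `0, 1, 2, 3` hold `n, d, r, T`, the real array `0` holds the
samples, one per row, and all other memory is `0`. -/
def inputState {n d : ℕ} (x : Fin n → Vec d) (r T : ℕ) : RAMState where
  int a := if a = 0 then n else if a = 1 then d else if a = 2 then r else if a = 3 then T else 0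
  real _ := 0
  intArr _ _ := 0
  realArr A i j := if h : A = 0 ∧ i < n ∧ j < d then x ⟨i, h.2.1⟩ ⟨j, h.2.2⟩ else 0

/-- The output: the first `d` entries of row `0` of the real array `1`. -/
def outputVec (d : ℕ) (m : RAMState) : Vec d := WithLp.toLp 2 fun j => m.realArr 1 0 j

/-- On the data `x`, the program `p` halts after at most `c` steps, and what it returns is an
output of the restarted truncated power method with truncation map `top`. -/
def ComputesWithin (p : Prog) {n d : ℕ} (top : Vec d → Vec d) (x : Fin n → Vec d) (r T : ℕ)
    (c : ℝ) : Prop :=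
  ∃ (steps : ℕ) (m : RAMState), Runs p (inputState x r T) steps m ∧ (steps : ℝ) ≤ c ∧
    IsOutput top x T (outputVec d m)

end SparsePCA

end

open MeasureTheory ProbabilityTheory

noncomputable section

namespace SparsePCA


/-! The output maximises the empirical Rayleigh quotient, so two facts suffice: some restart ends
with `⟨u, Σu⟩` close to λ₁, and the empirical quotient is uniformly accurate on `r`-sparse vectors
of the unit ball. The winner then satisfies `⟨u, Σu⟩ ≥ (1 - Δγ)λ₁`. Mass outside the top-`k`
eigenspace contributes at most at rate (1 - γ)λ₁, so at least the fraction 1 - Δ of `‖u‖²` lies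
inside (`Model.sum_inner_sq_ge`).

For the good restart, convergence to the top-`k` eigenspace would not be enough, because λ_k may be
far below λ₁. The target is instead taken at the first `m ≤ k` where the spectrum drops by the
relative amount x = Δγ/(4k) (`exists_first_gap`). The gap at `k` guarantees such an `m`, and at most
the fraction kx = Δγ/4 of λ₁ has been lost before it. Let W be the sum of the eigenspaces with
eigenvalue at least λ_m. It lies in the span of the `v i`, so its vectors live on at most `s`
coordinates, and unit vectors near W have Rayleigh quotient near λ₁. Some coordinate vector makes an
angle of tangent at most √s with W (`SparseGap.exists_start`). Each step multiplies the tangent by 1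
- x/2 up to noise: Σ acts with relative gap x, and truncation to `r ≫ s` coordinates loses little,
because each dropped entry in the support is dominated by many kept entries outside it, to which W
does not contribute (`SparseGap.truncated_step`, `SparseGap.tangent_le`).

Every step uses a fresh batch, independent of the current iterate. Its noise is therefore governed
entrywise by tails of sums of centred squares of sub-Gaussian variables
(`IsSubGaussian.measure_abs_quad_ge_le` and polarization), with a union bound over `T * d` events.
Uniformity over sparse vectors comes from a union bound over a grid
(`IsSubGaussian.measure_exists_sparse_quad_ge_le`).

The program never forms a matrix. A restart costs O(nd), since the batches have at most `n` samples
in total and `r * T ≤ n`; there are `d` restarts. Its correctness is shown with a Hoare-style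
predicate `WP` that carries a step budget. The special case is the general one with `K` replaced by
`8 * K`. -/

/-! ### Squares of sub-Gaussian random variables -/

/-- A real random variable with the moment generating function bound of a standard Gaussian. -/
structure IsStdSubGaussian {Ω : Type*} [MeasurableSpace Ω] (μ : Measure Ω) (Y : Ω → ℝ) :
    Prop where
  measurable : Measurable Y
  integrable_exp : ∀ t : ℝ, Integrable (fun ω => Real.exp (t * Y ω)) μ
  integral_exp_le : ∀ t : ℝ, ∫ ω, Real.exp (t * Y ω) ∂μ ≤ Real.exp (t ^ 2 / 2)

section Square

variable {Ω : Type*} [MeasurableSpace Ω] {μ : Measure Ω} [IsProbabilityMeasure μ] {Y : Ω → ℝ}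

/-- The density of N(0, 1/2) is proportional to exp(-g²); multiplied by exp(g²/2) it becomes √2
times the standard Gaussian density. -/
theorem lintegral_exp_sq_gaussianReal_half :
    ∫⁻ g, ENNReal.ofReal (Real.exp (g ^ 2 / 2)) ∂(gaussianReal 0 (1 / 2)) =
      ENNReal.ofReal (Real.sqrt 2) := by
  have hv : (1 / 2 : NNReal) ≠ 0 := by norm_num
  rw [gaussianReal_of_var_ne_zero 0 hv,
    lintegral_withDensity_eq_lintegral_mul _ (measurable_gaussianPDF _ _) (by fun_prop)]
  have key : ∀ g : ℝ, (gaussianPDF 0 (1 / 2) * fun g : ℝ => ENNReal.ofReal (Real.exp (g ^ 2 / 2))) g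
      = ENNReal.ofReal (Real.sqrt 2) * gaussianPDF 0 1 g := by
    intro g
    simp only [Pi.mul_apply, gaussianPDF]
    rw [← ENNReal.ofReal_mul (gaussianPDFReal_nonneg _ _ _), ← ENNReal.ofReal_mul (by positivity)]
    congr 1
    simp only [gaussianPDFReal]
    have h2 : (√(2 * Real.pi * ((1 / 2 : NNReal) : ℝ)))⁻¹ = √2 *
      (√(2 * Real.pi * ((1 : NNReal) : ℝ)))⁻¹ := by
      have : (2 * Real.pi * ((1 / 2 : NNReal) : ℝ)) = Real.pi := by push_cast; ring
      rw [this, NNReal.coe_one, mul_one, Real.sqrt_mul (by norm_num)]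
      have : √2 ≠ 0 := by positivity
      have : √Real.pi ≠ 0 := by have := Real.pi_pos; positivity
      field_simp
    rw [h2, mul_assoc, mul_assoc, ← Real.exp_add, ← mul_assoc, ← mul_assoc]
    congr 2
    push_cast
    ring
  simp_rw [key]
  rw [lintegral_const_mul _ (measurable_gaussianPDF _ _), lintegral_gaussianPDF_eq_one 0
    one_ne_zero,
    mul_one]

/-- Gaussian linearisation: exp(y²/4) is the mean of exp(gy) for g distributed as N(0, 1/2). After
Tonelli the moment generating function bound applies for each fixed g and leaves the mean of
exp(g²/2). Lower integrals are used because integrability is not yet known. -/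
theorem IsStdSubGaussian.lintegral_exp_sq_le (h : IsStdSubGaussian μ Y) :
    ∫⁻ ω, ENNReal.ofReal (Real.exp (Y ω ^ 2 / 4)) ∂μ ≤ ENNReal.ofReal (Real.sqrt 2) := by
  have hm := h.measurable
  have key : ∀ y : ℝ, ENNReal.ofReal (Real.exp (y ^ 2 / 4)) =
      ∫⁻ g, ENNReal.ofReal (Real.exp (g * y)) ∂(gaussianReal 0 (1 / 2)) := by
    intro y
    have h1 := congrFun (mgf_fun_id_gaussianReal (μ := 0) (v := 1 / 2)) y
    have hint : Integrable (fun g : ℝ => Real.exp (g * y)) (gaussianReal 0 (1 / 2)) := by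
      have := integrable_exp_mul_gaussianReal (μ := 0) (v := 1 / 2) y
      simpa only [mul_comm] using this
    rw [← ofReal_integral_eq_lintegral_ofReal hint
      (Filter.Eventually.of_forall fun g => by positivity)]
    simp only [mgf] at h1
    simp_rw [mul_comm _ y, h1]
    congr 2
    push_cast
    ring
  simp_rw [key]
  rw [lintegral_lintegral_swap (by fun_prop), ← lintegral_exp_sq_gaussianReal_half]
  refine lintegral_mono fun g => ?_
  rw [← ofReal_integral_eq_lintegral_ofReal (h.integrable_exp g)
    (Filter.Eventually.of_forall fun g => by positivity)]
  exact ENNReal.ofReal_le_ofReal (h.integral_exp_le g)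

theorem IsStdSubGaussian.integrable_exp_sq (h : IsStdSubGaussian μ Y) :
    Integrable (fun ω => Real.exp (Y ω ^ 2 / 4)) μ := by
  have hm := h.measurable
  refine ⟨by fun_prop, ?_⟩
  rw [hasFiniteIntegral_iff_ofReal (Filter.Eventually.of_forall fun g => by positivity)]
  exact h.lintegral_exp_sq_le.trans_lt ENNReal.ofReal_lt_top

theorem IsStdSubGaussian.integral_exp_sq_le (h : IsStdSubGaussian μ Y) :
    ∫ ω, Real.exp (Y ω ^ 2 / 4) ∂μ ≤ Real.sqrt 2 := by
  have h1 := h.lintegral_exp_sq_le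
  rw [← ofReal_integral_eq_lintegral_ofReal h.integrable_exp_sq
    (Filter.Eventually.of_forall fun g => by positivity)] at h1
  exact (ENNReal.ofReal_le_ofReal_iff (by positivity)).1 h1

theorem IsStdSubGaussian.integrable_sq (h : IsStdSubGaussian μ Y) :
    Integrable (fun ω => Y ω ^ 2) μ := by
  have hm := h.measurable
  refine (h.integrable_exp_sq.const_mul 4).mono' (by fun_prop)
    (Filter.Eventually.of_forall fun ω => ?_)
  rw [Real.norm_of_nonneg (by positivity)]
  nlinarith [Real.add_one_le_exp (Y ω ^ 2 / 4)]

/-- From 1 + z ≤ eᶻ with z = Y²/4, the second moment is at most 4(√2 - 1), and √2 ≤ 3/2. -/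
theorem IsStdSubGaussian.integral_sq_le (h : IsStdSubGaussian μ Y) : ∫ ω, Y ω ^ 2 ∂μ ≤ 2 := by
  have h1 : ∫ ω, (1 + Y ω ^ 2 / 4) ∂μ ≤ ∫ ω, Real.exp (Y ω ^ 2 / 4) ∂μ :=
    integral_mono ((integrable_const _).add (h.integrable_sq.div_const _)) h.integrable_exp_sq
      fun ω => by nlinarith [Real.add_one_le_exp (Y ω ^ 2 / 4)]
  rw [integral_add (integrable_const _) (h.integrable_sq.div_const _), integral_div] at h1
  simp only [integral_const, probReal_univ, smul_eq_mul, mul_one] at h1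
  have h2 := h.integral_exp_sq_le
  have h3 : √2 ≤ 3 / 2 := by rw [Real.sqrt_le_left (by norm_num)]; norm_num
  linarith

theorem exp_le_one_add_add_sq_mul_exp_abs (y : ℝ) :
    Real.exp y ≤ 1 + y + y ^ 2 * Real.exp |y| := by
  have h := Complex.norm_exp_sub_sum_le_norm_mul_exp (y : ℂ) 2
  simp only [Finset.sum_range_succ, Finset.sum_range_zero, pow_zero, Nat.factorial, pow_one] at h
  norm_num at h
  have h2 : ‖Complex.exp y - (1 + y)‖ = |Real.exp y - (1 + y)| := by
    rw [← Complex.ofReal_exp, ← Complex.ofReal_one, ← Complex.ofReal_add, ← Complex.ofReal_sub,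
      Complex.norm_real, Real.norm_eq_abs]
  rw [h2] at h
  linarith [le_abs_self (Real.exp y - (1 + y))]

/-- The right side contains exp((y² + 2)/4), the square of exp((y² + 2)/8). One factor absorbs the
polynomial (y² + 2)², with 128 = 2·8² from z² ≤ 2eᶻ; the other absorbs the exponential of the Taylor
remainder, whose argument is at most (y² + 2)/8. -/
theorem exp_centered_sq_le {y m s : ℝ} (hm0 : 0 ≤ m) (hm : m ≤ 2) (hs : |s| ≤ 1 / 8) :
    Real.exp (s * (y ^ 2 - m)) ≤
      1 + s * (y ^ 2 - m) + 128 * s ^ 2 * Real.exp (1 / 2) * Real.exp (y ^ 2 / 4) := by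
  have h1 := exp_le_one_add_add_sq_mul_exp_abs (s * (y ^ 2 - m))
  have hz : |y ^ 2 - m| ≤ y ^ 2 + 2 := by
    rw [abs_le]; constructor <;> nlinarith [sq_nonneg y]
  have habs : |s * (y ^ 2 - m)| ≤ (y ^ 2 + 2) / 8 := by
    rw [abs_mul]
    calc |s| * |y ^ 2 - m| ≤ 1 / 8 * (y ^ 2 + 2) := by gcongr
      _ = _ := by ring
  have hsq : (s * (y ^ 2 - m)) ^ 2 ≤ s ^ 2 * (y ^ 2 + 2) ^ 2 := by
    rw [mul_pow]
    gcongr s ^ 2 * ?_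
    exact sq_le_sq' (by linarith [(abs_le.1 hz).1]) (abs_le.1 hz).2
  have hq : (y ^ 2 + 2) ^ 2 ≤ 128 * Real.exp ((y ^ 2 + 2) / 8) := by
    have := Real.quadratic_le_exp_of_nonneg (x := (y ^ 2 + 2) / 8) (by positivity)
    nlinarith [sq_nonneg y]
  have he : Real.exp (1 / 2) * Real.exp (y ^ 2 / 4) =
      Real.exp ((y ^ 2 + 2) / 8) * Real.exp ((y ^ 2 + 2) / 8) := by
    rw [← Real.exp_add, ← Real.exp_add]; ring_nf
  have : (s * (y ^ 2 - m)) ^ 2 * Real.exp |s * (y ^ 2 - m)| ≤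
      s ^ 2 * (128 * Real.exp ((y ^ 2 + 2) / 8)) * Real.exp ((y ^ 2 + 2) / 8) := by
    gcongr
    exact hsq.trans (by gcongr)
  calc _ ≤ _ := h1
    _ ≤ 1 + s * (y ^ 2 - m) + s ^ 2 * (128 * Real.exp ((y ^ 2 + 2) / 8)) * Real.exp
      ((y ^ 2 + 2) / 8) := by
      gcongr
    _ = _ := by rw [mul_assoc (128 * s ^ 2), he]; ring

theorem IsStdSubGaussian.integrable_exp_centered_sq (h : IsStdSubGaussian μ Y) {s m : ℝ}
    (hm0 : 0 ≤ m) (hm : m ≤ 2) (hs : |s| ≤ 1 / 8) :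
    Integrable (fun ω => Real.exp (s * (Y ω ^ 2 - m))) μ := by
  have hY := h.measurable
  refine Integrable.mono' (g := fun ω => 1 + s * (Y ω ^ 2 - m) +
    128 * s ^ 2 * Real.exp (1 / 2) * Real.exp (Y ω ^ 2 / 4)) ?_ (by fun_prop)
    (Filter.Eventually.of_forall fun ω => ?_)
  · exact ((integrable_const _).add ((h.integrable_sq.sub (integrable_const _)).const_mul _)).add
      (h.integrable_exp_sq.const_mul _)
  · rw [Real.norm_of_nonneg (by positivity)]
    exact exp_centered_sq_le hm0 hm hs

/-- The linear term integrates to zero because the centring is the mean. The quadratic remainder is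
at most 128·2·(3/2)·s² = 384s². -/
theorem IsStdSubGaussian.integral_exp_centered_sq_le (h : IsStdSubGaussian μ Y) {s : ℝ}
    (hs : |s| ≤ 1 / 8) :
    ∫ ω, Real.exp (s * (Y ω ^ 2 - ∫ ω, Y ω ^ 2 ∂μ)) ∂μ ≤ Real.exp (512 * s ^ 2) := by
  set m := ∫ ω, Y ω ^ 2 ∂μ with hm
  have hm0 : 0 ≤ m := integral_nonneg fun ω => by positivity
  have hm2 : m ≤ 2 := h.integral_sq_le
  have i1 : Integrable (fun ω => s * (Y ω ^ 2 - m)) μ :=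
    (h.integrable_sq.sub (integrable_const _)).const_mul _
  have i2 : Integrable (fun ω => 1 + s * (Y ω ^ 2 - m)) μ := (integrable_const _).add i1
  have i3 : Integrable (fun ω => 128 * s ^ 2 * Real.exp (1 / 2) * Real.exp (Y ω ^ 2 / 4)) μ :=
    h.integrable_exp_sq.const_mul _
  have h1 : ∫ ω, Real.exp (s * (Y ω ^ 2 - m)) ∂μ ≤ ∫ ω, (1 + s * (Y ω ^ 2 - m) +
      128 * s ^ 2 * Real.exp (1 / 2) * Real.exp (Y ω ^ 2 / 4)) ∂μ :=
    integral_mono (h.integrable_exp_centered_sq hm0 hm2 hs) (i2.add i3)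
      fun ω => exp_centered_sq_le hm0 hm2 hs
  rw [integral_add i2 i3, integral_add (integrable_const _) i1, integral_const_mul,
    integral_sub h.integrable_sq (integrable_const _), integral_const_mul] at h1
  simp only [integral_const, probReal_univ, smul_eq_mul, mul_one, one_mul] at h1
  rw [← hm, sub_self, mul_zero, add_zero] at h1
  have h2 := h.integral_exp_sq_le
  have h3 : √2 ≤ 3 / 2 := by rw [Real.sqrt_le_left (by norm_num)]; norm_num
  have h4 : Real.exp (1 / 2) ≤ 2 := by
    have : Real.exp (1 / 2) ^ 2 ≤ 2 ^ 2 := by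
      rw [← Real.exp_nat_mul]; norm_num
      linarith [Real.exp_one_lt_d9]
    exact le_of_sq_le_sq this (by norm_num)
  have h5 : 128 * s ^ 2 * Real.exp (1 / 2) * ∫ ω, Real.exp (Y ω ^ 2 / 4) ∂μ ≤
      128 * s ^ 2 * 2 * (3 / 2) := by
    have : 0 ≤ ∫ ω, Real.exp (Y ω ^ 2 / 4) ∂μ := integral_nonneg fun ω => by positivity
    gcongr
    linarith
  nlinarith [Real.add_one_le_exp (512 * s ^ 2), sq_nonneg s]

end Square

/-! ### Concentration of empirical second moments -/

section Chernoff

variable {Ω : Type*} [MeasurableSpace Ω] {D : Measure Ω} [IsProbabilityMeasure D] {Y : Ω → ℝ}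
  {ι : Type*} [Fintype ι]

theorem measureReal_ge_le_exp_neg_mul_integral_exp {Ω : Type*} [MeasurableSpace Ω]
    {μ : Measure Ω} [IsFiniteMeasure μ] {X : Ω → ℝ}
    (h : Integrable (fun ω => Real.exp (X ω)) μ) (t : ℝ) :
    μ.real {ω | t ≤ X ω} ≤ Real.exp (-t) * ∫ ω, Real.exp (X ω) ∂μ := by
  have := measure_ge_le_exp_mul_mgf (μ := μ) (X := X) (t := 1) t zero_le_one (by simpa using h)
  simpa [mgf] using this

theorem IsStdSubGaussian.measure_sum_ge_le (h : IsStdSubGaussian D Y) {t s : ℝ}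
    (hs : |s| ≤ 1 / 8) :
    (Measure.pi fun _ : ι => D).real
      {z | t ≤ s * ∑ i, (Y (z i) ^ 2 - ∫ ω, Y ω ^ 2 ∂D)} ≤
        Real.exp (512 * s ^ 2 * Fintype.card ι - t) := by
  have h0 := h.integral_exp_centered_sq_le hs
  have h0' : ∀ m : ℝ, 0 ≤ m → m ≤ 2 → Integrable (fun ω => Real.exp (s * (Y ω ^ 2 - m))) D :=
    fun m hm0 hm => h.integrable_exp_centered_sq hm0 hm hs
  have hm0 : 0 ≤ ∫ ω, Y ω ^ 2 ∂D := integral_nonneg fun ω => by positivity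
  have hm2 : ∫ ω, Y ω ^ 2 ∂D ≤ 2 := h.integral_sq_le
  generalize ∫ ω, Y ω ^ 2 ∂D = m at *
  have hprod : ∀ z : ι → Ω, Real.exp (s * ∑ i, (Y (z i) ^ 2 - m)) =
      ∏ i, Real.exp (s * (Y (z i) ^ 2 - m)) := by
    intro z
    rw [Finset.mul_sum, Real.exp_sum]
  have hint : Integrable (fun z : ι → Ω => Real.exp (s * ∑ i, (Y (z i) ^ 2 - m)))
      (Measure.pi fun _ : ι => D) := by
    simp_rw [hprod]
    exact Integrable.fintype_prod fun i => h0' m hm0 hm2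
  refine (measureReal_ge_le_exp_neg_mul_integral_exp hint t).trans ?_
  simp_rw [hprod]
  have h2 := integral_fintype_prod_eq_pow (ι := ι) (μ := D) (fun x => Real.exp (s * (Y x ^ 2 - m)))
  rw [h2, sub_eq_neg_add, Real.exp_add]
  gcongr
  rw [mul_comm (512 * s ^ 2), Real.exp_nat_mul]
  exact pow_le_pow_left₀ (integral_nonneg fun ω => by positivity) h0 _

theorem IsStdSubGaussian.measure_abs_sum_ge_le (h : IsStdSubGaussian D Y) {t : ℝ} (ht0 : 0 ≤ t)
    (ht : t ≤ 1) :
    (Measure.pi fun _ : ι => D).real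
      {z | Fintype.card ι * t ≤ |∑ i, (Y (z i) ^ 2 - ∫ ω, Y ω ^ 2 ∂D)|} ≤
        2 * Real.exp (-(Fintype.card ι * t ^ 2 / 2048)) := by
  set m := ∫ ω, Y ω ^ 2 ∂D with hm
  -- The choice s = t/1024 minimises 512s² - st, with value -t²/2048; the two signs of s give the
  -- two tails.
  have hs : |t / 1024| ≤ 1 / 8 := by rw [abs_of_nonneg (by positivity)]; linarith
  have hs' : |-(t / 1024)| ≤ 1 / 8 := by rwa [abs_neg]
  have h1 := h.measure_sum_ge_le (ι := ι) (t := t / 1024 * (Fintype.card ι * t)) hs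
  have h2 := h.measure_sum_ge_le (ι := ι) (t := t / 1024 * (Fintype.card ι * t)) hs'
  rw [← hm] at h1 h2
  have hsub : {z : ι → Ω | Fintype.card ι * t ≤ |∑ i, (Y (z i) ^ 2 - m)|} ⊆
      {z | t / 1024 * (Fintype.card ι * t) ≤ t / 1024 * ∑ i, (Y (z i) ^ 2 - m)} ∪
      {z | t / 1024 * (Fintype.card ι * t) ≤ -(t / 1024) * ∑ i, (Y (z i) ^ 2 - m)} := by
    intro z hz
    rw [Set.mem_ofPred_eq] at hz
    rcases le_abs.1 hz with h | h
    · left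
      exact mul_le_mul_of_nonneg_left h (by positivity)
    · right
      rw [Set.mem_ofPred_eq, neg_mul, ← mul_neg]
      exact mul_le_mul_of_nonneg_left h (by positivity)
  refine (measureReal_mono hsub).trans ((measureReal_union_le _ _).trans ?_)
  refine (add_le_add h1 h2).trans_eq ?_
  rw [two_mul]
  congr 2 <;> ring

end Chernoff

/-! ### Quadratic forms -/

/-- The quadratic form of a matrix. -/
def quad {d : ℕ} (M : Matrix (Fin d) (Fin d) ℝ) (w : Vec d) : ℝ := inner ℝ w (matVec M w)

theorem matVec_apply {d : ℕ} (M : Matrix (Fin d) (Fin d) ℝ) (w : Vec d) (i : Fin d) :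
    matVec M w i = ∑ j, M i j * w j := rfl

theorem inner_eq_sum {d : ℕ} (u w : Vec d) : inner ℝ u w = ∑ j, u j * w j := by
  simp [PiLp.inner_apply, mul_comm]

theorem matVec_eq_toLpLin {d : ℕ} (M : Matrix (Fin d) (Fin d) ℝ) (w : Vec d) :
    matVec M w = Matrix.toLpLin 2 2 M w := rfl

theorem matVec_add {d : ℕ} (M : Matrix (Fin d) (Fin d) ℝ) (u w : Vec d) :
    matVec M (u + w) = matVec M u + matVec M w := by simp [matVec_eq_toLpLin]

theorem matVec_smul {d : ℕ} (M : Matrix (Fin d) (Fin d) ℝ) (c : ℝ) (w : Vec d) :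
    matVec M (c • w) = c • matVec M w := by simp [matVec_eq_toLpLin]

theorem matVec_sub {d : ℕ} (M : Matrix (Fin d) (Fin d) ℝ) (u w : Vec d) :
    matVec M (u - w) = matVec M u - matVec M w := by simp [matVec_eq_toLpLin]

theorem sub_matVec {d : ℕ} (M N : Matrix (Fin d) (Fin d) ℝ) (w : Vec d) :
    matVec (M - N) w = matVec M w - matVec N w := by simp [matVec_eq_toLpLin]

theorem continuous_matVec {d : ℕ} (M : Matrix (Fin d) (Fin d) ℝ) : Continuous (matVec M) :=
  (Matrix.toLpLin 2 2 M).continuous_of_finiteDimensional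

theorem continuous_quad {d : ℕ} (M : Matrix (Fin d) (Fin d) ℝ) : Continuous (quad M) :=
  continuous_id.inner (continuous_matVec M)

theorem quad_eq_sum {d : ℕ} (M : Matrix (Fin d) (Fin d) ℝ) (w : Vec d) :
    quad M w = ∑ i, ∑ j, w i * w j * M i j := by
  simp only [quad, inner_eq_sum, matVec_apply, Finset.mul_sum]
  exact Finset.sum_congr rfl fun i _ => Finset.sum_congr rfl fun j _ => by ring

theorem quad_sub {d : ℕ} (M N : Matrix (Fin d) (Fin d) ℝ) (w : Vec d) :
    quad (M - N) w = quad M w - quad N w := by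
  rw [quad, sub_matVec, inner_sub_right]; rfl

theorem quad_smul {d : ℕ} (M : Matrix (Fin d) (Fin d) ℝ) (c : ℝ) (w : Vec d) :
    quad M (c • w) = c ^ 2 * quad M w := by
  rw [quad, matVec_smul, real_inner_smul_left, real_inner_smul_right, quad]; ring

theorem quad_smul_matrix {d : ℕ} (M : Matrix (Fin d) (Fin d) ℝ) (c : ℝ) (w : Vec d) :
    quad (c • M) w = c * quad M w := by
  simp only [quad_eq_sum, Finset.mul_sum, Matrix.smul_apply, smul_eq_mul]
  exact Finset.sum_congr rfl fun i _ => Finset.sum_congr rfl fun j _ => by ring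

theorem inner_matVec_comm {d : ℕ} {M : Matrix (Fin d) (Fin d) ℝ} (hM : M.IsHermitian)
    (u w : Vec d) : inner ℝ (matVec M u) w = inner ℝ u (matVec M w) := by
  simp only [inner_eq_sum, matVec_apply, Finset.mul_sum, Finset.sum_mul]
  rw [Finset.sum_comm]
  refine Finset.sum_congr rfl fun i _ => Finset.sum_congr rfl fun j _ => ?_
  have : M j i = M i j := by simpa using congrFun (congrFun hM i) j
  rw [this]; ring

/-- Polarization, written with half sums so that the arguments stay in the unit ball when `u` and
`w` lie in it. -/
theorem quad_half_add_sub_quad_half_sub {d : ℕ} {M : Matrix (Fin d) (Fin d) ℝ}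
    (hM : M.IsHermitian) (u w : Vec d) :
    quad M ((1 / 2 : ℝ) • (u + w)) - quad M ((1 / 2 : ℝ) • (u - w)) = inner ℝ u (matVec M w) := by
  rw [quad_smul, quad_smul]
  simp only [quad, matVec_add, matVec_sub, inner_add_left, inner_add_right, inner_sub_left,
    inner_sub_right]
  rw [← inner_matVec_comm hM w u, real_inner_comm u (matVec M w)]
  ring

theorem isHermitian_empCov {n d : ℕ} (x : Fin n → Vec d) (J : Finset (Fin n)) :
    (empCov x J).IsHermitian := by
  ext i j
  simp [empCov, Matrix.sum_apply, Matrix.vecMulVec_apply, mul_comm]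

theorem quad_empCov {n d : ℕ} (x : Fin n → Vec d) (J : Finset (Fin n)) (w : Vec d) :
    quad (empCov x J) w = (J.card : ℝ)⁻¹ * ∑ j ∈ J, (inner ℝ w (x j)) ^ 2 := by
  rw [empCov, quad_smul_matrix]
  congr 1
  simp only [quad_eq_sum, Matrix.sum_apply, Matrix.vecMulVec_apply, Finset.mul_sum]
  simp_rw [Finset.sum_comm (t := J)]
  refine Finset.sum_congr rfl fun l _ => ?_
  rw [inner_eq_sum, sq, Finset.sum_mul_sum]
  exact Finset.sum_congr rfl fun i _ => Finset.sum_congr rfl fun j _ => by ring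

/-! ### Moments of sub-Gaussian vectors -/

section Moments

variable {d : ℕ} {D : Measure (Vec d)} {σ : ℝ}
  {Sig : Matrix (Fin d) (Fin d) ℝ}

theorem IsSubGaussian.isStdSubGaussian (h : IsSubGaussian σ D) (hσ : 0 < σ) {w : Vec d}
    (hw : ‖w‖ ≤ 1) : IsStdSubGaussian D (fun x => inner ℝ w x / σ) := by
  have key : ∀ (t : ℝ) (x : Vec d), t * (inner ℝ w x / σ) = inner ℝ ((t / σ) • w) x := by
    intro t x; rw [real_inner_smul_left]; ring
  refine ⟨by fun_prop, fun t => ?_, fun t => ?_⟩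
  · simp_rw [key]; exact (h _).1
  · simp_rw [key]
    refine (h _).2.trans (Real.exp_le_exp.2 ?_)
    rw [norm_smul, mul_pow, Real.norm_eq_abs, sq_abs]
    have : ‖w‖ ^ 2 ≤ 1 := pow_le_one₀ (norm_nonneg _) hw
    calc 1 / 2 * σ ^ 2 * ((t / σ) ^ 2 * ‖w‖ ^ 2) = t ^ 2 / 2 * ‖w‖ ^ 2 := by
          field_simp
      _ ≤ t ^ 2 / 2 * 1 := by gcongr
      _ = t ^ 2 / 2 := mul_one _

theorem IsSubGaussian.isStdSubGaussian_coord (h : IsSubGaussian σ D) (hσ : 0 < σ) (i : Fin d) :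
    IsStdSubGaussian D (fun x => x i / σ) := by
  have := h.isStdSubGaussian hσ (w := EuclideanSpace.single i 1) (by simp)
  simpa [EuclideanSpace.inner_single_left] using this

theorem IsStdSubGaussian.integrable {Ω : Type*} [MeasurableSpace Ω] {μ : Measure Ω}
    [IsProbabilityMeasure μ] {Y : Ω → ℝ} (h : IsStdSubGaussian μ Y) : Integrable Y μ :=
  ((memLp_two_iff_integrable_sq h.measurable.aestronglyMeasurable).2 h.integrable_sq).integrable
    (by norm_num)

/-- For |t| ≤ 1 one has 1 + tm ≤ E exp(tY) ≤ exp(t²/2) ≤ 1 + t², and a small multiple of m as t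
forces m = 0. This identifies the covariance of the model with the second moment that the algorithm
estimates. -/
theorem IsStdSubGaussian.integral_eq_zero {Ω : Type*} [MeasurableSpace Ω] {μ : Measure Ω}
    [IsProbabilityMeasure μ] {Y : Ω → ℝ} (h : IsStdSubGaussian μ Y) : ∫ ω, Y ω ∂μ = 0 := by
  set m := ∫ ω, Y ω ∂μ with hm
  have h1 : ∀ t : ℝ, |t| ≤ 1 → t * m ≤ t ^ 2 := by
    intro t ht
    have h2 : ∫ ω, (1 + t * Y ω) ∂μ ≤ ∫ ω, Real.exp (t * Y ω) ∂μ :=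
      integral_mono ((integrable_const _).add (h.integrable.const_mul _)) (h.integrable_exp t)
        fun ω => by linarith [Real.add_one_le_exp (t * Y ω)]
    rw [integral_add (integrable_const _) (h.integrable.const_mul _), integral_const_mul] at h2
    simp only [integral_const, probReal_univ, smul_eq_mul, mul_one] at h2
    have ht2 : t ^ 2 ≤ 1 := by rw [← sq_abs]; exact pow_le_one₀ (abs_nonneg _) ht
    have h3 : Real.exp (t ^ 2 / 2) ≤ 1 + t ^ 2 := by
      have h4 := Real.one_sub_le_exp_neg (t ^ 2 / 2)
      rw [Real.exp_neg] at h4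
      have h5 : 0 < 1 - t ^ 2 / 2 := by linarith
      have h6 : Real.exp (t ^ 2 / 2) ≤ (1 - t ^ 2 / 2)⁻¹ := by
        rw [le_inv_comm₀ (Real.exp_pos _) h5]; exact h4
      refine h6.trans ?_
      rw [inv_le_iff_one_le_mul₀ h5]
      nlinarith [sq_nonneg t]
    linarith [h.integral_exp_le t]
  have ha : 0 ≤ |m| := abs_nonneg m
  have h2 := h1 (m / (2 * (1 + |m|))) (by
    rw [abs_div, abs_of_pos (by positivity : 0 < 2 * (1 + |m|)), div_le_one (by positivity)]
    linarith)
  rw [div_pow, div_mul_eq_mul_div, div_le_div_iff₀ (by positivity) (by positivity)] at h2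
  have h3 : m ^ 2 * (2 * (1 + |m|)) * (1 + 2 * |m|) ≤ 0 := by nlinarith
  have h4 : m ^ 2 ≤ 0 := by
    by_contra hc
    push Not at hc
    have : 0 < m ^ 2 * (2 * (1 + |m|)) * (1 + 2 * |m|) := by positivity
    linarith
  exact pow_eq_zero_iff (two_ne_zero) |>.1 (le_antisymm h4 (sq_nonneg m))

variable [IsProbabilityMeasure D]

theorem IsSubGaussian.memLp_coord (h : IsSubGaussian σ D) (hσ : 0 < σ) (i : Fin d) :
    MemLp (fun x : Vec d => x i) 2 D := by
  have h1 := h.isStdSubGaussian_coord hσ i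
  have h2 := ((memLp_two_iff_integrable_sq h1.measurable.aestronglyMeasurable).2
    h1.integrable_sq).const_mul σ
  refine h2.congr_norm (by fun_prop) (Filter.Eventually.of_forall fun x => ?_)
  simp only
  rw [mul_div_cancel₀ _ hσ.ne']

theorem IsSubGaussian.integral_coord (h : IsSubGaussian σ D) (hσ : 0 < σ) (i : Fin d) :
    ∫ x, x i ∂D = 0 := by
  have h1 := (h.isStdSubGaussian_coord hσ i).integral_eq_zero
  rw [integral_div, div_eq_zero_iff] at h1
  exact h1.resolve_right hσ.ne'

theorem IsSubGaussian.integral_coord_mul_coord (h : IsSubGaussian σ D) (hσ : 0 < σ)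
    (hc : ∀ i j, Sig i j = covariance (fun x => x i) (fun x => x j) D) (i j : Fin d) :
    ∫ x, x i * x j ∂D = Sig i j := by
  rw [hc, covariance, h.integral_coord hσ, h.integral_coord hσ]
  simp

theorem IsSubGaussian.integral_inner_sq (h : IsSubGaussian σ D) (hσ : 0 < σ)
    (hc : ∀ i j, Sig i j = covariance (fun x => x i) (fun x => x j) D) (w : Vec d) :
    ∫ x, (inner ℝ w x) ^ 2 ∂D = quad Sig w := by
  have h1 : ∀ x : Vec d, (inner ℝ w x) ^ 2 = ∑ i, ∑ j, w i * w j * (x i * x j) := by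
    intro x
    rw [inner_eq_sum, sq, Finset.sum_mul_sum]
    exact Finset.sum_congr rfl fun i _ => Finset.sum_congr rfl fun j _ => by ring
  have h2 : ∀ i j : Fin d, Integrable (fun x : Vec d => w i * w j * (x i * x j)) D := fun i j =>
    ((h.memLp_coord hσ i).integrable_mul (h.memLp_coord hσ j)).const_mul _
  simp_rw [h1]
  rw [integral_finsetSum _ fun i _ => integrable_finsetSum _ fun j _ => h2 i j, quad_eq_sum]
  refine Finset.sum_congr rfl fun i _ => ?_
  rw [integral_finsetSum _ fun j _ => h2 i j]
  refine Finset.sum_congr rfl fun j _ => ?_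
  rw [integral_const_mul, h.integral_coord_mul_coord hσ hc]

theorem IsSubGaussian.quad_le (h : IsSubGaussian σ D) (hσ : 0 < σ)
    (hc : ∀ i j, Sig i j = covariance (fun x => x i) (fun x => x j) D) {w : Vec d}
    (hw : ‖w‖ ≤ 1) : quad Sig w ≤ 2 * σ ^ 2 := by
  have h1 := (h.isStdSubGaussian hσ hw).integral_sq_le
  simp_rw [div_pow] at h1
  rw [integral_div, h.integral_inner_sq hσ hc, div_le_iff₀ (by positivity)] at h1
  exact h1

/-! ### Deviations of the empirical second moment matrix -/

theorem IsSubGaussian.measure_abs_sum_inner_sq_ge_le {ι : Type*} [Fintype ι]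
    (h : IsSubGaussian σ D) (hσ : 0 < σ)
    (hc : ∀ i j, Sig i j = covariance (fun x => x i) (fun x => x j) D) {w : Vec d}
    (hw : ‖w‖ ≤ 1) {t : ℝ} (ht0 : 0 ≤ t) (ht : t ≤ 1) :
    (Measure.pi fun _ : ι => D)
      {z | Fintype.card ι * (σ ^ 2 * t) ≤ |∑ i, ((inner ℝ w (z i)) ^ 2 - quad Sig w)|} ≤
        ENNReal.ofReal (2 * Real.exp (-(Fintype.card ι * t ^ 2 / 2048))) := by
  have h1 := (h.isStdSubGaussian hσ hw).measure_abs_sum_ge_le (ι := ι) ht0 ht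
  rw [← ENNReal.ofReal_toReal (measure_ne_top _ _)]
  refine ENNReal.ofReal_le_ofReal (le_trans (measureReal_mono ?_) h1)
  intro z hz
  simp only [Set.mem_ofPred_eq] at hz ⊢
  simp_rw [div_pow]
  rw [integral_div, h.integral_inner_sq hσ hc]
  simp_rw [← sub_div]
  rw [← Finset.sum_div, abs_div, abs_of_pos (by positivity : 0 < σ ^ 2), le_div_iff₀
    (by positivity)]
  linarith

/-- The direction may be random as long as it ignores the samples in `J`: with the other samples
frozen, it is a constant vector and the tail bound for a fixed direction applies to each slice. This
is how an iterate meets its fresh batch. -/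
theorem IsSubGaussian.measure_abs_quad_ge_le {n : ℕ} (h : IsSubGaussian σ D) (hσ : 0 < σ)
    (hc : ∀ i j, Sig i j = covariance (fun x => x i) (fun x => x j) D)
    {J : Finset (Fin n)} (hJ : J.Nonempty) {U : (Fin n → Vec d) → Vec d} (hU : Measurable U)
    (hUJ : ∀ x x', (∀ j ∉ J, x j = x' j) → U x = U x') (hU1 : ∀ x, ‖U x‖ ≤ 1)
    {t : ℝ} (ht0 : 0 ≤ t) (ht : t ≤ 1) :
    (Measure.pi fun _ : Fin n => D) {x | σ ^ 2 * t ≤ |quad (empCov x J - Sig) (U x)|} ≤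
      ENNReal.ofReal (2 * Real.exp (-(J.card * t ^ 2 / 2048))) := by
  classical
  have hJ0 : (0 : ℝ) < J.card := by exact_mod_cast hJ.card_pos
  set S : Set (Fin n → Vec d) :=
    {x | J.card * (σ ^ 2 * t) ≤ |∑ j ∈ J, ((inner ℝ (U x) (x j)) ^ 2 - quad Sig (U x))|} with hS
  have hset : {x | σ ^ 2 * t ≤ |quad (empCov x J - Sig) (U x)|} ⊆ S := by
    intro x hx
    simp only [hS, Set.mem_ofPred_eq] at hx ⊢
    rw [quad_sub, quad_empCov] at hx
    rw [Finset.sum_sub_distrib, Finset.sum_const, nsmul_eq_mul]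
    have : ∑ j ∈ J, (inner ℝ (U x) (x j)) ^ 2 - J.card * quad Sig (U x) =
      J.card * ((J.card : ℝ)⁻¹ * ∑ j ∈ J, (inner ℝ (U x) (x j)) ^ 2 - quad Sig (U x)) := by
      field_simp
    rw [this, abs_mul, abs_of_pos hJ0]
    gcongr
  refine (measure_mono hset).trans ?_
  have hSm : MeasurableSet S := by
    refine measurableSet_le measurable_const ?_
    have hq : Measurable fun x => quad Sig (U x) := (continuous_quad Sig).measurable.comp hU
    have hi : ∀ j, Measurable fun x : Fin n → Vec d => (inner ℝ (U x) (x j) : ℝ) := fun j =>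
      hU.inner (measurable_pi_apply j)
    exact continuous_abs.measurable.comp
      (Finset.measurable_sum _ fun j _ => ((hi j).pow_const 2).sub hq)
  have hmp := measurePreserving_piEquivPiSubtypeProd (fun _ : Fin n => D) (· ∈ J)
  set e := MeasurableEquiv.piEquivPiSubtypeProd (fun _ : Fin n => Vec d) (· ∈ J) with he
  have h1 : S = e ⁻¹' (e.symm ⁻¹' S) := by
    ext x; simp
  have hS'm : MeasurableSet (e.symm ⁻¹' S) := e.symm.measurable hSm
  -- The product space is split into the coordinates in `J` and the rest; the slices have the rest
  -- fixed.
  rw [h1, hmp.measure_preimage hS'm.nullMeasurableSet, Measure.prod_apply_symm hS'm]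
  have hb : ∀ y : {j // j ∉ J} → Vec d,
      (Measure.pi fun _ : {j // j ∈ J} => D) ((fun z => (z, y)) ⁻¹' (e.symm ⁻¹' S)) ≤
        ENNReal.ofReal (2 * Real.exp (-(J.card * t ^ 2 / 2048))) := by
    intro y
    -- Any filling of the coordinates in `J` gives the same direction; zero is taken.
    set w := U (e.symm (0, y)) with hw
    have hz : ∀ z, U (e.symm (z, y)) = w := fun z => hUJ _ _ fun j hj => by
      simp [he, MeasurableEquiv.piEquivPiSubtypeProd, Equiv.piEquivPiSubtypeProd, hj]
    have h2 := h.measure_abs_sum_inner_sq_ge_le (ι := {j // j ∈ J}) hσ hc (w := w) (hU1 _) ht0 ht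
    rw [Fintype.card_coe] at h2
    refine le_trans (measure_mono ?_) h2
    intro z hzS
    simp only [hS, Set.mem_preimage, Set.mem_ofPred_eq] at hzS ⊢
    rw [hz] at hzS
    refine hzS.trans_eq ?_
    congr 1
    rw [← Finset.sum_coe_sort J]
    refine Finset.sum_congr rfl fun j _ => ?_
    simp [he, MeasurableEquiv.piEquivPiSubtypeProd, Equiv.piEquivPiSubtypeProd]
  refine (lintegral_mono (g := fun _ => ENNReal.ofReal (2 * Real.exp (-(J.card * t ^ 2 / 2048))))
    fun y => ?_).trans (by simp)
  convert hb y

/-- The bilinear version, by polarization. -/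
theorem IsSubGaussian.measure_abs_matVec_ge_le {n : ℕ} (h : IsSubGaussian σ D) (hσ : 0 < σ)
    (hc : ∀ i j, Sig i j = covariance (fun x => x i) (fun x => x j) D) (hSig : Sig.IsHermitian)
    {J : Finset (Fin n)} (hJ : J.Nonempty) {U : (Fin n → Vec d) → Vec d} (hU : Measurable U)
    (hUJ : ∀ x x', (∀ j ∉ J, x j = x' j) → U x = U x') (hU1 : ∀ x, ‖U x‖ ≤ 1)
    {t : ℝ} (ht0 : 0 ≤ t) (ht : t ≤ 1) (i : Fin d) :
    (Measure.pi fun _ : Fin n => D)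
      {x | 2 * (σ ^ 2 * t) ≤ |matVec (empCov x J - Sig) (U x) i|} ≤
      ENNReal.ofReal (4 * Real.exp (-(J.card * t ^ 2 / 2048))) := by
  set e : Vec d := EuclideanSpace.single i 1 with he
  have he1 : ‖e‖ = 1 := by simp [he]
  have key : ∀ (f : Vec d → Vec d) (hf : Measurable f) (hf1 : ∀ u, ‖u‖ ≤ 1 → ‖f u‖ ≤ 1),
      (Measure.pi fun _ : Fin n => D) {x | σ ^ 2 * t ≤ |quad (empCov x J - Sig) (f (U x))|} ≤
      ENNReal.ofReal (2 * Real.exp (-(J.card * t ^ 2 / 2048))) := fun f hf hf1 =>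
    h.measure_abs_quad_ge_le hσ hc hJ (U := fun x => f (U x)) (hf.comp hU)
      (fun x x' hx => by rw [hUJ x x' hx]) (fun x => hf1 _ (hU1 x)) ht0 ht
  have h1 := key (fun u => (1 / 2 : ℝ) • (e + u)) (by fun_prop) fun u hu => by
    rw [norm_smul, Real.norm_of_nonneg (by norm_num)]
    linarith [norm_add_le e u]
  have h2 := key (fun u => (1 / 2 : ℝ) • (e - u)) (by fun_prop) fun u hu => by
    rw [norm_smul, Real.norm_of_nonneg (by norm_num)]
    linarith [norm_sub_le e u]
  refine (measure_mono (t := {x | σ ^ 2 * t ≤ |quad (empCov x J - Sig) ((1 / 2 : ℝ) • (e + U x))|} ∪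
    {x | σ ^ 2 * t ≤ |quad (empCov x J - Sig) ((1 / 2 : ℝ) • (e - U x))|}) ?_).trans
      ((measure_union_le _ _).trans ((add_le_add h1 h2).trans_eq ?_))
  · intro x hx
    simp only [Set.mem_union, Set.mem_ofPred_eq] at hx ⊢
    by_contra hcon
    push Not at hcon
    have h3 := quad_half_add_sub_quad_half_sub ((isHermitian_empCov x J).sub hSig) e (U x)
    have h4 : inner ℝ e (matVec (empCov x J - Sig) (U x)) = matVec (empCov x J - Sig) (U x) i := by
      simp [he, EuclideanSpace.inner_single_left]
    rw [h4] at h3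
    rw [← h3] at hx
    have := abs_sub (quad (empCov x J - Sig) ((1 / 2 : ℝ) • (e + U x)))
      (quad (empCov x J - Sig) ((1 / 2 : ℝ) • (e - U x)))
    linarith [hcon.1, hcon.2]
  · rw [← ENNReal.ofReal_add (by positivity) (by positivity)]
    congr 1; ring

end Moments

/-! ### Quadratic forms on sparse vectors -/

theorem norm_sq_eq_sum {d : ℕ} (u : Vec d) : ‖u‖ ^ 2 = ∑ i, u i ^ 2 := by
  rw [EuclideanSpace.norm_sq_eq]; simp

/-- The points of a grid of mesh `1 / (4 r)` supported on at most `r` coordinates. -/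
def gridPoint {d : ℕ} (r : ℕ) (f : Fin r → Fin d × Fin (8 * r + 1)) : Vec d :=
  ∑ l, EuclideanSpace.single (f l).1 ((((f l).2 : ℕ) - 4 * r : ℝ) / (4 * r))

/-- Rounding goes towards zero, so that a rounded vector does not leave the unit ball. -/
theorem exists_int_abs_le_abs_sub_le (y : ℝ) : ∃ z : ℤ, |(z : ℝ)| ≤ |y| ∧ |y - z| ≤ 1 := by
  rcases le_total 0 y with h | h
  · refine ⟨⌊y⌋, ?_, ?_⟩
    · have : (0 : ℝ) ≤ ⌊y⌋ := by exact_mod_cast Int.floor_nonneg.2 h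
      rw [abs_of_nonneg this, abs_of_nonneg h]; exact Int.floor_le y
    · rw [abs_le]; constructor <;> linarith [Int.floor_le y, Int.lt_floor_add_one y]
  · refine ⟨⌈y⌉, ?_, ?_⟩
    · have : (⌈y⌉ : ℝ) ≤ 0 := by exact_mod_cast Int.ceil_le.2 (by simpa using h)
      rw [abs_of_nonpos this, abs_of_nonpos h]; linarith [Int.le_ceil y]
    · rw [abs_le]; constructor <;> linarith [Int.le_ceil y, Int.ceil_lt_add_one y]

theorem abs_apply_le_norm {d : ℕ} (u : Vec d) (i : Fin d) : |u i| ≤ ‖u‖ := by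
  simpa using PiLp.norm_apply_le u i

/-- Each of the `r` coordinates is rounded towards zero to a multiple of 1/(4r), so the error has
norm at most √r/(4r) ≤ 1/4. The multiples range over -4r, …, 4r and are encoded in `Fin (8 * r + 1)`
by a shift of 4r. -/
theorem exists_gridPoint_near {d r : ℕ} (hr : 1 ≤ r) {A : Finset (Fin d)} (hA : A.card = r)
    {u : Vec d} (hu : ∀ i ∉ A, u i = 0) (hu1 : ‖u‖ ≤ 1) :
    ∃ f, ‖gridPoint r f‖ ≤ 1 ∧ (∀ i ∉ A, gridPoint r f i = 0) ∧ ‖u - gridPoint r f‖ ≤ 1 / 4 := by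
  have hr0 : (0 : ℝ) < r := by exact_mod_cast hr
  have hr1 : (1 : ℝ) ≤ r := by exact_mod_cast hr
  choose z hz1 hz2 using fun i => exists_int_abs_le_abs_sub_le (4 * r * u i)
  have hzb : ∀ i, |(z i : ℝ)| ≤ 4 * r := fun i => by
    refine (hz1 i).trans ?_
    rw [abs_mul, abs_of_pos (by positivity)]
    have := (abs_apply_le_norm u i).trans hu1
    nlinarith
  have hzb' : ∀ i, -(4 * r : ℤ) ≤ z i ∧ z i ≤ 4 * r := fun i => by
    have := abs_le.1 (hzb i)
    exact ⟨by exact_mod_cast this.1, by exact_mod_cast this.2⟩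
  let a : Fin r ≃ A := (A.equivFinOfCardEq hA).symm
  let f : Fin r → Fin d × Fin (8 * r + 1) := fun l =>
    (a l, ⟨(z (a l) + 4 * r).toNat, by have := hzb' (a l); omega⟩)
  have hcoord : ∀ l, ((((f l).2 : ℕ) : ℝ) - 4 * r) / (4 * r) = z (a l) / (4 * r) := by
    intro l
    have : (((f l).2 : ℕ) : ℤ) = z (a l) + 4 * r := Int.toNat_of_nonneg
      (by have := hzb' (a l); omega)
    have h2 : (((f l).2 : ℕ) : ℝ) = z (a l) + 4 * r := by exact_mod_cast this
    rw [h2]; ring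
  have happ : ∀ i, gridPoint r f i = ∑ l, if i = a l then (z (a l) : ℝ) / (4 * r) else 0 := by
    intro i
    simp only [gridPoint, hcoord]
    rw [WithLp.ofLp_sum, Finset.sum_apply]
    refine Finset.sum_congr rfl fun l _ => ?_
    simp [f, EuclideanSpace.single]
  have hin : ∀ i ∈ A, gridPoint r f i = z i / (4 * r) := by
    intro i hi
    rw [happ, Finset.sum_eq_single (a.symm ⟨i, hi⟩)]
    · simp
    · intro l _ hl
      rw [if_neg]
      rintro rfl
      exact hl (by simp)
    · simp
  have hout : ∀ i ∉ A, gridPoint r f i = 0 := by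
    intro i hi
    rw [happ]
    refine Finset.sum_eq_zero fun l _ => if_neg ?_
    rintro rfl
    exact hi (a l).2
  refine ⟨f, ?_, hout, ?_⟩
  · refine le_trans (le_of_sq_le_sq ?_ (norm_nonneg u)) hu1
    rw [norm_sq_eq_sum, norm_sq_eq_sum]
    refine Finset.sum_le_sum fun i _ => ?_
    by_cases hi : i ∈ A
    · rw [hin i hi, ← sq_abs, ← sq_abs (u i), abs_div, abs_of_pos (by positivity : (0 : ℝ) < 4 * r)]
      gcongr
      rw [div_le_iff₀ (by positivity)]
      have := hz1 i
      rw [abs_mul, abs_of_pos (by positivity : (0 : ℝ) < 4 * r)] at this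
      linarith
    · rw [hout i hi, hu i hi]
  · refine le_of_sq_le_sq ?_ (by norm_num)
    rw [norm_sq_eq_sum]
    have hb : ∀ i, (u - gridPoint r f) i ^ 2 ≤ if i ∈ A then (1 / (4 * r : ℝ)) ^ 2 else 0 := by
      intro i
      split_ifs with hi
      · rw [PiLp.sub_apply, hin i hi, ← sq_abs]
        gcongr
        have h1 : u i - z i / (4 * r) = (4 * r * u i - z i) / (4 * r) := by field_simp
        rw [h1, abs_div, abs_of_pos (by positivity : (0 : ℝ) < 4 * r)]
        gcongr
        exact hz2 i
      · rw [PiLp.sub_apply, hout i hi, hu i hi]; simp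
    refine (Finset.sum_le_sum fun i _ => hb i).trans ?_
    rw [Finset.sum_ite_mem, Finset.univ_inter, Finset.sum_const, hA, nsmul_eq_mul, div_pow, one_pow]
    rw [mul_one_div, div_le_iff₀ (by positivity)]
    nlinarith

theorem isCompact_supported_unitBall {d : ℕ} (A : Finset (Fin d)) :
    IsCompact {u : Vec d | (∀ i ∉ A, u i = 0) ∧ ‖u‖ ≤ 1} := by
  have : {u : Vec d | (∀ i ∉ A, u i = 0) ∧ ‖u‖ ≤ 1} =
      (⋂ i, ⋂ (_ : i ∉ A), {u : Vec d | u i = 0}) ∩ Metric.closedBall 0 1 := by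
    ext u; simp
  rw [this]
  refine (isCompact_closedBall _ _).inter_left ?_
  exact isClosed_iInter fun i => isClosed_iInter fun _ =>
    isClosed_eq (by fun_prop) continuous_const

/-- A bound for a quadratic form on the grid yields twice that bound on all sparse vectors. -/
theorem abs_quad_le_of_gridPoint {d r : ℕ} (hr : 1 ≤ r) {M : Matrix (Fin d) (Fin d) ℝ}
    (hM : M.IsHermitian) {A : Finset (Fin d)} (hA : A.card = r) {ρ : ℝ}
    (hρ : ∀ f, ‖gridPoint (d := d) r f‖ ≤ 1 → |quad M (gridPoint r f)| ≤ ρ)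
    {u : Vec d} (hu : ∀ i ∉ A, u i = 0) (hu1 : ‖u‖ ≤ 1) : |quad M u| ≤ 2 * ρ := by
  -- A maximiser over the vectors supported on `A` is compared with a nearby grid point, which
  -- bounds the maximum by ρ plus half of itself.
  obtain ⟨u₀, ⟨hu₀, hu₀1⟩, hmax⟩ := (isCompact_supported_unitBall A).exists_isMaxOn
    ⟨0, by simp⟩ ((continuous_quad M).abs.continuousOn)
  set C := |quad M u₀| with hC
  have hC0 : 0 ≤ C := abs_nonneg _
  have hunit : ∀ w : Vec d, (∀ i ∉ A, w i = 0) → ‖w‖ ≤ 1 → |quad M w| ≤ C :=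
    fun w hw hw1 => hmax ⟨hw, hw1⟩
  have hhom : ∀ w : Vec d, (∀ i ∉ A, w i = 0) → |quad M w| ≤ C * ‖w‖ ^ 2 := by
    intro w hw
    by_cases hw0 : w = 0
    · subst hw0; simp [quad]
    have hn : 0 < ‖w‖ := norm_pos_iff.2 hw0
    have h1 := hunit (‖w‖⁻¹ • w) (fun i hi => by simp [hw i hi]) (by
      rw [norm_smul, norm_inv, norm_norm, inv_mul_cancel₀ hn.ne'])
    rw [quad_smul, abs_mul, abs_of_nonneg (by positivity), inv_pow, inv_mul_le_iff₀
      (by positivity)] at h1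
    linarith
  have hbil : ∀ x y : Vec d, (∀ i ∉ A, x i = 0) → (∀ i ∉ A, y i = 0) → ‖x‖ ≤ 1 → ‖y‖ ≤ 1 →
      |inner ℝ x (matVec M y)| ≤ C := by
    intro x y hx hy hx1 hy1
    rw [← quad_half_add_sub_quad_half_sub hM]
    have h1 := hhom ((1 / 2 : ℝ) • (x + y)) fun i hi => by simp [hx i hi, hy i hi]
    have h2 := hhom ((1 / 2 : ℝ) • (x - y)) fun i hi => by simp [hx i hi, hy i hi]
    have h3 := parallelogram_law_with_norm ℝ x y
    rw [norm_smul, Real.norm_of_nonneg (by norm_num), mul_pow] at h1 h2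
    have h4 := abs_sub (quad M ((1 / 2 : ℝ) • (x + y))) (quad M ((1 / 2 : ℝ) • (x - y)))
    have h5 : ‖x‖ ^ 2 ≤ 1 := pow_le_one₀ (norm_nonneg _) hx1
    have h6 : ‖y‖ ^ 2 ≤ 1 := pow_le_one₀ (norm_nonneg _) hy1
    have h7 : ‖x + y‖ ^ 2 + ‖x - y‖ ^ 2 ≤ 4 := by nlinarith
    nlinarith
  have hfin : C ≤ 2 * ρ := by
    obtain ⟨f, hf1, hfA, hfu⟩ := exists_gridPoint_near hr hA hu₀ hu₀1
    set w := gridPoint r f with hw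
    have h1 := hρ f hf1
    -- The two quadratic forms differ by ⟨u₀ - w, M(u₀ + w)⟩. Since ‖u₀ - w‖ ≤ 1/4, both rescaled
    -- arguments lie in the unit ball, so the difference is at most C/2.
    have h2 := hbil ((4 : ℝ) • (u₀ - w)) ((1 / 2 : ℝ) • (u₀ + w))
      (fun i hi => by simp [hu₀ i hi, hfA i hi]) (fun i hi => by simp [hu₀ i hi, hfA i hi])
      (by rw [norm_smul, Real.norm_of_nonneg (by norm_num)]; linarith)
      (by
        rw [norm_smul, Real.norm_of_nonneg (by norm_num)]
        linarith [norm_add_le u₀ w])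
    have h3 : inner ℝ ((4 : ℝ) • (u₀ - w)) (matVec M ((1 / 2 : ℝ) • (u₀ + w))) =
        2 * (quad M u₀ - quad M w) := by
      rw [matVec_smul, real_inner_smul_left, real_inner_smul_right, matVec_add, inner_add_right,
        inner_sub_left, inner_sub_left, ← inner_matVec_comm hM u₀ w,
        real_inner_comm w (matVec M u₀), quad, quad]
      ring
    rw [h3, abs_mul, abs_of_pos (by norm_num : (0 : ℝ) < 2)] at h2
    have h4 := abs_sub_abs_le_abs_sub (quad M u₀) (quad M w)
    rw [← hw] at h1
    linarith
  exact (hunit u hu hu1).trans hfin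

section Uniform

variable {d : ℕ} {D : Measure (Vec d)} [IsProbabilityMeasure D] {σ : ℝ}
  {Sig : Matrix (Fin d) (Fin d) ℝ}

theorem exists_card_eq_of_nnz_le {d r : ℕ} (hrd : r ≤ d) {u : Vec d} (hu : nnz u ≤ r) :
    ∃ A : Finset (Fin d), A.card = r ∧ ∀ i ∉ A, u i = 0 := by
  obtain ⟨A, hA1, hA2⟩ := Finset.exists_superset_card_eq (s := Finset.univ.filter fun j => u j ≠ 0)
    (n := r) hu (by simpa using hrd)
  refine ⟨A, hA2, fun i hi => ?_⟩
  by_contra hne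
  exact hi (hA1 (by simpa using hne))

/-- The empirical quadratic form is uniformly close to the population one on sparse vectors. -/
theorem IsSubGaussian.measure_exists_sparse_quad_ge_le {n r : ℕ} (h : IsSubGaussian σ D)
    (hσ : 0 < σ) (hc : ∀ i j, Sig i j = covariance (fun x => x i) (fun x => x j) D)
    (hSig : Sig.IsHermitian) (hn : 0 < n) (hr : 1 ≤ r) (hrd : r ≤ d)
    {t : ℝ} (ht0 : 0 ≤ t) (ht : t ≤ 1) :
    (Measure.pi fun _ : Fin n => D)
      {x | ∃ u : Vec d, nnz u ≤ r ∧ ‖u‖ ≤ 1 ∧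
        2 * (σ ^ 2 * t) < |quad (empCov x Finset.univ) u - quad Sig u|} ≤
      ENNReal.ofReal ((d * (8 * r + 1)) ^ r * (2 * Real.exp (-(n * t ^ 2 / 2048)))) := by
  classical
  have hne : (Finset.univ : Finset (Fin n)).Nonempty := ⟨⟨0, hn⟩, Finset.mem_univ _⟩
  set bad : (Fin r → Fin d × Fin (8 * r + 1)) → Set (Fin n → Vec d) := fun f =>
    {x | ‖gridPoint r f‖ ≤ 1 ∧ σ ^ 2 * t ≤ |quad (empCov x Finset.univ - Sig) (gridPoint r f)|}
  have hbad : ∀ f, (Measure.pi fun _ : Fin n => D) (bad f) ≤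
      ENNReal.ofReal (2 * Real.exp (-(n * t ^ 2 / 2048))) := by
    intro f
    by_cases hf : ‖gridPoint r f‖ ≤ 1
    · have h1 := h.measure_abs_quad_ge_le hσ hc hne (U := fun _ => gridPoint r f)
        measurable_const (fun _ _ _ => rfl) (fun _ => hf) ht0 ht
      rw [Finset.card_univ, Fintype.card_fin] at h1
      exact (measure_mono fun x hx => hx.2).trans h1
    · have : bad f = ∅ := by ext x; simp [bad, hf]
      rw [this, measure_empty]; exact zero_le
  refine (measure_mono (t := ⋃ f ∈ (Finset.univ : Finset _), bad f) ?_).trans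
    ((measure_biUnion_finset_le _ _).trans ((Finset.sum_le_sum fun f _ => hbad f).trans_eq ?_))
  · rintro x ⟨u, hu, hu1, hux⟩
    by_contra hcon
    simp only [Set.mem_iUnion, not_exists, Finset.mem_univ, bad, Set.mem_ofPred_eq,
      not_and, not_le, forall_const] at hcon
    obtain ⟨A, hA, huA⟩ := exists_card_eq_of_nnz_le hrd hu
    have h1 := abs_quad_le_of_gridPoint hr ((isHermitian_empCov x Finset.univ).sub hSig) hA
      (ρ := σ ^ 2 * t) (fun f hf => (hcon f hf).le) huA hu1
    rw [quad_sub] at h1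
    linarith
  · rw [Finset.sum_const, Finset.card_univ, nsmul_eq_mul, Fintype.card_fun, Fintype.card_prod,
      Fintype.card_fin, Fintype.card_fin, Fintype.card_fin,
      ENNReal.ofReal_mul (p := (d * (8 * r + 1) : ℝ) ^ r) (by positivity)]
    congr 1
    rw [← ENNReal.ofReal_natCast]
    push_cast
    rfl

end Uniform

/-! ### Restriction of vectors to sets of coordinates -/

/-- The vector `y` with the coordinates outside `B` set to zero. -/
def res {d : ℕ} (B : Finset (Fin d)) (y : Vec d) : Vec d :=
  WithLp.toLp 2 fun i => if i ∈ B then y i else 0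

section Res

variable {d : ℕ} (B : Finset (Fin d)) (y z : Vec d)

theorem res_apply (i : Fin d) : res B y i = if i ∈ B then y i else 0 := rfl

theorem res_add : res B (y + z) = res B y + res B z := by
  ext i; simp only [res_apply, PiLp.add_apply]; split_ifs <;> simp

theorem norm_res_sq : ‖res B y‖ ^ 2 = ∑ i ∈ B, y i ^ 2 := by
  rw [norm_sq_eq_sum]
  simp only [res_apply, ite_pow, ne_eq, OfNat.ofNat_ne_zero, not_false_eq_true, zero_pow]
  rw [Finset.sum_ite_mem, Finset.univ_inter]

theorem norm_res_le : ‖res B y‖ ≤ ‖y‖ := by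
  refine le_of_sq_le_sq ?_ (norm_nonneg y)
  rw [norm_res_sq, norm_sq_eq_sum]
  exact Finset.sum_le_sum_of_subset_of_nonneg (Finset.subset_univ _) fun i _ _ => sq_nonneg _

variable {B y}

theorem norm_res_le_of_abs_le {ε : ℝ} (hε : 0 ≤ ε) (hy : ∀ i, |y i| ≤ ε) {m : ℝ}
    (hB : (B.card : ℝ) ≤ m) : ‖res B y‖ ≤ √m * ε := by
  refine le_of_sq_le_sq ?_ (by positivity)
  rw [norm_res_sq, mul_pow, Real.sq_sqrt ((Nat.cast_nonneg _).trans hB)]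
  calc ∑ i ∈ B, y i ^ 2 ≤ ∑ i ∈ B, ε ^ 2 :=
        Finset.sum_le_sum fun i _ => sq_le_sq' (by linarith [(abs_le.1 (hy i)).1])
          (abs_le.1 (hy i)).2
    _ = B.card * ε ^ 2 := by rw [Finset.sum_const, nsmul_eq_mul]
    _ ≤ m * ε ^ 2 := by gcongr

theorem res_eq_self (h : ∀ i ∉ B, y i = 0) : res B y = y := by
  ext i; rw [res_apply]; split_ifs with hi
  · rfl
  · exact (h i hi).symm

theorem res_eq_zero (h : ∀ i ∈ B, y i = 0) : res B y = 0 := by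
  ext i; rw [res_apply]; split_ifs with hi
  · exact h i hi
  · rfl

/-- The entries dropped by a truncation are small compared with any set of kept entries. -/
theorem norm_res_sdiff_le {S A : Finset (Fin d)} {s r : ℕ} {η : ℝ} (hη : 0 ≤ η)
    (hS : S.card ≤ s) (hA : A.card = r) (hsr : s < r) (hηs : (s : ℝ) ≤ η ^ 2 * (r - s))
    (htop : ∀ i ∈ A, ∀ j ∉ A, |y j| ≤ |y i|) :
    ‖res (S \ A) y‖ ≤ η * ‖res (A \ S) y‖ := by
  have hsr' : (0 : ℝ) < r - s := by rw [sub_pos]; exact_mod_cast hsr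
  refine le_of_sq_le_sq ?_ (by positivity)
  rw [mul_pow, norm_res_sq, norm_res_sq]
  set a := ∑ i ∈ S \ A, y i ^ 2
  set b := ∑ i ∈ A \ S, y i ^ 2
  have ha : 0 ≤ a := Finset.sum_nonneg fun i _ => sq_nonneg _
  have hb : 0 ≤ b := Finset.sum_nonneg fun i _ => sq_nonneg _
  -- Double counting: every kept entry outside `S` dominates every dropped entry in `S`, summed over
  -- all pairs.
  have h1 : ((A \ S).card : ℝ) * a ≤ (S \ A).card * b := by
    have h2 : ∑ i ∈ A \ S, ∑ j ∈ S \ A, y j ^ 2 ≤ ∑ i ∈ A \ S, ∑ j ∈ S \ A, y i ^ 2 :=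
      Finset.sum_le_sum fun i hi => Finset.sum_le_sum fun j hj =>
        sq_le_sq.2 (htop i (Finset.mem_sdiff.1 hi).1 j (Finset.mem_sdiff.1 hj).2)
    simp only [Finset.sum_const, nsmul_eq_mul] at h2
    rwa [← Finset.mul_sum] at h2
  have h2 : (r - s : ℝ) ≤ (A \ S).card := by
    have : A.card - S.card ≤ (A \ S).card := Finset.le_card_sdiff S A
    have h3 : r ≤ (A \ S).card + s := by omega
    have : (r : ℝ) ≤ (A \ S).card + s := by exact_mod_cast h3
    linarith
  have h3 : ((S \ A).card : ℝ) ≤ s := by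
    exact_mod_cast (Finset.card_le_card Finset.sdiff_subset).trans hS
  have h4 : (r - s : ℝ) * a ≤ (r - s) * (η ^ 2 * b) := by
    calc (r - s : ℝ) * a ≤ (A \ S).card * a := by gcongr
      _ ≤ (S \ A).card * b := h1
      _ ≤ s * b := by gcongr
      _ ≤ (η ^ 2 * (r - s)) * b := by gcongr
      _ = _ := by ring
  exact le_of_mul_le_mul_left h4 hsr'

end Res

/-! ### One step of the truncated power method -/

/-- `W` is an invariant subspace of `M` of vectors supported on `S`, on which `M` expands by at
least `lam`, whereas `M` expands by at most `(1 - g) lam` on the orthogonal complement. -/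
structure SparseGap {d : ℕ} (M : Matrix (Fin d) (Fin d) ℝ) (W : Submodule ℝ (Vec d))
    (S : Finset (Fin d)) (lam g : ℝ) : Prop where
  support : ∀ w ∈ W, ∀ i ∉ S, w i = 0
  mem : ∀ a ∈ W, matVec M a ∈ W
  le : ∀ a ∈ W, lam * ‖a‖ ≤ ‖matVec M a‖
  mem_orthogonal : ∀ b ∈ Wᗮ, matVec M b ∈ Wᗮ
  le_orthogonal : ∀ b ∈ Wᗮ, ‖matVec M b‖ ≤ (1 - g) * lam * ‖b‖

section Step

variable {d : ℕ} {M : Matrix (Fin d) (Fin d) ℝ} {W : Submodule ℝ (Vec d)} {S : Finset (Fin d)}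
  {lam g : ℝ}

theorem norm_sub_starProjection_le (W : Submodule ℝ (Vec d)) (x : Vec d) :
    ‖x - W.starProjection x‖ ≤ ‖x‖ := by
  rw [← Submodule.starProjection_orthogonal_val]
  exact Submodule.norm_starProjection_apply_le _ x

theorem norm_sq_eq_starProjection_add (W : Submodule ℝ (Vec d)) (x : Vec d) :
    ‖W.starProjection x‖ ^ 2 + ‖x - W.starProjection x‖ ^ 2 = ‖x‖ ^ 2 := by
  rw [← Submodule.starProjection_orthogonal_val]
  exact (Submodule.norm_sq_eq_add_norm_sq_starProjection x W).symm

theorem SparseGap.starProjection_eq_zero (h : SparseGap M W S lam g) {x : Vec d}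
    (hx : ∀ i ∈ S, x i = 0) : W.starProjection x = 0 := by
  rw [Submodule.starProjection_apply_eq_zero_iff, Submodule.mem_orthogonal]
  intro w hw
  rw [inner_eq_sum]
  refine Finset.sum_eq_zero fun i _ => ?_
  by_cases hi : i ∈ S
  · rw [hx i hi, mul_zero]
  · rw [h.support w hw i hi, zero_mul]

/-- The projection onto `W` sees only the coordinates in `S`, so a restriction that keeps `S` is
invisible to it. -/
theorem SparseGap.starProjection_res (h : SparseGap M W S lam g) {B : Finset (Fin d)}
    (hB : S ⊆ B) (x : Vec d) : W.starProjection (res B x) = W.starProjection x := by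
  rw [← sub_eq_zero, ← map_sub]
  refine h.starProjection_eq_zero fun i hi => ?_
  rw [PiLp.sub_apply, res_apply, if_pos (hB hi), sub_self]

theorem SparseGap.starProjection_matVec (h : SparseGap M W S lam g) (u : Vec d) :
    W.starProjection (matVec M u) = matVec M (W.starProjection u) := by
  have h1 : matVec M u = matVec M (W.starProjection u) + matVec M (u - W.starProjection u) := by
    rw [← matVec_add, add_sub_cancel]
  have h2 : W.starProjection (matVec M (W.starProjection u)) = matVec M (W.starProjection u) :=
    Submodule.starProjection_eq_self_iff.2 (h.mem _ (Submodule.starProjection_apply_mem W u))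
  have h3 : W.starProjection (matVec M (u - W.starProjection u)) = 0 :=
    (Submodule.starProjection_apply_eq_zero_iff W).2
      (h.mem_orthogonal _ (Submodule.sub_starProjection_mem_orthogonal u))
  conv_lhs => rw [h1, map_add, h2, h3, add_zero]

/-- With b the component of `u` orthogonal to `W`, the vector before truncation is M(Pu) + (Mb + E),
whose first term lives on `S`. Truncation to `A` is restriction to `S ∪ A` minus the dropped part on
`S \ A`. That part is at most η times the kept part on `A \ S`, where only Mb + E is present. Noise
reaches the component in `W` only through `S`, hence the √s there, and reaches the complement
through `S ∪ A`, hence √(s + r). -/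
theorem SparseGap.truncated_step (h : SparseGap M W S lam g) {s r : ℕ} {η ε : ℝ} (hη : 0 ≤ η)
    (hε : 0 ≤ ε) (hS : S.card ≤ s) (hsr : s < r) (hηs : (s : ℝ) ≤ η ^ 2 * (r - s))
    {u E z : Vec d} (hE : ∀ i, |E i| ≤ ε) (hz : IsTopTruncation r (matVec M u + E) z) :
    lam * ‖W.starProjection u‖ - √s * ε -
        η * ((1 - g) * lam * ‖u - W.starProjection u‖ + √r * ε) ≤ ‖W.starProjection z‖ ∧
    ‖z - W.starProjection z‖ ≤ (1 - g) * lam * ‖u - W.starProjection u‖ + √(s + r) * ε +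
        η * ((1 - g) * lam * ‖u - W.starProjection u‖ + √r * ε) := by
  obtain ⟨A, hA, htop, hzA⟩ := hz
  set y := matVec M u + E with hy
  set P := W.starProjection with hP
  set b := u - P u with hb
  have hbW : b ∈ Wᗮ := Submodule.sub_starProjection_mem_orthogonal u
  have hz' : z = res (S ∪ A) y - res (S \ A) y := by
    ext i
    rw [hzA, PiLp.sub_apply, res_apply, res_apply]
    by_cases h1 : i ∈ S <;> by_cases h2 : i ∈ A <;> simp [h1, h2]
  have hMb := h.le_orthogonal b hbW
  have hyb : y = matVec M (P u) + (matVec M b + E) := by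
    rw [hy, hb, matVec_sub]; abel
  have hloss : ‖res (S \ A) y‖ ≤ η * ((1 - g) * lam * ‖b‖ + √r * ε) := by
    refine (norm_res_sdiff_le hη hS hA hsr hηs htop).trans ?_
    gcongr
    rw [hyb, res_add, res_add, res_eq_zero, zero_add]
    · refine (norm_add_le _ _).trans (add_le_add ((norm_res_le _ _).trans hMb) ?_)
      refine norm_res_le_of_abs_le hε hE ?_
      rw [← hA]
      exact_mod_cast Finset.card_le_card Finset.sdiff_subset
    · intro i hi
      exact h.support _ (h.mem _ (Submodule.starProjection_apply_mem W u)) i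
        (Finset.mem_sdiff.1 hi).2
  have hPy : P (res (S ∪ A) y) = P y := h.starProjection_res Finset.subset_union_left y
  have hPu : P y = matVec M (P u) + P (res S E) := by
    rw [hy, map_add, h.starProjection_matVec, h.starProjection_res subset_rfl]
  constructor
  · have h1 : ‖P (res (S \ A) y)‖ ≤ ‖res (S \ A) y‖ := Submodule.norm_starProjection_apply_le _ _
    have h2 : ‖P (res S E)‖ ≤ √s * ε := (Submodule.norm_starProjection_apply_le _ _).trans
      (norm_res_le_of_abs_le hε hE (by exact_mod_cast hS))
    have h3 := h.le (P u) (Submodule.starProjection_apply_mem W u)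
    rw [hz', map_sub, hPy, hPu]
    have h4 := norm_sub_norm_le (matVec M (P u) + P (res S E)) (P (res (S \ A) y))
    have h5 := norm_sub_le (matVec M (P u) + P (res S E)) (P (res S E))
    rw [add_sub_cancel_right] at h5
    linarith
  · have h1 : z - P z = res (S ∪ A) (matVec M b) +
        (res (S ∪ A) E - P (res (S ∪ A) E)) - (res (S \ A) y - P (res (S \ A) y)) := by
      have h2 : res (S ∪ A) y = matVec M (P u) + res (S ∪ A) (matVec M b) + res (S ∪ A) E := by
        conv_lhs => rw [hyb, res_add, res_add]
        rw [res_eq_self (y := matVec M (P u)), add_assoc]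
        intro i hi
        exact h.support _ (h.mem _ (Submodule.starProjection_apply_mem W u)) i
          fun hS => hi (Finset.mem_union_left _ hS)
      have h3 : P z = matVec M (P u) + P (res (S ∪ A) E) - P (res (S \ A) y) := by
        rw [hz', map_sub, hPy, hPu, h.starProjection_res subset_rfl,
          h.starProjection_res Finset.subset_union_left]
      rw [h3]
      conv_lhs => rw [hz', h2]
      abel
    rw [h1]
    refine (norm_sub_le _ _).trans (add_le_add ((norm_add_le _ _).trans (add_le_add ?_ ?_)) ?_)
    · exact (norm_res_le _ _).trans hMb
    · refine (norm_sub_starProjection_le _ _).trans (norm_res_le_of_abs_le hε hE ?_)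
      calc ((S ∪ A).card : ℝ) ≤ (S.card + A.card : ℕ) := by exact_mod_cast Finset.card_union_le S A
        _ ≤ s + r := by rw [hA]; push_cast; gcongr
    · exact (norm_sub_starProjection_le _ _).trans hloss

/-- The tangent of the angle to `W` contracts: the inequality between real numbers. -/
theorem tangent_numeric {p q η e1 e2 g τ R s : ℝ} (hp0 : 0 ≤ p) (hq0 : 0 ≤ q) (hη : 0 ≤ η)
    (he10 : 0 ≤ e1) (he20 : 0 ≤ e2) (hg0 : 0 < g) (hg1 : g ≤ 1) (hτ0 : 0 ≤ τ) (hs : 1 ≤ s)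
    (hR : 1 ≤ R) (hR2 : R ^ 2 = 2 * s) (hpq : p ^ 2 + q ^ 2 = 1) (hq : q ≤ τ * p)
    (hτ : τ ^ 2 ≤ s) (hsmall : (η + 3 * e2) * R ≤ g / 8) (he1 : e1 ≤ g / 24)
    (hηe : η * e1 ≤ 2 * e2) :
    0 < p ∧ (1 - g / 8) * p ≤ p - e2 - η * (q + e1) ∧
      (1 - g) * q + 2 * e1 + η * (q + e1) ≤ ((1 - g / 2) * τ + 5 * e1) * ((1 - g / 8) * p) := by
  have hηg : η + 3 * e2 ≤ g / 8 := (le_mul_of_one_le_right (by positivity) hR).trans hsmall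
  have hq1 : q ≤ 1 := by nlinarith
  -- From p² + q² = 1 and q ≤ τp with τ² ≤ s one gets (1 + s)p² ≥ 1, hence 2s·p² ≥ 1. The smallness
  -- condition then turns absolute errors into multiples of p.
  have hp1 : 1 ≤ R * p := by
    refine (sq_le_sq₀ (by norm_num) (by positivity)).1 ?_
    rw [mul_pow, hR2]
    have h1 : q ^ 2 ≤ (τ * p) ^ 2 := by gcongr
    have h2 : τ ^ 2 * p ^ 2 ≤ s * p ^ 2 := by gcongr
    have h3 : 1 * p ^ 2 ≤ s * p ^ 2 := by gcongr
    rw [mul_pow] at h1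
    linarith
  -- The 3 collects e2 itself and η·e1 ≤ 2e2.
  have hden : η * q + 3 * e2 ≤ g / 8 * p := by
    calc η * q + 3 * e2 ≤ η * 1 + 3 * e2 := by gcongr
      _ = (η + 3 * e2) * 1 := by ring
      _ ≤ (η + 3 * e2) * (R * p) := by gcongr
      _ = (η + 3 * e2) * R * p := by ring
      _ ≤ g / 8 * p := by gcongr
  have hp_pos : 0 < p := by
    rcases hp0.eq_or_lt with h | h
    · rw [← h, mul_zero] at hp1; linarith
    · exact h
  -- This lets the larger error e1 be charged partly to the contraction of τ and partly to an
  -- additive term.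
  have hpq1 : 1 ≤ (1 + τ) * p := by
    have : 1 ≤ (p + q) ^ 2 := by nlinarith [mul_nonneg hp0 hq0]
    have h2 : 1 ≤ p + q := by
      by_contra hcon
      push Not at hcon
      have := pow_lt_one₀ (by positivity) hcon two_ne_zero
      linarith
    linarith
  refine ⟨hp_pos, by linarith, ?_⟩
  have h3 : η * (q + e1) ≤ g / 8 * q + 1 * e1 := by
    have h31 : η ≤ g / 8 := by linarith
    have h32 : η ≤ 1 := by linarith
    rw [mul_add]
    gcongr
  have h5 : (1 - g + g / 8) * q ≤ (1 - g + g / 8) * (τ * p) := by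
    have : 0 ≤ 1 - g + g / 8 := by linarith
    gcongr
  have h6 : 3 * e1 * 1 ≤ 3 * e1 * ((1 + τ) * p) := by gcongr
  have h7 : 3 * e1 * (τ * p) ≤ g / 8 * (τ * p) := by
    have : 3 * e1 ≤ g / 8 := by linarith
    gcongr
  have h8 : (1 - g) * q + 2 * e1 + η * (q + e1) ≤ ((1 - 3 * g / 4) * τ + 3 * e1) * p := by
    linarith
  refine h8.trans ?_
  rw [← mul_assoc, mul_right_comm]
  -- Division by 1 - g/8 is affordable because (1 - g/2)(1 - g/8) ≥ 1 - 3g/4 and 5(1 - g/8) ≥ 3.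
  have h9 : (1 - 3 * g / 4) * τ + 3 * e1 ≤ ((1 - g / 2) * τ + 5 * e1) * (1 - g / 8) := by
    have k1 : 0 ≤ g * τ := by positivity
    have k2 : 0 ≤ g * g * τ := by positivity
    have k3 : g * e1 ≤ 1 * e1 := by gcongr
    nlinarith
  calc _ ≤ ((1 - g / 2) * τ + 5 * e1) * (1 - g / 8) * p := by gcongr
    _ = _ := by ring

/-- The tangent of the angle to `W` contracts. -/
theorem SparseGap.tangent_step (h : SparseGap M W S lam g) {s r : ℕ} {η ε τ : ℝ} (hη : 0 ≤ η)
    (hε : 0 ≤ ε) (hlam : 0 < lam) (hg0 : 0 < g) (hg1 : g ≤ 1) (hs : 1 ≤ s)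
    (hS : S.card ≤ s) (hsr : 2 * s ≤ r) (hηs : η ^ 2 * r = 2 * s)
    (hsmall : (η + 3 * (√s * ε / lam)) * √(2 * s) ≤ g / 8) (he1 : √r * ε / lam ≤ g / 24)
    (hτ0 : 0 ≤ τ) (hτ : τ ≤ √s)
    {u E z : Vec d} (hu : ‖u‖ = 1) (huτ : ‖u - W.starProjection u‖ ≤ τ * ‖W.starProjection u‖)
    (hE : ∀ i, |E i| ≤ ε) (hz : IsTopTruncation r (matVec M u + E) z) :
    z ≠ 0 ∧ ‖z - W.starProjection z‖ ≤
      ((1 - g / 2) * τ + 5 * (√r * ε / lam)) * ‖W.starProjection z‖ := by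
  have hs0 : (1 : ℝ) ≤ s := by exact_mod_cast hs
  have hsr' : 2 * (s : ℝ) ≤ r := by exact_mod_cast hsr
  have hηle : (s : ℝ) ≤ η ^ 2 * (r - s) := by
    have : η ^ 2 * (2 * s) ≤ η ^ 2 * r := by gcongr
    linarith
  obtain ⟨h1, h2⟩ := h.truncated_step hη hε hS (by omega) hηle hE hz
  have hpq := norm_sq_eq_starProjection_add W u
  rw [hu, one_pow] at hpq
  have hr1 : √r * ε = lam * (√r * ε / lam) := by field_simp
  have hs1 : √s * ε = lam * (√s * ε / lam) := by field_simp
  have hsr1 : √(s + r) * ε ≤ lam * (2 * (√r * ε / lam)) := by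
    have : √(s + r) ≤ 2 * √r := by
      rw [Real.sqrt_le_left (by positivity), mul_pow, Real.sq_sqrt (by positivity)]
      linarith
    calc √(s + r) * ε ≤ 2 * √r * ε := by gcongr
      _ = _ := by field_simp
  have hηe : η * (√r * ε / lam) ≤ 2 * (√s * ε / lam) := by
    have h3 : η * √r ≤ 2 * √s := by
      refine le_of_sq_le_sq ?_ (by positivity)
      rw [mul_pow, mul_pow, Real.sq_sqrt (by positivity), Real.sq_sqrt (by positivity), hηs]
      linarith
    calc η * (√r * ε / lam) = η * √r * (ε / lam) := by ring
      _ ≤ 2 * √s * (ε / lam) := by gcongr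
      _ = _ := by ring
  have h2s : 1 ≤ √(2 * (s : ℝ)) := by rw [Real.one_le_sqrt]; linarith
  have hτs : τ ^ 2 ≤ (s : ℝ) := by
    rw [← Real.sq_sqrt (Nat.cast_nonneg s)]
    gcongr
  have he10 : 0 ≤ √r * ε / lam := by positivity
  have he20 : 0 ≤ √s * ε / lam := by positivity
  obtain ⟨hp, hP, hQ⟩ := tangent_numeric (norm_nonneg (W.starProjection u))
    (norm_nonneg (u - W.starProjection u)) hη he10 he20 hg0 hg1 hτ0 hs0 h2s
    (Real.sq_sqrt (by positivity)) hpq huτ hτs hsmall he1 hηe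
  rw [hr1] at h1 h2
  rw [hs1] at h1
  have hq0 := norm_nonneg (u - W.starProjection u)
  generalize √r * ε / lam = e1 at *
  generalize √s * ε / lam = e2 at *
  generalize ‖W.starProjection u‖ = p at *
  generalize ‖u - W.starProjection u‖ = q at *
  have hgq : (1 - g) * lam * q ≤ lam * q := by
    have : 0 ≤ g * (lam * q) := by positivity
    linarith
  have hgq' : η * ((1 - g) * lam * q + lam * e1) ≤ lam * (η * (q + e1)) := by
    calc η * ((1 - g) * lam * q + lam * e1) ≤ η * (lam * q + lam * e1) := by gcongr
      _ = _ := by ring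
  have hPz : lam * ((1 - g / 8) * p) ≤ ‖W.starProjection z‖ := by
    calc lam * ((1 - g / 8) * p) ≤ lam * (p - e2 - η * (q + e1)) := by gcongr
      _ = lam * p - lam * e2 - lam * (η * (q + e1)) := by ring
      _ ≤ _ := by linarith
  have hQz : ‖z - W.starProjection z‖ ≤
      lam * (((1 - g / 2) * τ + 5 * e1) * ((1 - g / 8) * p)) := by
    calc _ ≤ lam * ((1 - g) * q + 2 * e1 + η * (q + e1)) := by linarith
      _ ≤ _ := by gcongr
  have hpos : 0 < lam * ((1 - g / 8) * p) := by
    have : 0 < 1 - g / 8 := by linarith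
    positivity
  constructor
  · rintro rfl
    rw [map_zero, norm_zero] at hPz
    linarith
  · refine hQz.trans ?_
    have hτ' : 0 ≤ (1 - g / 2) * τ + 5 * e1 := by
      have : 0 ≤ 1 - g / 2 := by linarith
      positivity
    calc _ = ((1 - g / 2) * τ + 5 * e1) * (lam * ((1 - g / 8) * p)) := by ring
      _ ≤ _ := by gcongr

/-- The iterates of the truncated power method approach `W` at a linear rate. -/
theorem SparseGap.tangent_le (h : SparseGap M W S lam g) {s r T : ℕ} {η ε : ℝ} (hη : 0 ≤ η)
    (hε : 0 ≤ ε) (hlam : 0 < lam) (hg0 : 0 < g) (hg1 : g ≤ 1) (hs : 1 ≤ s)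
    (hS : S.card ≤ s) (hsr : 2 * s ≤ r) (hηs : η ^ 2 * r = 2 * s)
    (hsmall : (η + 3 * (√s * ε / lam)) * √(2 * s) ≤ g / 8) (he1 : √r * ε / lam ≤ g / 24)
    {u z : ℕ → Vec d} {N : ℕ → Matrix (Fin d) (Fin d) ℝ} (hu0 : ‖u 0‖ = 1)
    (hu0τ : ‖u 0 - W.starProjection (u 0)‖ ≤ √s * ‖W.starProjection (u 0)‖)
    (hN : ∀ t < T, ∀ i, |matVec (N t - M) (u t) i| ≤ ε)
    (hz : ∀ t, IsTopTruncation r (matVec (N t) (u t)) (z t))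
    (hu : ∀ t, u (t + 1) = ‖z t‖⁻¹ • z t) :
    ∀ t ≤ T, ‖u t‖ = 1 ∧ ‖u t - W.starProjection (u t)‖ ≤
      ((1 - g / 2) ^ t * √s + 10 * (√r * ε / lam) / g) * ‖W.starProjection (u t)‖ := by
  set e1 := √r * ε / lam with he1d
  have he10 : 0 ≤ e1 := by positivity
  have hs0 : (1 : ℝ) ≤ √s := by rw [Real.one_le_sqrt]; exact_mod_cast hs
  have hbase : 0 ≤ 1 - g / 2 := by linarith
  -- The bound √s is carried along because the one-step estimate requires it; it persists since 5·e1
  -- ≤ (g/2)√s. The recursion τ ↦ (1 - g/2)τ + 5·e1 has the fixed point 10·e1/g.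
  have key : ∀ t ≤ T, ∃ τ, 0 ≤ τ ∧ τ ≤ √s ∧ τ ≤ (1 - g / 2) ^ t * √s + 10 * e1 / g ∧ ‖u t‖ = 1 ∧
      ‖u t - W.starProjection (u t)‖ ≤ τ * ‖W.starProjection (u t)‖ := by
    intro t
    induction t with
    | zero =>
      intro _
      refine ⟨√s, by positivity, le_rfl, ?_, hu0, hu0τ⟩
      have : 0 ≤ 10 * e1 / g := by positivity
      linarith
    | succ t ih =>
      intro ht
      obtain ⟨τ, hτ0, hτs, hτ, hut, hutτ⟩ := ih (by omega)
      have hstep := h.tangent_step hη hε hlam hg0 hg1 hs hS hsr hηs hsmall he1 hτ0 hτs hut hutτ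
        (hN t (by omega)) (z := z t) (by
          have := hz t
          rwa [sub_matVec, add_sub_cancel])
      obtain ⟨hz0, hzτ⟩ := hstep
      have hzn : 0 < ‖z t‖ := norm_pos_iff.2 hz0
      refine ⟨(1 - g / 2) * τ + 5 * e1, by positivity, ?_, ?_, ?_, ?_⟩
      · have h1 : (1 - g / 2) * τ ≤ (1 - g / 2) * √s := by gcongr
        nlinarith
      · have h1 : (1 - g / 2) * τ ≤ (1 - g / 2) * ((1 - g / 2) ^ t * √s + 10 * e1 / g) := by gcongr
        have h2 : (1 - g / 2) * (10 * e1 / g) = 10 * e1 / g - 5 * e1 := by field_simp; ring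
        rw [pow_succ]
        nlinarith
      · rw [hu, norm_smul, norm_inv, norm_norm, inv_mul_cancel₀ hzn.ne']
      · rw [hu, map_smul, ← smul_sub, norm_smul, norm_smul]
        nlinarith [norm_nonneg (‖z t‖⁻¹)]
  intro t ht
  obtain ⟨τ, _, _, hτ, hut, hutτ⟩ := key t ht
  exact ⟨hut, hutτ.trans (by gcongr)⟩

end Step

/-! ### Sorted eigenvalues -/

section Eigval

variable {d : ℕ} {M : Matrix (Fin d) (Fin d) ℝ}

theorem eigval_eq_eigenvalues₀ (hM : M.IsHermitian) {m : ℕ} (hm : 1 ≤ m) (hd : m ≤ d) :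
    eigval M m = hM.eigenvalues₀ ⟨m - 1, by rw [Fintype.card_fin]; omega⟩ := by
  rw [eigval, dif_pos ⟨hM, hm, hd⟩]

theorem exists_eigenvalues_eq_eigval (hM : M.IsHermitian) {m : ℕ} (hm : 1 ≤ m) (hd : m ≤ d) :
    ∃ i, hM.eigenvalues i = eigval M m := by
  rw [eigval_eq_eigenvalues₀ hM hm hd]
  exact ⟨Fintype.equivOfCardEq (Fintype.card_fin _) ⟨m - 1, by rw [Fintype.card_fin]; omega⟩,
    by simp [Matrix.IsHermitian.eigenvalues]⟩

theorem eigval_le_eigenvalues_or (hM : M.IsHermitian) {m : ℕ} (hm : 1 ≤ m) (hd : m ≤ d)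
    (i : Fin d) : eigval M m ≤ hM.eigenvalues i ∨ hM.eigenvalues i ≤ eigval M (m + 1) := by
  set j := (Fintype.equivOfCardEq (Fintype.card_fin (Fintype.card (Fin d)))).symm i with hj
  have hi : hM.eigenvalues i = hM.eigenvalues₀ j := rfl
  have hjd : (j : ℕ) < d := j.2.trans_eq (Fintype.card_fin d)
  rw [hi]
  rcases Nat.lt_or_ge (j : ℕ) m with h | h
  · left
    rw [eigval_eq_eigenvalues₀ hM hm hd]
    exact hM.eigenvalues₀_antitone (Fin.mk_le_mk.2 (by omega) : (⟨j, j.2⟩ : Fin _) ≤ _)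
  -- This case forces `m < d`, so the default value of `eigval` beyond `d` plays no role.
  · right
    rw [eigval_eq_eigenvalues₀ hM (by omega) (by omega)]
    exact hM.eigenvalues₀_antitone (Fin.mk_le_mk.2 (by omega) : _ ≤ (⟨j, j.2⟩ : Fin _))

theorem eigenvalues_le_eigval_one (hM : M.IsHermitian) (i : Fin d) :
    hM.eigenvalues i ≤ eigval M 1 := by
  rw [eigval_eq_eigenvalues₀ hM le_rfl (by have := i.2; omega)]
  exact hM.eigenvalues₀_antitone (Fin.mk_le_mk.2 (Nat.zero_le _))

theorem inner_eigenvectorBasis_matVec (hM : M.IsHermitian) (i : Fin d) (u : Vec d) :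
    inner ℝ (hM.eigenvectorBasis i) (matVec M u) =
      hM.eigenvalues i * inner ℝ (hM.eigenvectorBasis i) u := by
  rw [← inner_matVec_comm hM]
  have : matVec M (hM.eigenvectorBasis i) = hM.eigenvalues i • hM.eigenvectorBasis i := by
    ext j
    have := congrFun (hM.mulVec_eigenvectorBasis i) j
    simpa [matVec] using this
  rw [this, real_inner_smul_left]

theorem norm_sq_eq_sum_inner_sq (b : OrthonormalBasis (Fin d) ℝ (Vec d)) (u : Vec d) :
    ‖u‖ ^ 2 = ∑ i, (inner ℝ (b i) u) ^ 2 := by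
  rw [← b.sum_sq_norm_inner_right u]
  simp

theorem quad_eq_sum_eigenvalues (hM : M.IsHermitian) (u : Vec d) :
    quad M u = ∑ i, hM.eigenvalues i * (inner ℝ (hM.eigenvectorBasis i) u) ^ 2 := by
  rw [quad, ← hM.eigenvectorBasis.sum_inner_mul_inner]
  refine Finset.sum_congr rfl fun i _ => ?_
  rw [inner_eigenvectorBasis_matVec, real_inner_comm]
  ring

end Eigval

/-- In a positive sequence that drops by a factor `1 - x` at some place at most `k`, the first such
drop happens before much has been lost. -/
theorem exists_first_gap {L : ℕ → ℝ} {k : ℕ} {x : ℝ} (hk : 1 ≤ k) (hx0 : 0 ≤ x) (hx1 : x ≤ 1)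
    (hL : 0 ≤ L 1) (hgap : L (k + 1) ≤ (1 - x) * L k) :
    ∃ m, 1 ≤ m ∧ m ≤ k ∧ L (m + 1) ≤ (1 - x) * L m ∧ (1 - k * x) * L 1 ≤ L m := by
  classical
  have hex : ∃ m, 1 ≤ m ∧ L (m + 1) ≤ (1 - x) * L m := ⟨k, hk, hgap⟩
  set m := Nat.find hex with hm
  obtain ⟨hm1, hm2⟩ := Nat.find_spec hex
  have hmk : m ≤ k := Nat.find_min' hex ⟨hk, hgap⟩
  -- Before the first drop each ratio exceeds 1 - x; Bernoulli's inequality then turns the power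
  -- into 1 - kx.
  have hpow : ∀ j, 1 ≤ j → j ≤ m → (1 - x) ^ (j - 1) * L 1 ≤ L j := by
    intro j hj
    induction j, hj using Nat.le_induction with
    | base => intro _; simp
    | succ j hj ih =>
      intro hjm
      have h1 := ih (by omega)
      have h2 := Nat.find_min hex (m := j) (by omega)
      push Not at h2
      have h3 := h2 hj
      have h4 : j + 1 - 1 = (j - 1) + 1 := by omega
      rw [h4, pow_succ]
      nlinarith
  refine ⟨m, hm1, hmk, hm2, le_trans ?_ (hpow m hm1 le_rfl)⟩
  gcongr
  have h1 : 1 + (k : ℝ) * (-x) ≤ (1 + -x) ^ k := one_add_mul_le_pow (by linarith) k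
  have h2 : (1 - x) ^ k ≤ (1 - x) ^ (m - 1) := by
    exact pow_le_pow_of_le_one (by linarith) (by linarith) (by omega)
  calc 1 - k * x = 1 + k * (-x) := by ring
    _ ≤ (1 + -x) ^ k := h1
    _ = (1 - x) ^ k := by ring
    _ ≤ _ := h2

/-! ### The spectral structure of the model -/

section Model

variable {s d k : ℕ} {γ σ : ℝ} {D : Measure (Vec d)} {Sig : Matrix (Fin d) (Fin d) ℝ}
  {v : Fin k → Vec d}

/-- The joint support of the vectors `v i`. -/
def jointSupport {d k : ℕ} (v : Fin k → Vec d) : Finset (Fin d) :=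
  Finset.univ.filter fun j => ∃ i, v i j ≠ 0

theorem apply_eq_zero_of_mem_span {w : Vec d} (hw : w ∈ Submodule.span ℝ (Set.range v))
    {j : Fin d} (hj : j ∉ jointSupport v) : w j = 0 := by
  have hv : ∀ i, v i j = 0 := by simpa [jointSupport] using hj
  induction hw using Submodule.span_induction with
  | mem x hx => obtain ⟨i, rfl⟩ := hx; exact hv i
  | zero => rfl
  | add x y _ _ hx hy => rw [PiLp.add_apply, hx, hy, add_zero]
  | smul a x _ hx => rw [PiLp.smul_apply, hx, smul_zero]

theorem Model.hermitian (h : Model s d k γ σ D Sig v) : Sig.IsHermitian := h.posSemidef.isHermitian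

theorem Model.eigenvectorBasis_mem (h : Model s d k γ σ D Sig v) {i : Fin d}
    (hi : eigval Sig k ≤ h.hermitian.eigenvalues i) :
    h.hermitian.eigenvectorBasis i ∈ Submodule.span ℝ (Set.range v) := by
  rw [h.span_eq]
  refine Submodule.mem_iSup_of_mem (h.hermitian.eigenvalues i) (Submodule.mem_iSup_of_mem hi ?_)
  rw [Module.End.mem_eigenspace_iff]
  ext j
  have := congrFun (h.hermitian.mulVec_eigenvectorBasis i) j
  simpa using this

theorem Model.eigval_antitone (h : Model s d k γ σ D Sig v) {m : ℕ} (hm : 1 ≤ m) (hmk : m ≤ k) :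
    eigval Sig k ≤ eigval Sig m := by
  have hk := h.k_le
  rw [eigval_eq_eigenvalues₀ h.hermitian h.k_pos hk,
    eigval_eq_eigenvalues₀ h.hermitian hm (hmk.trans hk)]
  exact h.hermitian.eigenvalues₀_antitone (Fin.mk_le_mk.2 (by omega))

/-- The span of the eigenvectors of the `m` largest eigenvalues. -/
def topSpace (hM : Sig.IsHermitian) (m : ℕ) : Submodule ℝ (Vec d) :=
  Submodule.span ℝ (hM.eigenvectorBasis '' {i | eigval Sig m ≤ hM.eigenvalues i})

theorem eigenvectorBasis_mem_topSpace (hM : Sig.IsHermitian) {m : ℕ} {i : Fin d}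
    (hi : eigval Sig m ≤ hM.eigenvalues i) : hM.eigenvectorBasis i ∈ topSpace hM m :=
  Submodule.subset_span ⟨i, hi, rfl⟩

theorem inner_eq_zero_of_mem_topSpace (hM : Sig.IsHermitian) {m : ℕ} {a : Vec d}
    (ha : a ∈ topSpace hM m) {i : Fin d} (hi : ¬ eigval Sig m ≤ hM.eigenvalues i) :
    inner ℝ (hM.eigenvectorBasis i) a = 0 := by
  induction ha using Submodule.span_induction with
  | mem x hx =>
    obtain ⟨j, hj, rfl⟩ := hx
    rw [hM.eigenvectorBasis.inner_eq_ite, if_neg]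
    rintro rfl
    exact hi hj
  | zero => simp
  | add x y _ _ hx hy => rw [inner_add_right, hx, hy, add_zero]
  | smul a x _ hx => rw [real_inner_smul_right, hx, mul_zero]

theorem matVec_mem_topSpace (hM : Sig.IsHermitian) {m : ℕ} {a : Vec d}
    (ha : a ∈ topSpace hM m) : matVec Sig a ∈ topSpace hM m := by
  induction ha using Submodule.span_induction with
  | mem x hx =>
    obtain ⟨j, hj, rfl⟩ := hx
    have : matVec Sig (hM.eigenvectorBasis j) = hM.eigenvalues j • hM.eigenvectorBasis j := by
      ext l
      have := congrFun (hM.mulVec_eigenvectorBasis j) l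
      simpa [matVec] using this
    rw [this]
    exact Submodule.smul_mem _ _ (eigenvectorBasis_mem_topSpace hM hj)
  | zero => simp [matVec_eq_toLpLin]
  | add x y _ _ hx hy => rw [matVec_add]; exact Submodule.add_mem _ hx hy
  | smul a x _ hx => rw [matVec_smul]; exact Submodule.smul_mem _ _ hx

/-- Since `m ≤ k`, every eigenvector with eigenvalue at least λ_m lies in the span of the `v i` and
so on their joint support. The remaining conditions are diagonal in the eigenbasis: the other
eigenvalues are at most λ_{m+1}, and nonnegativity makes this a bound on norms. -/
theorem Model.sparseGap (h : Model s d k γ σ D Sig v) {m : ℕ} {x : ℝ} (hm : 1 ≤ m) (hmk : m ≤ k)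
    (hx1 : x ≤ 1) (hgap : eigval Sig (m + 1) ≤ (1 - x) * eigval Sig m) :
    SparseGap Sig (topSpace h.hermitian m) (jointSupport v) (eigval Sig m) x := by
  have hpos : 0 < eigval Sig m := h.eigval_pos.trans_le (h.eigval_antitone hm hmk)
  have hM := h.hermitian
  refine ⟨fun w hw i hi => ?_, fun a ha => matVec_mem_topSpace _ ha, fun a ha => ?_,
    fun b hb => ?_, fun b hb => ?_⟩
  · refine apply_eq_zero_of_mem_span (Submodule.span_le.2 ?_ hw) hi
    rintro _ ⟨j, hj, rfl⟩
    exact h.eigenvectorBasis_mem ((h.eigval_antitone hm hmk).trans hj)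
  · refine le_of_sq_le_sq ?_ (norm_nonneg _)
    rw [mul_pow, norm_sq_eq_sum_inner_sq h.hermitian.eigenvectorBasis,
      norm_sq_eq_sum_inner_sq h.hermitian.eigenvectorBasis (matVec Sig a), Finset.mul_sum]
    refine Finset.sum_le_sum fun i _ => ?_
    by_cases hi : eigval Sig m ≤ h.hermitian.eigenvalues i
    · rw [inner_eigenvectorBasis_matVec, mul_pow]
      gcongr
    · rw [inner_eq_zero_of_mem_topSpace _ ha hi]
      simpa using sq_nonneg _
  · rw [Submodule.mem_orthogonal] at hb ⊢
    intro w hw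
    rw [← inner_matVec_comm h.hermitian]
    exact hb _ (matVec_mem_topSpace _ hw)
  · have hc : 0 ≤ (1 - x) * eigval Sig m := mul_nonneg (by linarith) hpos.le
    refine le_of_sq_le_sq ?_ (by positivity)
    rw [mul_pow, norm_sq_eq_sum_inner_sq h.hermitian.eigenvectorBasis,
      norm_sq_eq_sum_inner_sq h.hermitian.eigenvectorBasis b, Finset.mul_sum]
    refine Finset.sum_le_sum fun i _ => ?_
    rw [inner_eigenvectorBasis_matVec, mul_pow]
    by_cases hi : eigval Sig m ≤ h.hermitian.eigenvalues i
    · rw [(Submodule.mem_orthogonal _ _).1 hb _ (eigenvectorBasis_mem_topSpace _ hi)]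
      simp
    · have h1 := (eigval_le_eigenvalues_or h.hermitian hm (hmk.trans h.k_le) i).resolve_left hi
      have h2 : 0 ≤ h.hermitian.eigenvalues i := h.posSemidef.eigenvalues_nonneg i
      gcongr
      exact h1.trans hgap

theorem Model.card_jointSupport_le (h : Model s d k γ σ D Sig v) : (jointSupport v).card ≤ s :=
  h.support

/-- Some coordinate vector is sufficiently correlated with the top eigenspace. -/
theorem SparseGap.exists_start {W : Submodule ℝ (Vec d)} {S : Finset (Fin d)} {lam x : ℝ}
    (h : SparseGap Sig W S lam x) (hs : S.card ≤ s) {w : Vec d} (hw : w ∈ W) (hw1 : ‖w‖ = 1) :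
    ∃ i : Fin d, ‖EuclideanSpace.single i (1 : ℝ) - W.starProjection (EuclideanSpace.single i 1)‖ ≤
      √s * ‖W.starProjection (EuclideanSpace.single i (1 : ℝ))‖ := by
  have h1 : ∑ i ∈ S, w i ^ 2 = 1 := by
    rw [← norm_res_sq, res_eq_self (h.support w hw), hw1, one_pow]
  have hne : S.Nonempty := by
    by_contra hcon
    rw [Finset.not_nonempty_iff_eq_empty] at hcon
    simp [hcon] at h1
  obtain ⟨i, hi, hmax⟩ := S.exists_max_image (fun i => w i ^ 2) hne
  refine ⟨i, ?_⟩
  set e : Vec d := EuclideanSpace.single i 1 with he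
  have he1 : ‖e‖ = 1 := by simp [he]
  -- By pigeonhole the largest squared entry of a unit vector of `W` is at least 1/s, and that entry
  -- bounds the projection of the coordinate vector from below.
  have h2 : 1 ≤ s * w i ^ 2 := by
    calc (1 : ℝ) = ∑ j ∈ S, w j ^ 2 := h1.symm
      _ ≤ ∑ j ∈ S, w i ^ 2 := Finset.sum_le_sum hmax
      _ = S.card * w i ^ 2 := by rw [Finset.sum_const, nsmul_eq_mul]
      _ ≤ s * w i ^ 2 := by gcongr
  have h3 : |w i| ≤ ‖W.starProjection e‖ := by
    have h4 : w i = inner ℝ w (W.starProjection e) := by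
      rw [← Submodule.inner_starProjection_left_eq_right,
        Submodule.starProjection_eq_self_iff.2 hw, he, EuclideanSpace.inner_single_right]
      simp
    rw [h4]
    refine (abs_real_inner_le_norm _ _).trans ?_
    rw [hw1, one_mul]
  have h5 : 1 ≤ √s * |w i| := by
    refine le_of_sq_le_sq ?_ (by positivity)
    rw [mul_pow, Real.sq_sqrt (by positivity), sq_abs, one_pow]
    exact h2
  calc ‖e - W.starProjection e‖ ≤ ‖e‖ := norm_sub_starProjection_le W e
    _ = 1 := he1
    _ ≤ √s * |w i| := h5
    _ ≤ _ := by gcongr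

/-- A tangent at most τ means ‖Pu‖² ≥ 1/(1 + τ²) ≥ 1 - τ², and the part of `u` outside the top space
contributes nonnegatively. -/
theorem Model.le_quad (h : Model s d k γ σ D Sig v) {m : ℕ} (hm : 1 ≤ m) (hmk : m ≤ k)
    {u : Vec d} (hu : ‖u‖ = 1) {τ : ℝ}
    (huτ : ‖u - (topSpace h.hermitian m).starProjection u‖ ≤
      τ * ‖(topSpace h.hermitian m).starProjection u‖) :
    (1 - τ ^ 2) * eigval Sig m ≤ quad Sig u := by
  set W := topSpace h.hermitian m
  have hpos : 0 < eigval Sig m := h.eigval_pos.trans_le (h.eigval_antitone hm hmk)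
  have h1 : eigval Sig m * ‖W.starProjection u‖ ^ 2 ≤ quad Sig u := by
    rw [quad_eq_sum_eigenvalues h.hermitian, norm_sq_eq_sum_inner_sq h.hermitian.eigenvectorBasis,
      Finset.mul_sum]
    refine Finset.sum_le_sum fun i _ => ?_
    by_cases hi : eigval Sig m ≤ h.hermitian.eigenvalues i
    · rw [← Submodule.inner_starProjection_left_eq_right,
        Submodule.starProjection_eq_self_iff.2 (eigenvectorBasis_mem_topSpace _ hi)]
      gcongr
    · rw [inner_eq_zero_of_mem_topSpace _ (Submodule.starProjection_apply_mem _ u) hi]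
      have := h.posSemidef.eigenvalues_nonneg i
      have h3 : 0 ≤ h.hermitian.eigenvalues i * (inner ℝ (h.hermitian.eigenvectorBasis i) u) ^ 2 :=
        mul_nonneg this (sq_nonneg _)
      simpa using h3
  have h2 := norm_sq_eq_starProjection_add W u
  rw [hu, one_pow] at h2
  have h3 : ‖u - W.starProjection u‖ ^ 2 ≤ (τ * ‖W.starProjection u‖) ^ 2 := by gcongr
  have h4 : ‖W.starProjection u‖ ^ 2 ≤ 1 := by nlinarith [sq_nonneg ‖u - W.starProjection u‖]
  have h5 : 1 - τ ^ 2 ≤ ‖W.starProjection u‖ ^ 2 := by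
    rw [mul_pow] at h3
    nlinarith [sq_nonneg τ]
  calc (1 - τ ^ 2) * eigval Sig m ≤ ‖W.starProjection u‖ ^ 2 * eigval Sig m := by gcongr
    _ ≤ _ := by linarith

/-- A unit vector whose Rayleigh quotient is almost maximal is close to the top eigenspace. -/
theorem Model.sum_inner_sq_ge (h : Model s d k γ σ D Sig v) {u : Vec d} (hu : ‖u‖ = 1) {Δ : ℝ}
    (hq : (1 - Δ * γ) * eigval Sig 1 ≤ quad Sig u) : 1 - Δ ≤ ∑ i, (inner ℝ (v i) u) ^ 2 := by
  classical
  set b := h.hermitian.eigenvectorBasis with hb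
  set eig := h.hermitian.eigenvalues with heig
  set G := ∑ i, (inner ℝ (b i) u) ^ 2 * (if eigval Sig k ≤ eig i then 1 else 0) with hG
  have hk1 := h.eigval_antitone le_rfl h.k_pos
  have hkpos := h.eigval_pos
  have hγ := h.gap_pos
  have hgap : eigval Sig (k + 1) ≤ (1 - γ) * eigval Sig k := (div_le_iff₀ hkpos).1 h.gap
  -- The mass G on eigenvalues at least λ_k is charged λ₁, the remaining mass (1 - γ)λ₁. Comparison
  -- with (1 - Δγ)λ₁ gives G ≥ 1 - Δ.
  have h1 : quad Sig u ≤ ∑ i, (eigval Sig 1 * ((inner ℝ (b i) u) ^ 2 *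
      (if eigval Sig k ≤ eig i then 1 else 0)) + (1 - γ) * eigval Sig 1 *
      ((inner ℝ (b i) u) ^ 2 - (inner ℝ (b i) u) ^ 2 * (if eigval Sig k ≤ eig i then 1 else 0))) :=
        by
    rw [quad_eq_sum_eigenvalues h.hermitian]
    refine Finset.sum_le_sum fun i _ => ?_
    split_ifs with hi
    · simp only [mul_one, sub_self, mul_zero, add_zero]
      gcongr
      exact eigenvalues_le_eigval_one h.hermitian i
    · simp only [mul_zero, sub_zero, zero_add]
      gcongr
      have h2 := (eigval_le_eigenvalues_or h.hermitian h.k_pos h.k_le i).resolve_left hi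
      refine h2.trans (hgap.trans ?_)
      have := h.gap_lt
      gcongr
      linarith
  rw [Finset.sum_add_distrib, ← Finset.mul_sum, ← Finset.mul_sum, Finset.sum_sub_distrib,
    ← norm_sq_eq_sum_inner_sq b u, hu, ← hG] at h1
  have hpos1 : 0 < eigval Sig 1 := hkpos.trans_le hk1
  have h2 : 1 - Δ ≤ G := by
    have h3 : eigval Sig 1 * γ * (1 - Δ) ≤ eigval Sig 1 * γ * G := by
      nlinarith
    exact le_of_mul_le_mul_left h3 (by positivity)
  refine h2.trans ?_
  -- This is the projection of `u` to the span of the `v j`. Only the fact that the top eigenvectors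
  -- lie in this span is needed, so no dimensions have to be compared.
  set y := ∑ j, (inner ℝ (v j) u : ℝ) • v j with hy
  have hvy : ∀ l, inner ℝ (v l) y = (inner ℝ (v l) u : ℝ) := fun l => by
    rw [hy, h.orthonormal.inner_right_fintype]
  have hspan : ∀ w ∈ Submodule.span ℝ (Set.range v), (inner ℝ w u : ℝ) = inner ℝ w y := by
    intro w hw
    induction hw using Submodule.span_induction with
    | mem x hx => obtain ⟨l, rfl⟩ := hx; exact (hvy l).symm
    | zero => simp
    | add x y _ _ hx hy => rw [inner_add_left, inner_add_left, hx, hy]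
    | smul a x _ hx => rw [real_inner_smul_left, real_inner_smul_left, hx]
  have hyn : ‖y‖ ^ 2 = ∑ i, (inner ℝ (v i) u) ^ 2 := by
    rw [← real_inner_self_eq_norm_sq]
    conv_lhs => rw [hy, sum_inner]
    refine Finset.sum_congr rfl fun l _ => ?_
    rw [real_inner_smul_left, ← hy, hvy, sq]
  rw [← hyn, norm_sq_eq_sum_inner_sq b y]
  refine Finset.sum_le_sum fun i _ => ?_
  split_ifs with hi
  · rw [mul_one, hspan _ (h.eigenvectorBasis_mem hi)]
  · rw [mul_zero]; positivity

end Model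

/-! ### The iterates -/

section Iterates

variable {n d r T : ℕ} {top : Vec d → Vec d}

theorem IsTopTruncation.nnz_le {v w : Vec d} (h : IsTopTruncation r v w) : nnz w ≤ r := by
  obtain ⟨A, hA, _, hw⟩ := h
  rw [← hA]
  refine Finset.card_le_card fun i hi => ?_
  by_contra hiA
  rw [Finset.mem_filter, hw, if_neg hiA] at hi
  exact hi.2 rfl

theorem nnz_smul_le (c : ℝ) (w : Vec d) : nnz (c • w) ≤ nnz w := by
  refine Finset.card_le_card fun i hi => ?_
  rw [Finset.mem_filter_univ, PiLp.smul_apply, smul_eq_mul] at hi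
  exact Finset.mem_filter_univ _ |>.2 (right_ne_zero_of_mul hi)

theorem iterate_succ (x : Fin n → Vec d) (i : Fin d) (t : ℕ) :
    iterate top x T i (t + 1) =
      ‖top (matVec (empCov x (batch n T t)) (iterate top x T i t))‖⁻¹ •
        top (matVec (empCov x (batch n T t)) (iterate top x T i t)) := rfl

theorem nnz_iterate_succ_le (htop : IsTopRule r top) (x : Fin n → Vec d) (i : Fin d) (t : ℕ) :
    nnz (iterate top x T i (t + 1)) ≤ r :=
  (nnz_smul_le _ _).trans (htop.2 _).nnz_le

theorem iterate_eq_zero_or_norm_eq_one (x : Fin n → Vec d) (i : Fin d) (t : ℕ) :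
    iterate top x T i t = 0 ∨ ‖iterate top x T i t‖ = 1 := by
  cases t with
  | zero => right; simp [iterate]
  | succ t =>
    rw [iterate_succ]
    set w := top (matVec (empCov x (batch n T t)) (iterate top x T i t))
    by_cases hw : w = 0
    · left; rw [hw, smul_zero]
    · right
      rw [norm_smul, norm_inv, norm_norm, inv_mul_cancel₀ (norm_ne_zero_iff.2 hw)]

theorem norm_iterate_le (x : Fin n → Vec d) (i : Fin d) (t : ℕ) :
    ‖iterate top x T i t‖ ≤ 1 := by
  rcases iterate_eq_zero_or_norm_eq_one (top := top) (T := T) x i t with h | h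
  · rw [h, norm_zero]; exact zero_le_one
  · exact h.le

theorem empCov_congr {x x' : Fin n → Vec d} {J : Finset (Fin n)} (h : ∀ j ∈ J, x j = x' j) :
    empCov x J = empCov x' J := by
  rw [empCov, empCov]
  congr 1
  exact Finset.sum_congr rfl fun j hj => by rw [h j hj]

/-- Iterate `t` depends on the first `t` batches only, which makes the next batch independent of it.
-/
theorem iterate_congr {x x' : Fin n → Vec d} (i : Fin d) (t : ℕ)
    (h : ∀ j : Fin n, (j : ℕ) < n / T * t → x j = x' j) :
    iterate top x T i t = iterate top x' T i t := by
  induction t with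
  | zero => rfl
  | succ t ih =>
    rw [iterate_succ, iterate_succ, ih fun j hj => h j (hj.trans_le (by gcongr; omega)),
      empCov_congr (x := x) (x' := x') fun j hj => h j ?_]
    exact (Finset.mem_filter.1 hj).2.2

theorem measurable_empCov_apply (J : Finset (Fin n)) (i j : Fin d) :
    Measurable fun x : Fin n → Vec d => empCov x J i j := by
  simp only [empCov, Matrix.smul_apply, Matrix.sum_apply, Matrix.vecMulVec_apply, smul_eq_mul]
  fun_prop

theorem measurable_iterate (htop : Measurable top) (i : Fin d) (t : ℕ) :
    Measurable fun x : Fin n → Vec d => iterate top x T i t := by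
  induction t with
  | zero => exact measurable_const
  | succ t ih =>
    simp only [iterate_succ]
    have h1 : Measurable fun x : Fin n → Vec d =>
        matVec (empCov x (batch n T t)) (iterate top x T i t) := by
      refine (MeasurableEquiv.toLp 2 (Fin d → ℝ)).measurable.comp
        (measurable_pi_lambda _ fun a => ?_)
      simp only [Matrix.mulVec, dotProduct]
      refine Finset.measurable_sum _ fun b _ => (measurable_empCov_apply _ _ _).mul ?_
      fun_prop
    have h2 := htop.comp h1
    exact h2.norm.inv.smul h2

theorem map_batch {t : ℕ} (ht : t < T) :
    (batch n T t).map Fin.valEmbedding = Finset.Ico (n / T * t) (n / T * (t + 1)) := by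
  have h1 : n / T * (t + 1) ≤ n :=
    (Nat.mul_le_mul_left _ ht).trans (Nat.div_mul_le_self n T)
  ext j
  simp only [batch, Finset.mem_map, Finset.mem_filter, Finset.mem_univ, true_and,
    Fin.valEmbedding_apply, Finset.mem_Ico]
  constructor
  · rintro ⟨a, ha, rfl⟩; exact ha
  · intro hj; exact ⟨⟨j, by omega⟩, hj, rfl⟩

theorem card_batch {t : ℕ} (ht : t < T) : (batch n T t).card = n / T := by
  rw [← Finset.card_map, map_batch ht, Nat.card_Ico, Nat.mul_succ, Nat.add_sub_cancel_left]

end Iterates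

/-! ### Success of the method on favourable data -/

section Success

variable {s d k : ℕ} {γ σ : ℝ} {D : Measure (Vec d)} {Sig : Matrix (Fin d) (Fin d) ℝ}
  {v : Fin k → Vec d}

theorem norm_eigenvectorBasis (hM : Sig.IsHermitian) (i : Fin d) :
    ‖hM.eigenvectorBasis i‖ = 1 := hM.eigenvectorBasis.orthonormal.1 i

/-- There is a start from which the method succeeds if the sampling errors along the iterates and
the errors in the Rayleigh objective are small. -/
theorem Model.exists_start_success (h : Model s d k γ σ D Sig v) {Δ : ℝ} (hΔ0 : 0 < Δ)
    (hΔ1 : Δ < 1) {r T : ℕ} {η ε g x : ℝ} (hg : g = Δ * γ) (hx : x = g / (4 * k)) (hη : 0 ≤ η)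
    (hε : 0 ≤ ε) (hsr : 2 * s ≤ r) (hηs : η ^ 2 * r = 2 * s)
    (hsmall : (η + 3 * (√s * ε / eigval Sig k)) * √(2 * s) ≤ x / 8)
    (he1 : √r * ε / eigval Sig k ≤ x * √g / 40) (hT : 1 ≤ T)
    (hTpow : (1 - x / 2) ^ T * √s ≤ √g / 4) :
    ∃ i : Fin d, ∀ (n : ℕ) (top : Vec d → Vec d), IsTopRule r top → ∀ y : Fin n → Vec d,
      (∀ t < T, ∀ j, |matVec (empCov y (batch n T t) - Sig) (iterate top y T i t) j| ≤ ε) →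
      (∀ u : Vec d, nnz u ≤ r → ‖u‖ ≤ 1 →
        |quad (empCov y Finset.univ) u - quad Sig u| ≤ g / 8 * eigval Sig k) →
      y ∈ successEvent top r T v Δ := by
  have hkpos := h.eigval_pos
  have hγ0 := h.gap_pos
  have hγ1 := h.gap_lt
  have hk1 : (1 : ℝ) ≤ k := by exact_mod_cast h.k_pos
  have hg0 : 0 < g := by rw [hg]; positivity
  have hgγ : g ≤ γ := by rw [hg]; nlinarith
  have hg1 : g ≤ 1 / 2 := by linarith
  have hx0 : 0 < x := by rw [hx]; positivity
  have hxg : x ≤ g := by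
    rw [hx, div_le_iff₀ (by positivity)]; nlinarith
  have hkx : k * x = g / 4 := by rw [hx]; field_simp
  have hgap : eigval Sig (k + 1) ≤ (1 - x) * eigval Sig k :=
    ((div_le_iff₀ hkpos).1 h.gap).trans (by gcongr; linarith)
  have hL1 : eigval Sig k ≤ eigval Sig 1 := h.eigval_antitone le_rfl h.k_pos
  -- The gap γ at `k` is at least x, so a first drop exists; since kx = g/4, its eigenvalue is at
  -- least (1 - g/4)λ₁.
  obtain ⟨m, hm1, hmk, hmgap, hmL⟩ := exists_first_gap (L := eigval Sig) h.k_pos hx0.le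
    (by linarith) (hkpos.le.trans hL1) hgap
  have hkm : eigval Sig k ≤ eigval Sig m := h.eigval_antitone hm1 hmk
  have hmpos : 0 < eigval Sig m := hkpos.trans_le hkm
  have hG := h.sparseGap hm1 hmk (by linarith) hmgap
  obtain ⟨i₀, hi₀⟩ := exists_eigenvalues_eq_eigval h.hermitian hm1 (hmk.trans h.k_le)
  -- This start depends on Σ and not on the data, so only one sequence of iterates needs a union
  -- bound.
  obtain ⟨i, hi⟩ := hG.exists_start h.card_jointSupport_le
    (eigenvectorBasis_mem_topSpace h.hermitian hi₀.ge) (norm_eigenvectorBasis h.hermitian i₀)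
  refine ⟨i, fun n top htop y hy1 hy2 => ?_⟩
  set W := topSpace h.hermitian m with hW
  have hsqg : √g ≤ 1 := by rw [Real.sqrt_le_one]; linarith
  have he1' : √r * ε / eigval Sig m ≤ x * √g / 40 := le_trans (by gcongr) he1
  have hxs : x * √g ≤ x := mul_le_of_le_one_right hx0.le hsqg
  have htan := hG.tangent_le (r := r) (T := T) hη hε hmpos hx0 (by linarith) h.s_pos
    h.card_jointSupport_le hsr hηs (le_trans (by gcongr) hsmall) (by linarith)
    (u := iterate top y T i)
    (z := fun t => top (matVec (empCov y (batch n T t)) (iterate top y T i t)))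
    (N := fun t => empCov y (batch n T t)) (by simp [iterate]) hi hy1 (fun t => htop.2 _)
    (fun t => rfl) T le_rfl
  obtain ⟨hu1, huτ⟩ := htan
  obtain ⟨T', rfl⟩ : ∃ T', T = T' + 1 := ⟨T - 1, by omega⟩
  set us := iterate top y (T' + 1) i (T' + 1) with hus
  -- The decayed initial tangent and the accumulated noise contribute √g/4 each; the Rayleigh
  -- quotient then loses the factor 1 - g/4.
  have hτ : (1 - x / 2) ^ (T' + 1) * √s + 10 * (√r * ε / eigval Sig m) / x ≤ √g / 2 := by
    have : 10 * (√r * ε / eigval Sig m) / x ≤ √g / 4 := by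
      rw [div_le_iff₀ hx0]; linarith
    linarith
  have hq1 := h.le_quad hm1 hmk hu1 (huτ.trans (mul_le_mul_of_nonneg_right hτ (norm_nonneg _)))
  have hsq : (√g / 2) ^ 2 = g / 4 := by rw [div_pow, Real.sq_sqrt hg0.le]; norm_num
  rw [hsq] at hq1
  have hquad_us : (1 - g / 2) * eigval Sig 1 ≤ quad Sig us := by
    refine le_trans ?_ hq1
    rw [hkx] at hmL
    have h1 : (1 - g / 4) * ((1 - g / 4) * eigval Sig 1) ≤ (1 - g / 4) * eigval Sig m := by
      have : 0 ≤ 1 - g / 4 := by linarith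
      gcongr
    have h2 : 0 ≤ g ^ 2 / 16 * eigval Sig 1 := by
      have := hkpos.trans_le hL1
      positivity
    linarith
  rintro u ⟨j, rfl, hj⟩
  have hmax : quad (empCov y Finset.univ) us ≤
    quad (empCov y Finset.univ) (iterate top y (T' + 1) j (T' + 1)) := hj i
  set u := iterate top y (T' + 1) j (T' + 1) with hu
  have hnnz : nnz u ≤ r := nnz_iterate_succ_le htop y j T'
  have d1 := abs_le.1 (hy2 us (nnz_iterate_succ_le htop y i T') (norm_iterate_le y i _))
  have d2 := abs_le.1 (hy2 u hnnz (norm_iterate_le y j _))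
  -- The good iterate loses g/2 and the two comparisons with the empirical form lose g/8 each, 3g/4
  -- in total.
  have hquad_u : (1 - g) * eigval Sig 1 ≤ quad Sig u := by
    have : g / 8 * eigval Sig k ≤ g / 8 * eigval Sig 1 := by gcongr
    have : 0 ≤ g * eigval Sig 1 := by
      have := hkpos.trans_le hL1
      positivity
    linarith [d1.1, d2.2]
  -- A vanishing iterate has Rayleigh quotient zero and cannot be the maximiser.
  have hnorm : ‖u‖ = 1 := by
    rcases iterate_eq_zero_or_norm_eq_one (top := top) (T := T' + 1) y j (T' + 1) with h0 | h0
    · exfalso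
      rw [← hu] at h0
      rw [h0] at hquad_u
      have h1 : quad Sig (0 : Vec d) = 0 := by simp [quad]
      have h2 : 0 < (1 - g) * eigval Sig 1 := mul_pos (by linarith) (hkpos.trans_le hL1)
      linarith
    · exact h0
  refine ⟨hnnz, hnorm, h.sum_inner_sq_ge hnorm ?_⟩
  rwa [← hg]

/-- Hence σ²/λ_k ≥ 1/2, which keeps the deviation levels below 1, where the tail bounds are valid.
-/
theorem Model.eigval_le (h : Model s d k γ σ D Sig v) : eigval Sig k ≤ 2 * σ ^ 2 := by
  have := h.isProbability
  obtain ⟨i, hi⟩ := exists_eigenvalues_eq_eigval h.hermitian h.k_pos h.k_le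
  have h1 := h.subGaussian.quad_le h.sigma_pos h.covariance
    (norm_eigenvectorBasis h.hermitian i).le
  rw [quad, inner_eigenvectorBasis_matVec, hi, real_inner_self_eq_norm_sq,
    norm_eigenvectorBasis] at h1
  simpa using h1

/-- The probability of success in terms of the deviation levels. -/
theorem Model.measure_compl_successEvent_le (h : Model s d k γ σ D Sig v) {Δ : ℝ} (hΔ0 : 0 < Δ)
    (hΔ1 : Δ < 1) {n r T : ℕ} {η ε g x t₁ t₂ : ℝ} (hg : g = Δ * γ) (hx : x = g / (4 * k))
    (hη : 0 ≤ η) (hsr : 2 * s ≤ r) (hrd : r ≤ d) (hηs : η ^ 2 * r = 2 * s)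
    (hsmall : (η + 3 * (√s * ε / eigval Sig k)) * √(2 * s) ≤ x / 8)
    (he1 : √r * ε / eigval Sig k ≤ x * √g / 40) (hT : 1 ≤ T) (hnT : T ≤ n)
    (hTpow : (1 - x / 2) ^ T * √s ≤ √g / 4)
    (ht₁0 : 0 ≤ t₁) (ht₁ : t₁ ≤ 1) (hεt : ε = 2 * (σ ^ 2 * t₁)) (ht₂0 : 0 ≤ t₂) (ht₂ : t₂ ≤ 1)
    (hgt : g / 8 * eigval Sig k = 2 * (σ ^ 2 * t₂))
    {top : Vec d → Vec d} (htop : IsTopRule r top) :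
    (Measure.pi fun _ : Fin n => D) (successEvent top r T v Δ)ᶜ ≤
      ENNReal.ofReal (T * d * (4 * Real.exp (-((n / T : ℕ) * t₁ ^ 2 / 2048)))) +
      ENNReal.ofReal ((d * (8 * r + 1)) ^ r * (2 * Real.exp (-(n * t₂ ^ 2 / 2048)))) := by
  have := h.isProbability
  have hε : 0 ≤ ε := by rw [hεt]; positivity
  obtain ⟨i, hi⟩ := h.exists_start_success hΔ0 hΔ1 hg hx hη hε hsr hηs hsmall he1 hT hTpow
  have hB : 0 < n / T := Nat.div_pos hnT hT
  set bad₁ : ℕ × Fin d → Set (Fin n → Vec d) := fun p =>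
    {y | 2 * (σ ^ 2 * t₁) ≤
      |matVec (empCov y (batch n T p.1) - Sig) (iterate top y T i p.1) p.2|}
  set bad₂ : Set (Fin n → Vec d) := {y | ∃ u : Vec d, nnz u ≤ r ∧ ‖u‖ ≤ 1 ∧
        2 * (σ ^ 2 * t₂) < |quad (empCov y Finset.univ) u - quad Sig u|}
  have hbad₁ : ∀ p ∈ Finset.range T ×ˢ (Finset.univ : Finset (Fin d)),
      (Measure.pi fun _ : Fin n => D) (bad₁ p) ≤
        ENNReal.ofReal (4 * Real.exp (-((n / T : ℕ) * t₁ ^ 2 / 2048))) := by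
    rintro ⟨t, j⟩ hp
    have ht : t < T := by simpa using hp
    have hcard := card_batch (n := n) ht
    rw [← hcard]
    refine h.subGaussian.measure_abs_matVec_ge_le h.sigma_pos h.covariance h.hermitian
      (Finset.card_pos.1 (hcard ▸ hB)) (measurable_iterate htop.1 i t) (fun y y' hy => ?_)
      (fun y => norm_iterate_le y i t) ht₁0 ht₁ j
    refine iterate_congr i t fun l hl => hy l fun hmem => ?_
    exact absurd hl (not_lt.2 (Finset.mem_filter.1 hmem).2.1)
  have hbad₂ := h.subGaussian.measure_exists_sparse_quad_ge_le (n := n) (r := r) h.sigma_pos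
    h.covariance h.hermitian (by omega) (by have := h.s_pos; omega) hrd ht₂0 ht₂
  refine (measure_mono (t := (⋃ p ∈ Finset.range T ×ˢ (Finset.univ : Finset (Fin d)), bad₁ p) ∪
    bad₂) ?_).trans ((measure_union_le _ _).trans (add_le_add ?_ hbad₂))
  · intro y hy
    by_contra hcon
    simp only [Set.mem_union, Set.mem_iUnion, not_or, not_exists] at hcon
    refine hy (hi n top htop y (fun t ht j => ?_) fun u hu hu1 => ?_)
    · have := hcon.1 (t, j) (by simpa using ht)
      simp only [bad₁, Set.mem_ofPred_eq, not_le] at this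
      rw [hεt]
      exact this.le
    · by_contra hlt
      rw [hgt] at hlt
      exact hcon.2 ⟨u, hu, hu1, not_le.1 hlt⟩
  · refine (measure_biUnion_finset_le _ _).trans ((Finset.sum_le_sum hbad₁).trans_eq ?_)
    rw [Finset.sum_const, Finset.card_product, Finset.card_range, Finset.card_univ,
      Fintype.card_fin, nsmul_eq_mul, ENNReal.ofReal_mul (p := (T * d : ℝ)) (by positivity)]
    congr 1
    rw [← ENNReal.ofReal_natCast]
    push_cast
    rfl

end Success

/-! ### The choice of the parameters -/

theorem log_two_ge_half : 1 / 2 ≤ Real.log 2 := by linarith [Real.log_two_gt_d9]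

theorem half_le_log {y : ℝ} (hy : 2 ≤ y) : 1 / 2 ≤ Real.log y :=
  log_two_ge_half.trans (Real.log_le_log (by norm_num) hy)

/-- With L = log(s/g), the number of steps gives xT/2 ≥ 5L/2, so the power is at most (g/s)^(5/2). A
factor (g/s)^(1/2) cancels √s and leaves √g; the remaining (g/s)² is at most 1/4. -/
theorem one_sub_pow_mul_sqrt_le {s k g x : ℝ} {T : ℕ} (hs : 1 ≤ s) (hk : 1 ≤ k) (hg0 : 0 < g)
    (hg1 : g ≤ 1 / 2) (hx : x = g / (4 * k)) (hT : 20 * (k * Real.log (s / g) / g) ≤ T) :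
    (1 - x / 2) ^ T * √s ≤ √g / 4 := by
  have hx1 : x ≤ 1 := by rw [hx, div_le_one (by positivity)]; linarith
  have hsg : 2 ≤ s / g := by rw [le_div_iff₀ hg0]; linarith
  have hL := half_le_log hsg
  set L := Real.log (s / g) with hLdef
  have hxT : L / 2 + 2 * L ≤ x / 2 * T := by
    have h1 : x / 2 * (20 * (k * L / g)) ≤ x / 2 * T := by
      have : 0 ≤ x / 2 := by rw [hx]; positivity
      gcongr
    have h2 : x / 2 * (20 * (k * L / g)) = L / 2 + 2 * L := by rw [hx]; field_simp; norm_num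
    linarith
  have h1 : (1 - x / 2) ^ T ≤ Real.exp (-(L / 2 + 2 * L)) := by
    calc (1 - x / 2) ^ T ≤ Real.exp (-(x / 2)) ^ T :=
          pow_le_pow_left₀ (by linarith) (Real.one_sub_le_exp_neg _) _
      _ = Real.exp (-(x / 2 * T)) := by rw [← Real.exp_nat_mul]; ring_nf
      _ ≤ _ := Real.exp_le_exp.2 (by linarith)
  have hexpL : Real.exp (-L) = g / s := by
    rw [Real.exp_neg, hLdef, Real.exp_log (by positivity), inv_div]
  have h2 : Real.exp (-(L / 2 + 2 * L)) = √(g / s) * (g / s) ^ 2 := by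
    rw [← hexpL, ← Real.exp_half, ← Real.exp_nat_mul, ← Real.exp_add]
    congr 1; push_cast; ring
  have h3 : (g / s) ^ 2 ≤ 1 / 4 := by
    have : g / s ≤ 1 / 2 := by rw [div_le_iff₀ (by linarith)]; linarith
    calc (g / s) ^ 2 ≤ (1 / 2) ^ 2 := by gcongr
      _ = 1 / 4 := by norm_num
  calc (1 - x / 2) ^ T * √s ≤ √(g / s) * (g / s) ^ 2 * √s := by rw [← h2]; gcongr
    _ = √g * (g / s) ^ 2 := by
      rw [Real.sqrt_div hg0.le]
      have : √s ≠ 0 := by positivity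
      field_simp
    _ ≤ √g * (1 / 4) := by gcongr
    _ = √g / 4 := by ring

/-- Bounds on the truncation and sampling errors for a suitable number `r` of kept entries. -/
theorem error_levels_le {s k g x K r lam ε : ℝ} (hs : 1 ≤ s) (hk : 1 ≤ k) (hg0 : 0 < g)
    (hg1 : g ≤ 1 / 2) (hK : 1 ≤ K) (hlam : 0 < lam) (hx : x = g / (4 * k))
    (hr1 : 16384 * (s * k / g) ^ 2 ≤ r) (hr2 : r ≤ K * (16384 * (s * k / g) ^ 2))
    (hε : ε = lam * (g ^ 2 * √g / (20480 * √K * (k ^ 2 * s)))) :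
    2 * s ≤ r ∧ √(2 * s / r) ^ 2 * r = 2 * s ∧
      (√(2 * s / r) + 3 * (√s * ε / lam)) * √(2 * s) ≤ x / 8 ∧
      √r * ε / lam ≤ x * √g / 40 := by
  have hs0 : 0 < s := by linarith
  have hk0 : 0 < k := by linarith
  have hA : 2 * s ≤ s * k / g := by
    rw [le_div_iff₀ hg0]; nlinarith
  have hA0 : 0 < s * k / g := by positivity
  have hr0 : 0 < r := lt_of_lt_of_le (by positivity) hr1
  have hsqr : 128 * (s * k / g) ≤ √r := by
    refine Real.le_sqrt_of_sq_le (le_trans (le_of_eq ?_) hr1); ring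
  have hsqr2 : √r ≤ √K * (128 * (s * k / g)) := by
    rw [Real.sqrt_le_left (by positivity), mul_pow, Real.sq_sqrt (by linarith)]
    refine hr2.trans (le_of_eq ?_); ring
  have hK1 : 1 ≤ √K := by rwa [Real.one_le_sqrt]
  have hsqg : √g ≤ 1 := by rw [Real.sqrt_le_one]; linarith
  refine ⟨by nlinarith, ?_, ?_, ?_⟩
  · rw [Real.sq_sqrt (by positivity)]; field_simp
  -- The budget x/8 = g/(32k) is shared equally by the truncation error, controlled through √r ≥
  -- 128sk/g, and the sampling error.
  · have h1 : √(2 * s / r) * √(2 * s) ≤ g / (64 * k) := by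
      rw [Real.sqrt_div (by positivity), div_mul_eq_mul_div, Real.mul_self_sqrt (by positivity),
        div_le_iff₀ (by positivity)]
      calc 2 * s = g / (64 * k) * (128 * (s * k / g)) := by field_simp; norm_num
        _ ≤ _ := by gcongr
    have h2 : 3 * (√s * ε / lam) * √(2 * s) ≤ g / (64 * k) := by
      have h3 : √(2 * s) = √2 * √s := Real.sqrt_mul (by norm_num) s
      have h4 : √2 ≤ 3 / 2 := by rw [Real.sqrt_le_left (by norm_num)]; norm_num
      have h5 : √s * √s = s := Real.mul_self_sqrt hs0.le
      calc 3 * (√s * ε / lam) * √(2 * s) =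
          3 * √2 * (√s * √s) * (g ^ 2 * √g / (20480 * √K * (k ^ 2 * s))) := by
            rw [h3, hε]; field_simp
        _ = 3 * √2 * g * (g * √g) / (20480 * √K * k * k) := by rw [h5]; field_simp
        _ ≤ 3 * (3 / 2) * g * (1 * 1) / (20480 * 1 * 1 * k) := by
            gcongr; linarith
        _ ≤ _ := by
          rw [div_le_div_iff₀ (by positivity) (by positivity)]
          have : 0 < g * k := by positivity
          nlinarith
    rw [add_mul]
    have h6 : x / 8 = g / (64 * k) + g / (64 * k) := by rw [hx]; field_simp; norm_num
    rw [h6]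
    gcongr
  -- The level ε is chosen to give equality here for the largest `r` allowed.
  · calc √r * ε / lam = √r * (g ^ 2 * √g / (20480 * √K * (k ^ 2 * s))) := by rw [hε]; field_simp
      _ ≤ √K * (128 * (s * k / g)) * (g ^ 2 * √g / (20480 * √K * (k ^ 2 * s))) := by gcongr
      _ = x * √g / 40 := by rw [hx]; field_simp; norm_num

/-- The three conclusions serve the running time, the batch deviations and the grid. In terms of w =
1/g each is a comparison of monomials. The second fixes the exponents: the squared level costs k⁴w⁵
and the number of batches kw, together k⁵w⁶. -/
theorem sample_size_bounds {s k g K a n r T LL L : ℝ} (hs : 1 ≤ s) (hk : 1 ≤ k) (hg0 : 0 < g)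
    (hg1 : g ≤ 1 / 2) (hK : 1 ≤ K) (ha : 1 / 2 ≤ a) (hL : 1 / 2 ≤ L) (hLL : 1 / 2 ≤ LL)
    (hr0 : 1 ≤ r)
    (hr2 : r ≤ K * (16384 * (s * k / g) ^ 2)) (hT2 : T ≤ K * (20 * (k * L / g)))
    (hT0 : 1 ≤ T)
    (hn : 10 ^ 15 * K ^ 2 * (a ^ 2 * s ^ 2 * (k ^ 5 / g ^ 6) * LL * L) ≤ n) :
    r * T ≤ n ∧
    4 * LL ≤ n / (2 * T) * (g ^ 2 * √g / (20480 * √K * (2 * a * (k ^ 2 * s)))) ^ 2 / 2048 ∧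
    (6 * r + 2) * LL ≤ n * (g / (16 * a)) ^ 2 / 2048 := by
  set w := 1 / g with hw
  have hw2 : 2 ≤ w := by rw [hw, le_div_iff₀ hg0]; linarith
  have e1 : k ^ 5 / g ^ 6 = k ^ 5 * w ^ 6 := by rw [hw]; field_simp
  have e2 : s * k / g = s * k * w := by rw [hw]; field_simp
  have e3 : k * L / g = k * L * w := by rw [hw]; field_simp
  rw [e1] at hn
  rw [e2] at hr2
  rw [e3] at hT2
  have hgw : g = 1 / w := by rw [hw]; field_simp
  have hk5 : k ^ 3 ≤ k ^ 5 := pow_le_pow_right₀ hk (by norm_num)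
  have hk2 : k ^ 2 ≤ k ^ 5 := pow_le_pow_right₀ hk (by norm_num)
  have hw3 : w ^ 3 ≤ w ^ 6 := pow_le_pow_right₀ (by linarith) (by norm_num)
  have hw4 : w ^ 2 ≤ w ^ 4 := pow_le_pow_right₀ (by linarith) (by norm_num)
  have hKK : K ≤ K ^ 2 := le_self_pow₀ hK two_ne_zero
  have hs2 : 1 ≤ s ^ 2 := one_le_pow₀ hs
  have hL0 : 0 < L := by linarith
  have hLL0 : 0 < LL := by linarith
  have ha0 : 0 < a := by linarith
  refine ⟨?_, ?_, ?_⟩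
  · calc r * T ≤ K * (16384 * (s * k * w) ^ 2) * (K * (20 * (k * L * w))) := by gcongr
      _ = 327680 * K ^ 2 * (s ^ 2 * (k ^ 3 * w ^ 3) * L) := by ring
      _ ≤ 327680 * K ^ 2 * (s ^ 2 * (k ^ 5 * w ^ 6) * L) := by gcongr
      _ = (8 * 327680) * K ^ 2 * ((1 / 2) ^ 2 * s ^ 2 * (k ^ 5 * w ^ 6) * (1 / 2) * L) := by ring
      _ ≤ 10 ^ 15 * K ^ 2 * (a ^ 2 * s ^ 2 * (k ^ 5 * w ^ 6) * LL * L) := by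
        gcongr; norm_num
      _ ≤ n := hn
  · have hsq : (g ^ 2 * √g / (20480 * √K * (2 * a * (k ^ 2 * s)))) ^ 2 =
        1 / (4 * 20480 ^ 2 * K * (a ^ 2 * k ^ 4 * s ^ 2 * w ^ 5)) := by
      have h1 : √g ^ 2 = g := Real.sq_sqrt hg0.le
      have h2 : √K ^ 2 = K := Real.sq_sqrt (by linarith)
      rw [div_pow, mul_pow, mul_pow, mul_pow, h1, h2, hgw]
      field_simp
      ring
    rw [hsq]
    rw [le_div_iff₀ (by norm_num), mul_one_div, le_div_iff₀ (by positivity),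
      le_div_iff₀ (by positivity)]
    calc 4 * LL * 2048 * (4 * 20480 ^ 2 * K * (a ^ 2 * k ^ 4 * s ^ 2 * w ^ 5)) * (2 * T) ≤
        4 * LL * 2048 * (4 * 20480 ^ 2 * K * (a ^ 2 * k ^ 4 * s ^ 2 * w ^ 5)) *
          (2 * (K * (20 * (k * L * w)))) := by gcongr
      _ = (4 * 2048 * 4 * 20480 ^ 2 * 2 * 20) * K ^ 2 *
          (a ^ 2 * s ^ 2 * (k ^ 5 * w ^ 6) * LL * L) := by ring
      _ ≤ 10 ^ 15 * K ^ 2 * (a ^ 2 * s ^ 2 * (k ^ 5 * w ^ 6) * LL * L) := by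
        gcongr; norm_num
      _ ≤ n := hn
  · rw [hgw, le_div_iff₀ (by norm_num), div_pow, div_pow, one_pow, ← mul_div_assoc,
      le_div_iff₀ (by positivity), ← mul_div_assoc, le_div_iff₀ (by positivity), mul_one]
    calc (6 * r + 2) * LL * 2048 * (16 * a) ^ 2 * w ^ 2 ≤
        (6 * r + 2 * r) * LL * 2048 * (16 * a) ^ 2 * w ^ 2 := by gcongr; linarith
      _ = (8 * 2048 * 256) * (r * (LL * a ^ 2 * w ^ 2)) := by ring
      _ ≤ (8 * 2048 * 256) * (K * (16384 * (s * k * w) ^ 2) * (LL * a ^ 2 * w ^ 2)) := by gcongr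
      _ = (8 * 2048 * 256 * 16384 * 2) * K * (a ^ 2 * s ^ 2 * (k ^ 2 * w ^ 4) * LL * (1 / 2)) := by
        ring
      _ ≤ 10 ^ 15 * K ^ 2 * (a ^ 2 * s ^ 2 * (k ^ 5 * w ^ 6) * LL * L) := by
        have hw46 : w ^ 4 ≤ w ^ 6 := pow_le_pow_right₀ (by linarith) (by norm_num)
        gcongr; norm_num
      _ ≤ n := hn

/-- With Q = dT/δ, the first term is at most 4δQ⁻³. The number of grid points is at most Q^(6r),
which is beaten by Q^(-6r-2). -/
theorem failure_bounds {d T δ N₁ N₂ : ℝ} {r : ℕ} (hδ0 : 0 < δ) (hδ1 : δ ≤ 1) (hT : 1 ≤ T)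
  (hd2 : 2 ≤ d)
    (hrd : r ≤ d) (hQ : 2 ≤ d * T / δ) (h₁ : 4 * Real.log (d * T / δ) ≤ N₁)
    (h₂ : (6 * r + 2) * Real.log (d * T / δ) ≤ N₂) :
    T * d * (4 * Real.exp (-N₁)) ≤ δ / 2 ∧
      (d * (8 * r + 1)) ^ r * (2 * Real.exp (-N₂)) ≤ δ / 2 := by
  set Q := d * T / δ with hQd
  have hQ0 : 0 < Q := by linarith
  have hδQ : d * T = Q * δ := by rw [hQd]; field_simp
  have hlogQ : Real.exp (-Real.log Q) = Q⁻¹ := by rw [Real.exp_neg, Real.exp_log hQ0]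
  have hQi : Q⁻¹ ≤ 1 / 2 := by rw [inv_le_comm₀ hQ0 (by norm_num)]; linarith
  have hQi0 : 0 < Q⁻¹ := by positivity
  constructor
  · have h1 : Real.exp (-N₁) ≤ Q⁻¹ ^ 4 := by
      rw [← hlogQ, ← Real.exp_nat_mul]
      refine Real.exp_le_exp.2 ?_
      push_cast
      linarith
    calc T * d * (4 * Real.exp (-N₁)) ≤ T * d * (4 * Q⁻¹ ^ 4) := by gcongr
      _ = 4 * δ * Q⁻¹ ^ 3 := by rw [mul_comm T d, hδQ]; field_simp
      _ ≤ 4 * δ * (1 / 2) ^ 3 := by gcongr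
      _ = δ / 2 := by ring
  · have hdQ : d ≤ Q := by
      rw [hQd, le_div_iff₀ hδ0]
      gcongr
      linarith
    have h1 : d * (8 * r + 1) ≤ Q ^ 6 := by
      calc d * (8 * r + 1) ≤ d * (8 * d + d) := by gcongr; linarith
        _ = 9 * d ^ 2 := by ring
        _ ≤ 2 ^ 4 * d ^ 2 := by gcongr; norm_num
        _ ≤ d ^ 4 * d ^ 2 := by gcongr
        _ = d ^ 6 := by ring
        _ ≤ Q ^ 6 := by gcongr
    have h2 : Real.exp (-N₂) ≤ (Q⁻¹ ^ 6) ^ r * Q⁻¹ ^ 2 := by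
      rw [← hlogQ, ← Real.exp_nat_mul, ← Real.exp_nat_mul, ← Real.exp_nat_mul, ← Real.exp_add]
      refine Real.exp_le_exp.2 ?_
      push_cast
      linarith
    calc (d * (8 * r + 1)) ^ r * (2 * Real.exp (-N₂)) ≤
        (Q ^ 6) ^ r * (2 * ((Q⁻¹ ^ 6) ^ r * Q⁻¹ ^ 2)) := by gcongr
      _ = 2 * Q⁻¹ ^ 2 := by
        have : ((Q ^ 6) ^ r) * ((Q⁻¹ ^ 6) ^ r) = 1 := by
          rw [← mul_pow, ← mul_pow, mul_inv_cancel₀ hQ0.ne', one_pow, one_pow]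
        calc _ = 2 * ((Q ^ 6) ^ r * (Q⁻¹ ^ 6) ^ r) * Q⁻¹ ^ 2 := by ring
          _ = _ := by rw [this, mul_one]
      _ = 2 * (δ / (d * T)) * Q⁻¹ := by rw [hδQ]; field_simp
      _ ≤ 2 * (δ / (2 * 1)) * (1 / 2) := by gcongr
      _ = δ / 2 := by ring

section Accuracy

variable {s d n k r T : ℕ} {γ σ Δ δ K : ℝ} {D : Measure (Vec d)} {Sig : Matrix (Fin d) (Fin d) ℝ}
  {v : Fin k → Vec d}

/-- Consequences of the assumptions of the main theorem on `n`, `r` and `T`. -/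
theorem Model.sizes (h : Model s d k γ σ D Sig v) (hK : 1 ≤ K) (hΔ0 : 0 < Δ) (hΔ1 : Δ < 1)
    (hδ0 : 0 < δ) (hδ1 : δ < 1) (hrd : r ≤ d)
    (hr1 : 16384 * ((s : ℝ) ^ 2 * (k : ℝ) ^ 2 / (Δ ^ 2 * γ ^ 2)) ≤ r)
    (hr2 : r ≤ K * (16384 * ((s : ℝ) ^ 2 * (k : ℝ) ^ 2 / (Δ ^ 2 * γ ^ 2))))
    (hT1 : 20 * ((k : ℝ) * Real.log (s / (Δ * γ)) / (Δ * γ)) ≤ T)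
    (hT2 : T ≤ K * (20 * ((k : ℝ) * Real.log (s / (Δ * γ)) / (Δ * γ))))
    (hn : 10 ^ 15 * K ^ 2 * ((σ ^ 2 / eigval Sig k) ^ 2 * (s : ℝ) ^ 2 *
      ((k : ℝ) ^ 5 / (Δ ^ 6 * γ ^ 6) + (k : ℝ) ^ 2 / (Δ ^ 2 * γ ^ 6)) *
        Real.log (d * T / δ) * Real.log (s / (Δ * γ))) ≤ n) :
    1 ≤ T ∧ 1 ≤ r ∧ r * T ≤ n ∧
      4 * Real.log (d * T / δ) ≤ n / (2 * T) * ((Δ * γ) ^ 2 * √(Δ * γ) /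
        (20480 * √K * (2 * (σ ^ 2 / eigval Sig k) * (k ^ 2 * s)))) ^ 2 / 2048 ∧
      (6 * r + 2) * Real.log (d * T / δ) ≤
        n * (Δ * γ / (16 * (σ ^ 2 / eigval Sig k))) ^ 2 / 2048 ∧ 2 ≤ d * T / δ := by
  have hs : (1 : ℝ) ≤ s := by exact_mod_cast h.s_pos
  have hk : (1 : ℝ) ≤ k := by exact_mod_cast h.k_pos
  have hγ0 := h.gap_pos
  have hγ1 := h.gap_lt
  have hkpos := h.eigval_pos
  have hσ := h.sigma_pos
  have hg0 : 0 < Δ * γ := by positivity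
  have hg1 : Δ * γ ≤ 1 / 2 := by nlinarith
  have er : (s : ℝ) ^ 2 * (k : ℝ) ^ 2 / (Δ ^ 2 * γ ^ 2) = (s * k / (Δ * γ)) ^ 2 := by
    rw [div_pow, mul_pow, mul_pow]
  have en : (k : ℝ) ^ 5 / (Δ ^ 6 * γ ^ 6) = k ^ 5 / (Δ * γ) ^ 6 := by rw [mul_pow]
  rw [er] at hr1 hr2
  rw [en] at hn
  have hA : 2 ≤ s * k / (Δ * γ) := by rw [le_div_iff₀ hg0]; nlinarith
  have hsg : 2 ≤ s / (Δ * γ) := by rw [le_div_iff₀ hg0]; linarith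
  have hL := half_le_log hsg
  have hr0' : (2 : ℝ) ≤ r := le_trans (by nlinarith) hr1
  have hr0 : (1 : ℝ) ≤ r := by linarith
  have hT0' : (0 : ℝ) < T := by
    refine lt_of_lt_of_le ?_ hT1
    have : 0 < Real.log (s / (Δ * γ)) := by linarith
    positivity
  have hT0 : 1 ≤ T := by exact_mod_cast hT0'
  have hT0r : (1 : ℝ) ≤ T := by exact_mod_cast hT0
  have hd : (2 : ℝ) ≤ d := hr0'.trans (by exact_mod_cast hrd)
  have hQ : 2 ≤ d * T / δ := by rw [le_div_iff₀ hδ0]; nlinarith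
  have hLL := half_le_log hQ
  have ha : 1 / 2 ≤ σ ^ 2 / eigval Sig k := by
    rw [le_div_iff₀ hkpos]; linarith [h.eigval_le]
  have hn' : 10 ^ 15 * K ^ 2 * ((σ ^ 2 / eigval Sig k) ^ 2 * (s : ℝ) ^ 2 *
      ((k : ℝ) ^ 5 / (Δ * γ) ^ 6) * Real.log (d * T / δ) * Real.log (s / (Δ * γ))) ≤ n := by
    -- The first summand of the sample size already suffices.
    refine le_trans ?_ hn
    have : 0 ≤ (k : ℝ) ^ 2 / (Δ ^ 2 * γ ^ 6) := by positivity
    gcongr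
    linarith
  obtain ⟨h1, h2, h3⟩ := sample_size_bounds (a := σ ^ 2 / eigval Sig k) hs hk hg0 hg1 hK ha hL hLL
    hr0
    hr2 hT2 hT0r hn'
  exact ⟨hT0, by exact_mod_cast hr0, by exact_mod_cast h1, h2, h3, hQ⟩

theorem Model.accuracy (h : Model s d k γ σ D Sig v) (hK : 1 ≤ K) (hΔ0 : 0 < Δ) (hΔ1 : Δ < 1)
    (hδ0 : 0 < δ) (hδ1 : δ < 1) (hrd : r ≤ d)
    (hr1 : 16384 * ((s : ℝ) ^ 2 * (k : ℝ) ^ 2 / (Δ ^ 2 * γ ^ 2)) ≤ r)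
    (hr2 : r ≤ K * (16384 * ((s : ℝ) ^ 2 * (k : ℝ) ^ 2 / (Δ ^ 2 * γ ^ 2))))
    (hT1 : 20 * ((k : ℝ) * Real.log (s / (Δ * γ)) / (Δ * γ)) ≤ T)
    (hT2 : T ≤ K * (20 * ((k : ℝ) * Real.log (s / (Δ * γ)) / (Δ * γ))))
    (hn : 10 ^ 15 * K ^ 2 * ((σ ^ 2 / eigval Sig k) ^ 2 * (s : ℝ) ^ 2 *
      ((k : ℝ) ^ 5 / (Δ ^ 6 * γ ^ 6) + (k : ℝ) ^ 2 / (Δ ^ 2 * γ ^ 6)) *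
        Real.log (d * T / δ) * Real.log (s / (Δ * γ))) ≤ n)
    {top : Vec d → Vec d} (htop : IsTopRule r top) :
    ENNReal.ofReal (1 - δ) ≤ (Measure.pi fun _ : Fin n => D) (successEvent top r T v Δ) := by
  have hprob := h.isProbability
  obtain ⟨hT0, hr0, hrT, hdev1, hdev2, hQ⟩ :=
    h.sizes hK hΔ0 hΔ1 hδ0 hδ1 hrd hr1 hr2 hT1 hT2 hn
  have hs : (1 : ℝ) ≤ s := by exact_mod_cast h.s_pos
  have hk : (1 : ℝ) ≤ k := by exact_mod_cast h.k_pos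
  have hγ0 := h.gap_pos
  have hγ1 := h.gap_lt
  have hkpos := h.eigval_pos
  have hσ := h.sigma_pos
  have hg0 : 0 < Δ * γ := by positivity
  have hg1 : Δ * γ ≤ 1 / 2 := by nlinarith
  have er : (s : ℝ) ^ 2 * (k : ℝ) ^ 2 / (Δ ^ 2 * γ ^ 2) = (s * k / (Δ * γ)) ^ 2 := by
    rw [div_pow, mul_pow, mul_pow]
  rw [er] at hr1 hr2
  set g := Δ * γ with hg
  set lam := eigval Sig k with hlam
  have ha : 1 / 2 ≤ σ ^ 2 / lam := by
    rw [le_div_iff₀ hkpos]; linarith [h.eigval_le]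
  set a := σ ^ 2 / lam with ha_def
  have hσa : σ ^ 2 = a * lam := by rw [ha_def]; field_simp
  set ε := lam * (g ^ 2 * √g / (20480 * √K * (k ^ 2 * s))) with hε
  obtain ⟨hsr, hηs, hsmall, he1⟩ := error_levels_le hs hk hg0 hg1 hK hkpos rfl hr1 hr2 hε
  have hK1 : 1 ≤ √K := by rwa [Real.one_le_sqrt]
  have hsqg : √g ≤ 1 := by rw [Real.sqrt_le_one]; linarith
  -- These solve 2σ²t₁ = ε and 2σ²t₂ = gλ_k/8.
  set t₁ := g ^ 2 * √g / (20480 * √K * (2 * a * (k ^ 2 * s))) with ht₁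
  set t₂ := g / (16 * a) with ht₂
  have ha0 : 0 < a := by linarith
  have ht₁1 : t₁ ≤ 1 := by
    rw [ht₁, div_le_one (by positivity)]
    calc g ^ 2 * √g ≤ (1 / 2) ^ 2 * 1 := by gcongr
      _ ≤ 20480 * 1 * (2 * (1 / 2) * (1 ^ 2 * 1)) := by norm_num
      _ ≤ _ := by gcongr
  have ht₂1 : t₂ ≤ 1 := by
    rw [ht₂, div_le_one (by positivity)]
    linarith
  have hTn : T ≤ n := (Nat.le_mul_of_pos_left T hr0).trans hrT
  have hT0r : (0 : ℝ) < T := by exact_mod_cast hT0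
  have hmain := h.measure_compl_successEvent_le hΔ0 hΔ1 (n := n) (r := r) (T := T)
    (η := √(2 * s / r)) (ε := ε) (g := g) (x := g / (4 * k)) (t₁ := t₁) (t₂ := t₂) rfl rfl
    (Real.sqrt_nonneg _) (by exact_mod_cast hsr) hrd hηs hsmall he1 hT0 hTn
    (one_sub_pow_mul_sqrt_le hs hk hg0 hg1 rfl hT1) (by positivity) ht₁1
    (by rw [hε, hσa, ht₁]; field_simp) (by positivity) ht₂1
    (by rw [hσa, ht₂, ← hlam]; field_simp; norm_num) htop
  have hT1r : (1 : ℝ) ≤ T := by exact_mod_cast hT0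
  -- Rounding down costs at most a factor 2 because `T ≤ n`.
  have hB : n / (2 * T) ≤ ((n / T : ℕ) : ℝ) := by
    have h1 : n < T * (n / T + 1) := by
      have := Nat.lt_mul_div_succ n hT0
      simpa using this
    have h2 : 1 ≤ n / T := Nat.div_pos hTn hT0
    have h3 : (n : ℝ) < T * ((n / T : ℕ) + 1) := by exact_mod_cast h1
    have h4 : (1 : ℝ) ≤ (n / T : ℕ) := by exact_mod_cast h2
    have h5 : (T : ℝ) * 1 ≤ T * (n / T : ℕ) := by gcongr
    rw [div_le_iff₀ (by positivity)]
    linarith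
  have hdev1' : 4 * Real.log (d * T / δ) ≤ (n / T : ℕ) * t₁ ^ 2 / 2048 := hdev1.trans (by gcongr)
  have hd2 : (2 : ℝ) ≤ d := by
    have h1 : (r : ℝ) ≤ d := by exact_mod_cast hrd
    linarith
  obtain ⟨hb1, hb2⟩ := failure_bounds hδ0 hδ1.le hT1r hd2 (by exact_mod_cast hrd) hQ hdev1' hdev2
  have hcompl : (Measure.pi fun _ : Fin n => D) (successEvent top r T v Δ)ᶜ ≤ ENNReal.ofReal δ := by
    refine hmain.trans ((add_le_add (ENNReal.ofReal_le_ofReal hb1)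
      (ENNReal.ofReal_le_ofReal hb2)).trans_eq ?_)
    rw [← ENNReal.ofReal_add (by positivity) (by positivity), add_halves]
  -- Subadditivity is enough here, so the success event need not be measurable.
  have huniv : 1 ≤ (Measure.pi fun _ : Fin n => D) (successEvent top r T v Δ) +
      (Measure.pi fun _ : Fin n => D) (successEvent top r T v Δ)ᶜ := by
    have h1 := measure_union_le (μ := Measure.pi fun _ : Fin n => D)
      (successEvent top r T v Δ) (successEvent top r T v Δ)ᶜ
    rwa [Set.union_compl_self, measure_univ] at h1
  rw [ENNReal.ofReal_sub _ hδ0.le, ENNReal.ofReal_one, tsub_le_iff_right]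
  exact huniv.trans (add_le_add le_rfl hcompl)

end Accuracy

/-! ### Reasoning about programs -/

/-- From the state `m` the program `p` halts within `c` steps in a state satisfying `Q`. -/
def WP (p : Prog) (c : ℕ) (Q : RAMState → Prop) (m : RAMState) : Prop :=
  ∃ c' m', Runs p m c' m' ∧ c' ≤ c ∧ Q m'

theorem WP.mono {p : Prog} {c c' : ℕ} {Q Q' : RAMState → Prop} {m : RAMState} (h : WP p c Q m)
    (hc : c ≤ c') (hQ : ∀ m', Q m' → Q' m') : WP p c' Q' m := by
  obtain ⟨e, m', hr, he, hq⟩ := h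
  exact ⟨e, m', hr, he.trans hc, hQ _ hq⟩

theorem WP.instr {i : Instr} {Q : RAMState → Prop} {m : RAMState} (h : Q (i.step m)) :
    WP (.instr i) 1 Q m := ⟨1, _, .instr i m, le_rfl, h⟩

theorem WP.seq {p q : Prog} {c c' : ℕ} {Q : RAMState → Prop} {m : RAMState}
    (h : WP p c (WP q c' Q) m) : WP (.seq p q) (c + c') Q m := by
  obtain ⟨e, m', hr, he, e', m'', hr', he', hq⟩ := h
  exact ⟨e + e', m'', hr.seq hr', add_le_add he he', hq⟩

theorem WP.branch {b : Test} {p q : Prog} {c : ℕ} {Q : RAMState → Prop} {m : RAMState}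
    (hp : b.holds m → WP p c Q m) (hq : ¬ b.holds m → WP q c Q m) :
    WP (.branch b p q) (c + 1) Q m := by
  by_cases hb : b.holds m
  · obtain ⟨e, m', hr, he, h⟩ := hp hb
    exact ⟨e + 1, m', .branch_true hb hr, Nat.succ_le_succ he, h⟩
  · obtain ⟨e, m', hr, he, h⟩ := hq hb
    exact ⟨e + 1, m', .branch_false hb hr, Nat.succ_le_succ he, h⟩

theorem WP.loop {b : Test} {p : Prog} {c N : ℕ} (Inv : ℕ → RAMState → Prop)
    (hstep : ∀ j < N, ∀ m, Inv j m → b.holds m ∧ WP p c (Inv (j + 1)) m)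
    (hend : ∀ m, Inv N m → ¬ b.holds m) {m : RAMState} (h0 : Inv 0 m) :
    WP (.loop b p) (N * (c + 1) + 1) (Inv N) m := by
  have key : ∀ l j, j + l = N → ∀ m, Inv j m → WP (.loop b p) (l * (c + 1) + 1) (Inv N) m := by
    intro l
    induction l with
    | zero =>
      intro j hj m hm
      obtain rfl : j = N := by omega
      exact ⟨1, m, .loop_false (hend m hm), by omega, hm⟩
    | succ l ih =>
      intro j hj m hm
      obtain ⟨hb, e, m', hr, he, hm'⟩ := hstep j (by omega) m hm
      obtain ⟨e', m'', hr', he', hm''⟩ := ih (j + 1) (by omega) m' hm'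
      exact ⟨e + e' + 1, m'', .loop_true hb hr hr', by rw [Nat.succ_mul]; omega, hm''⟩
  exact key N 0 (by omega) m h0

/-- The memory below the given register and array numbers is the same in both states. -/
structure Frame (a b ra ia : ℕ) (m m' : RAMState) : Prop where
  int : ∀ i < a, m'.int i = m.int i
  real : ∀ i < b, m'.real i = m.real i
  realArr : ∀ A < ra, m'.realArr A = m.realArr A
  intArr : ∀ A < ia, m'.intArr A = m.intArr A

theorem Frame.refl (a b ra ia : ℕ) (m : RAMState) : Frame a b ra ia m m :=
  ⟨fun _ _ => rfl, fun _ _ => rfl, fun _ _ => rfl, fun _ _ => rfl⟩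

theorem Frame.trans {a b ra ia : ℕ} {m m' m'' : RAMState} (h : Frame a b ra ia m m')
    (h' : Frame a b ra ia m' m'') : Frame a b ra ia m m'' :=
  ⟨fun i hi => (h'.int i hi).trans (h.int i hi), fun i hi => (h'.real i hi).trans (h.real i hi),
    fun i hi => (h'.realArr i hi).trans (h.realArr i hi),
    fun i hi => (h'.intArr i hi).trans (h.intArr i hi)⟩

/-- The instruction writes only to memory from the given register and array numbers on. -/
def Instr.writesFrom (a b ra ia : ℕ) : Instr → Bool
  | .iconst x _ => decide (a ≤ x)
  | .iadd x _ _ => decide (a ≤ x)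
  | .isub x _ _ => decide (a ≤ x)
  | .iload x _ _ => decide (a ≤ x)
  | .istore A _ _ => decide (ia ≤ A)
  | .ofInt x _ => decide (b ≤ x)
  | .radd x _ _ => decide (b ≤ x)
  | .rsub x _ _ => decide (b ≤ x)
  | .rmul x _ _ => decide (b ≤ x)
  | .rdiv x _ _ => decide (b ≤ x)
  | .rsqrt x _ => decide (b ≤ x)
  | .rload x _ _ _ => decide (b ≤ x)
  | .rstore A _ _ _ => decide (ra ≤ A)

/-- The program writes only to memory from the given register and array numbers on. -/
def Prog.writesFrom (a b ra ia : ℕ) : Prog → Bool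
  | .instr i => i.writesFrom a b ra ia
  | .seq p q => p.writesFrom a b ra ia && q.writesFrom a b ra ia
  | .branch _ p q => p.writesFrom a b ra ia && q.writesFrom a b ra ia
  | .loop _ p => p.writesFrom a b ra ia

theorem Instr.frame_step {a b ra ia : ℕ} {i : Instr} (h : i.writesFrom a b ra ia = true)
    (m : RAMState) : Frame a b ra ia m (i.step m) := by
  cases i <;> simp only [Instr.writesFrom, decide_eq_true_eq] at h <;>
    refine ⟨fun j hj => ?_, fun j hj => ?_, fun j hj => ?_, fun j hj => ?_⟩ <;>
    first
    | rfl
    | exact Function.update_of_ne (by omega) _ _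

/-- A syntactic check, settled by `rfl` for a concrete program, shows what is left untouched. Inner
loops use higher registers than outer ones, so one lower bound for each kind of memory suffices. -/
theorem Runs.frame {a b ra ia : ℕ} {p : Prog} {m m' : RAMState} {c : ℕ} (h : Runs p m c m')
    (hp : p.writesFrom a b ra ia = true) : Frame a b ra ia m m' := by
  induction h with
  | instr c m => exact Instr.frame_step hp m
  | seq _ _ ih ih' =>
    simp only [Prog.writesFrom, Bool.and_eq_true] at hp
    exact (ih hp.1).trans (ih' hp.2)
  | branch_true _ _ ih =>
    simp only [Prog.writesFrom, Bool.and_eq_true] at hp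
    exact ih hp.1
  | branch_false _ _ ih =>
    simp only [Prog.writesFrom, Bool.and_eq_true] at hp
    exact ih hp.2
  | loop_true _ _ _ ih ih' => exact (ih hp).trans (ih' hp)
  | loop_false _ => exact Frame.refl _ _ _ _ _

theorem WP.frame {a b ra ia : ℕ} {p : Prog} {c : ℕ} {Q : RAMState → Prop} {m : RAMState}
    (hp : p.writesFrom a b ra ia = true) (h : WP p c Q m) :
    WP p c (fun m' => Frame a b ra ia m m' ∧ Q m') m := by
  obtain ⟨e, m', hr, he, hq⟩ := h
  exact ⟨e, m', hr, he, hr.frame hp, hq⟩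

/-- A straight-line program. -/
def block : Instr → List Instr → Prog
  | i, [] => .instr i
  | i, j :: l => .seq (.instr i) (block j l)

/-- The effect of a straight-line program. -/
def exec : Instr → List Instr → RAMState → RAMState
  | i, [], m => i.step m
  | i, j :: l, m => exec j l (i.step m)

theorem WP.block {Q : RAMState → Prop} (l : List Instr) (i : Instr) {m : RAMState}
    (h : Q (exec i l m)) : WP (block i l) (l.length + 1) Q m := by
  induction l generalizing i m with
  | nil => exact WP.instr h
  | cons j l ih =>
    have h2 : WP (.seq (.instr i) (SparsePCA.block j l)) (1 + (l.length + 1)) Q m :=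
      WP.seq (WP.instr (ih j h))
    exact h2.mono (by simp; omega) fun _ h => h

/-- `for cnt = 0, …, bnd - 1 do body`, where integer register `5` holds `1`. -/
def forLoop (cnt bnd : ℕ) (body : Prog) : Prog :=
  .seq (.instr (.iconst cnt 0)) (.loop (.ilt cnt bnd) (.seq body (.instr (.iadd cnt cnt 5))))

/-- The rule for counting loops. The invariant may not depend on the counter. -/
theorem WP.forLoop {a b ra ia cnt bnd c N : ℕ} {body : Prog} (Inv : ℕ → RAMState → Prop)
    {m : RAMState} (hw : (forLoop cnt bnd body).writesFrom a b ra ia = true)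
    (hwb : body.writesFrom (cnt + 1) 0 0 0 = true) (ha : 5 < a) (hbnd : bnd < a)
    (h5 : m.int 5 = 1) (hN : m.int bnd = N)
    (hInv : ∀ j e m', Inv j m' → Inv j { m' with int := Function.update m'.int cnt e })
    (h0 : Inv 0 m)
    (hstep : ∀ j < N, ∀ m', Frame a b ra ia m m' → m'.int cnt = j → Inv j m' →
      WP body c (Inv (j + 1)) m') :
    WP (forLoop cnt bnd body) (N * (c + 2) + 2) (fun m' => Frame a b ra ia m m' ∧ Inv N m') m := by
  have hw1 := hw
  simp only [SparsePCA.forLoop, Prog.writesFrom, Instr.writesFrom, Bool.and_eq_true,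
    decide_eq_true_eq] at hw1
  have hcnt : a ≤ cnt := hw1.1
  refine WP.frame hw ?_
  have hl := WP.loop (b := .ilt cnt bnd) (p := .seq body (.instr (.iadd cnt cnt 5))) (c := c + 1)
    (N := N) (fun j m' => Frame a b ra ia m m' ∧ m'.int cnt = j ∧ Inv j m') ?_ ?_
    (m := (Instr.iconst cnt 0).step m) ?_
  · exact ((WP.instr (i := .iconst cnt 0) hl).seq).mono (by ring_nf; omega) fun m' h => h.2.2
  · rintro j hj m' ⟨hF, hc, hI⟩
    constructor
    · change m'.int cnt < m'.int bnd
      rw [hF.int _ hbnd, hc, hN]; exact hj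
    -- Two frames of the body are needed: one protects the loop counter, the other what the whole
    -- loop leaves alone.
    · have hb := (hstep j hj m' hF hc hI).frame hwb
      have hb' := hb.frame (a := a) (b := b) (ra := ra) (ia := ia) hw1.2.1
      refine WP.seq (hb'.mono le_rfl ?_)
      rintro m'' ⟨hF', hFc, hI'⟩
      refine WP.instr ⟨hF.trans (hF'.trans (Instr.frame_step (by simpa [Instr.writesFrom]) _)), ?_,
        hInv _ _ _ hI'⟩
      change Function.update m''.int cnt (m''.int cnt + m''.int 5) cnt = j + 1
      rw [Function.update_self, hFc.int _ (by omega), hc, hF'.int _ ha, hF.int _ ha, h5]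
  · rintro m' ⟨hF, hc, _⟩
    change ¬ m'.int cnt < m'.int bnd
    rw [hF.int _ hbnd, hc, hN]; exact lt_irrefl _
  · exact ⟨Instr.frame_step (by simpa [Instr.writesFrom]) _, Function.update_self _ _ _,
      hInv _ _ _ h0⟩

/-! ### The program

Integer registers: `0` to `3` hold `n, d, r, T`, `4` the batch size, `5` and `6` the constants one
and zero, `7` the restart, `8` the iteration, `10` the current sample, `9` and `11` counters, `15`
the selected coordinate, `13` a coordinate, `14` a mark. Real registers: `0` holds zero, `1` one,
`2` the best objective so far, `3` the number `n`, `4` the batch size, `5` the current objective,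
`6` an inner product, `7` and `8` temporary values, `9` the largest square, `10` the norm. Real
arrays: `0` holds the samples, `1` the output, `2` the iterate, `3` its image. The integer array `0`
holds the marks of the selected coordinates. -/

/-- The constants in memory. -/
structure Consts (m : RAMState) : Prop where
  one : m.int 5 = 1
  zero : m.int 6 = 0
  rzero : m.real 0 = 0
  rone : m.real 1 = 1

theorem Consts.frame {m m' : RAMState} {a b ra ia : ℕ} (h : Consts m) (hF : Frame a b ra ia m m')
    (ha : 7 ≤ a) (hb : 2 ≤ b) : Consts m' :=
  ⟨by rw [hF.int _ (by omega), h.one], by rw [hF.int _ (by omega), h.zero],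
    by rw [hF.real _ (by omega), h.rzero], by rw [hF.real _ (by omega), h.rone]⟩

/-- Inner product of the current sample and the iterate. -/
def dotProg : Prog :=
  .seq (.instr (.ofInt 6 6)) (forLoop 13 1 (block (.rload 7 0 10 13)
    [.rload 8 2 6 13, .rmul 7 7 8, .radd 6 6 7]))

theorem wp_dotProg {m : RAMState} (h : Consts m) :
    WP dotProg (6 * m.int 1 + 3) (fun m' => Frame 13 6 100 100 m m' ∧
      m'.real 6 = ∑ j ∈ Finset.range (m.int 1), m.realArr 0 (m.int 10) j * m.realArr 2 0 j) m := by
  refine WP.frame rfl (WP.mono (c := 1 + (m.int 1 * (4 + 2) + 2)) ?_ (by omega) fun m' h => h)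
  refine WP.seq (WP.instr ?_)
  set m₁ := (Instr.ofInt 6 6).step m with hm₁
  have hF₁ : Frame 13 6 100 100 m m₁ := Instr.frame_step rfl m
  have hC := h.frame hF₁ (by norm_num) (by norm_num)
  refine (WP.forLoop (a := 13) (b := 6) (ra := 100) (ia := 100) (c := 4) (N := m.int 1)
    (fun J m' => m'.real 6 =
      ∑ j ∈ Finset.range J, m.realArr 0 (m.int 10) j * m.realArr 2 0 j) rfl rfl (by norm_num)
    (by norm_num) hC.one (hF₁.int _ (by norm_num)) (fun _ _ _ h => h) ?_ ?_).mono le_rfl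
    fun m' h => h.2
  · simp [hm₁, Instr.step, h.zero]
  · intro j hj m' hF hc hI
    refine WP.block _ _ ?_
    have hF' := hF₁.trans hF
    simp only [exec, Instr.step, Function.update_apply]
    norm_num
    rw [hI, Finset.sum_range_succ, hF'.int 10 (by norm_num), hF'.int 6 (by norm_num), h.zero, hc,
      hF'.realArr 0 (by norm_num), hF'.realArr 2 (by norm_num)]

/-- Add a multiple of the current sample to the image. -/
def axpyProg : Prog :=
  forLoop 13 1 (block (.rload 7 0 10 13) [.rmul 7 7 6, .rload 8 3 6 13, .radd 8 8 7, .rstore 3 6 13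
    8])

theorem wp_axpyProg {m : RAMState} (h : Consts m) :
    WP axpyProg (7 * m.int 1 + 2) (fun m' => Frame 13 7 3 100 m m' ∧ ∀ j, m'.realArr 3 0 j =
      m.realArr 3 0 j + if j < m.int 1 then m.real 6 * m.realArr 0 (m.int 10) j else 0) m := by
  refine (WP.forLoop (a := 13) (b := 7) (ra := 3) (ia := 100) (c := 5) (N := m.int 1)
    (fun J m' => ∀ j, m'.realArr 3 0 j =
      m.realArr 3 0 j + if j < J then m.real 6 * m.realArr 0 (m.int 10) j else 0) rfl rfl
    (by norm_num) (by norm_num) h.one rfl (fun _ _ _ h => h) (by simp) ?_).mono (by omega)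
    fun m' h => h
  intro j hj m' hF hc hI
  refine WP.block _ _ fun l => ?_
  simp only [exec, Instr.step, Function.update_apply]
  norm_num
  rw [hF.int 6 (by norm_num), h.zero, hc, hF.int 10 (by norm_num), hF.realArr 0 (by norm_num),
    hF.real 6 (by norm_num)]
  by_cases hl : l = j
  · subst hl
    simp [hI l, mul_comm]
  · rw [Function.update_self, Function.update_of_ne hl, hI l]
    congr 1
    exact if_congr (by omega) rfl rfl

/-- Add the products of the iterate with the samples of one batch to the image. -/
def mulProg : Prog :=
  forLoop 9 4 (.seq dotProg (.seq axpyProg (.instr (.iadd 10 10 5))))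

/-- The image is accumulated as the sum of the vectors ⟨x_l, u⟩x_l, which costs O(d) per sample. -/
theorem wp_mulProg {m : RAMState} (h : Consts m) :
    WP mulProg (m.int 4 * (13 * m.int 1 + 8) + 2) (fun m' => Frame 9 6 3 100 m m' ∧
      m'.int 10 = m.int 10 + m.int 4 ∧ ∀ j < m.int 1, m'.realArr 3 0 j = m.realArr 3 0 j +
        ∑ l ∈ Finset.range (m.int 4), (∑ i ∈ Finset.range (m.int 1),
          m.realArr 0 (m.int 10 + l) i * m.realArr 2 0 i) * m.realArr 0 (m.int 10 + l) j) m := by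
  refine (WP.forLoop (cnt := 9) (bnd := 4) (a := 9) (b := 6) (ra := 3) (ia := 100)
    (c := 13 * m.int 1 + 6)
    (N := m.int 4)
    (fun L m' => m'.int 10 = m.int 10 + L ∧ ∀ j < m.int 1, m'.realArr 3 0 j = m.realArr 3 0 j +
        ∑ l ∈ Finset.range L, (∑ i ∈ Finset.range (m.int 1),
          m.realArr 0 (m.int 10 + l) i * m.realArr 2 0 i) * m.realArr 0 (m.int 10 + l) j) rfl rfl
    (by norm_num) (by norm_num) h.one rfl (fun _ _ _ h => h) (by simp) ?_).mono le_rfl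
    fun m' h => h
  rintro L hL m' hF - ⟨hq, hI⟩
  have hC := h.frame hF (by norm_num) (by norm_num)
  have hd : m'.int 1 = m.int 1 := hF.int _ (by norm_num)
  refine (WP.seq ((wp_dotProg hC).mono le_rfl (Q' := fun m'' => WP _ (7 * m.int 1 + 3) _ m'')
    ?_)).mono
    (by rw [hd]; omega) fun m' h => h
  rintro m₁ ⟨hF₁, hdot⟩
  have hC₁ := hC.frame hF₁ (by norm_num) (by norm_num)
  have hd₁ : m₁.int 1 = m.int 1 := (hF₁.int _ (by norm_num)).trans hd
  have hq₁ : m₁.int 10 = m.int 10 + L := (hF₁.int _ (by norm_num)).trans hq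
  refine (WP.seq ((wp_axpyProg hC₁).mono le_rfl (Q' := fun m'' => WP _ 1 _ m'') ?_)).mono
    (by rw [hd₁]) fun m' h => h
  rintro m₂ ⟨hF₂, hy⟩
  refine WP.instr ⟨?_, fun j hj => ?_⟩
  · simp only [Instr.step, Function.update_self]
    rw [hF₂.int 10 (by norm_num), hq₁, hF₂.int 5 (by norm_num), hC₁.one, add_assoc]
  · simp only [Instr.step]
    rw [hy, hd₁, if_pos hj, hdot, hd, hF₁.realArr 3 (by norm_num), hI j hj, Finset.sum_range_succ,
      hF₁.realArr 0 (by norm_num), hq₁, hq, hF.realArr 0 (by norm_num), hF.realArr 2 (by norm_num),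
      add_assoc]

/-- Clear the image and the marks. -/
def clearProg : Prog := forLoop 13 1 (block (.rstore 3 6 13 0) [.istore 0 13 6])

theorem wp_clearProg {m : RAMState} (h : Consts m) :
    WP clearProg (4 * m.int 1 + 2) (fun m' => Frame 13 100 3 0 m m' ∧ ∀ j < m.int 1,
      m'.realArr 3 0 j = 0 ∧ m'.intArr 0 j = 0) m := by
  refine (WP.forLoop (a := 13) (b := 100) (ra := 3) (ia := 0) (c := 2) (N := m.int 1)
    (fun J m' => ∀ j < J, m'.realArr 3 0 j = 0 ∧ m'.intArr 0 j = 0) rfl rfl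
    (by norm_num) (by norm_num) h.one rfl (fun _ _ _ h => h) (by simp) ?_).mono (by omega)
    fun m' h => h
  intro j hj m' hF hc hI
  refine WP.block _ _ fun l hl => ?_
  simp only [exec, Instr.step, Function.update_apply]
  norm_num
  rw [hF.int 6 (by norm_num), h.zero, hc, hF.real 0 (by norm_num), h.rzero]
  by_cases hlj : l = j
  · simp [hlj]
  · simpa [hlj] using hI l (by omega)

/-- Divide the image by the batch size. -/
def scaleProg : Prog := forLoop 13 1 (block (.rload 7 3 6 13) [.rdiv 7 7 4, .rstore 3 6 13 7])

theorem wp_scaleProg {m : RAMState} (h : Consts m) :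
    WP scaleProg (5 * m.int 1 + 2) (fun m' => Frame 13 7 3 100 m m' ∧ ∀ j < m.int 1,
      m'.realArr 3 0 j = m.realArr 3 0 j / m.real 4) m := by
  refine (WP.forLoop (a := 13) (b := 7) (ra := 3) (ia := 100) (c := 3) (N := m.int 1)
    (fun J m' => ∀ j, m'.realArr 3 0 j =
      if j < J then m.realArr 3 0 j / m.real 4 else m.realArr 3 0 j) rfl rfl
    (by norm_num) (by norm_num) h.one rfl (fun _ _ _ h => h) (by simp) ?_).mono (by omega)
    fun m' h => ⟨h.1, fun j hj => by rw [h.2, if_pos hj]⟩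
  intro j hj m' hF hc hI
  refine WP.block _ _ fun l => ?_
  simp only [exec, Instr.step, Function.update_apply]
  norm_num
  rw [hF.int 6 (by norm_num), h.zero, hc, hF.real 4 (by norm_num), hI]
  by_cases hlj : l = j
  · simp [hlj]
  · rw [Function.update_self, Function.update_of_ne hlj, hI]
    exact if_congr (by omega) rfl rfl

/-! ### Selection of the largest entries -/

/-- `Beats y i j`: the entry `i` of `y` comes before the entry `j` in the order by decreasing
magnitude, where ties are broken in favour of the smaller index. -/
def Beats {ι : Type*} [LT ι] (y : ι → ℝ) (i j : ι) : Prop :=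
  y j ^ 2 < y i ^ 2 ∨ y j ^ 2 = y i ^ 2 ∧ i < j

theorem Beats.trans {y : ℕ → ℝ} {i j l : ℕ} (h : Beats y i j) (h' : Beats y j l) : Beats y i l := by
  rcases h with h | ⟨h, hi⟩ <;> rcases h' with h' | ⟨h', hj⟩
  · exact .inl (h'.trans h)
  · exact .inl (h' ▸ h)
  · exact .inl (h ▸ h')
  · exact .inr ⟨h'.trans h, hi.trans hj⟩

theorem Beats.not_symm {y : ℕ → ℝ} {i j : ℕ} (h : Beats y i j) : ¬ Beats y j i := by
  rintro (h' | ⟨h', hj⟩) <;> rcases h with h | ⟨h, hi⟩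
  · exact lt_asymm h h'
  · exact h'.ne h.symm
  · exact h.ne h'.symm
  · omega

/-- `A` consists of the first entries of `y` among those below `d` in the order `Beats`. -/
structure IsSelection (d : ℕ) (y : ℕ → ℝ) (A : Finset ℕ) : Prop where
  lt : ∀ i ∈ A, i < d
  beats : ∀ i ∈ A, ∀ j < d, j ∉ A → Beats y i j

theorem IsSelection.insert {d : ℕ} {y : ℕ → ℝ} {A : Finset ℕ} (h : IsSelection d y A) {b : ℕ}
    (hb : b < d) (hbA : b ∉ A) (hmax : ∀ j < d, j ∉ A → j = b ∨ Beats y b j) :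
    IsSelection d y (insert b A) := by
  constructor
  · intro i hi
    rcases Finset.mem_insert.1 hi with rfl | hi
    · exact hb
    · exact h.lt i hi
  · intro i hi j hj hjA
    rw [Finset.mem_insert, not_or] at hjA
    rcases Finset.mem_insert.1 hi with rfl | hi
    · exact (hmax j hj hjA.2).resolve_left hjA.1
    · exact h.beats i hi j hj hjA.2

/-- Find the first unmarked coordinate in the order `Beats`. -/
def findProg : Prog :=
  .seq (block (.rsub 9 0 1) [.iconst 15 0]) (forLoop 13 1 (.seq (.instr (.iload 14 0 13))
    (.branch (.ilt 14 5) (.seq (block (.rload 7 3 6 13) [.rmul 7 7 7])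
      (.branch (.rlt 9 7) (block (.radd 9 7 0) [.iadd 15 13 6]) (.instr (.iconst 14 0))))
      (.instr (.iconst 14 0)))))

/-- The marks are those of the set `A`. -/
def Marked (d : ℕ) (m : RAMState) (A : Finset ℕ) : Prop :=
  ∀ j < d, m.intArr 0 j = if j ∈ A then 1 else 0

theorem wp_findProg {m : RAMState} (h : Consts m) {A : Finset ℕ} (hA : Marked (m.int 1) m A)
    (hAd : ∃ j < m.int 1, j ∉ A) :
    WP findProg (9 * m.int 1 + 4) (fun m' => Frame 12 7 100 100 m m' ∧ m'.int 15 < m.int 1 ∧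
      m'.int 15 ∉ A ∧ ∀ j < m.int 1, j ∉ A → j = m'.int 15 ∨
        Beats (m.realArr 3 0) (m'.int 15) j) m := by
  refine WP.frame rfl (WP.mono (c := 2 + (m.int 1 * (7 + 2) + 2)) ?_ (by omega) fun m' h => h)
  refine WP.seq (WP.block _ _ ?_)
  set m₁ := exec (.rsub 9 0 1) [.iconst 15 0] m with hm₁
  have hF₁ : Frame 12 7 100 100 m m₁ :=
    (Instr.frame_step (i := .rsub 9 0 1) rfl m).trans (Instr.frame_step (i := .iconst 15 0) rfl _)
  have hC := h.frame hF₁ (by norm_num) (by norm_num)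
  refine (WP.forLoop (cnt := 13) (bnd := 1) (a := 12) (b := 7) (ra := 100) (ia := 100) (c := 7)
    (N := m.int 1)
    -- The record starts at -1, below every square, so even a zero entry is recorded; it stays there
    -- while only marked coordinates have been seen.
    (fun J m' => (m'.real 9 = -1 ∧ ∀ j < J, j ∈ A) ∨ (m'.real 9 = m.realArr 3 0 (m'.int 15) ^ 2 ∧
      m'.int 15 < J ∧ m'.int 15 ∉ A ∧ ∀ j < J, j ∉ A → j = m'.int 15 ∨
        Beats (m.realArr 3 0) (m'.int 15) j)) rfl rfl
    (by norm_num) (by norm_num) hC.one (hF₁.int _ (by norm_num)) (fun _ _ _ h => h) ?_ ?_).mono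
    le_rfl ?_
  · left
    simp [hm₁, exec, Instr.step, h.rzero, h.rone]
  · intro j hj m' hF hc hI
    have hF' := hF₁.trans hF
    have hC' := h.frame hF' (by norm_num) (by norm_num)
    refine WP.mono (c := 1 + ((2 + (2 + 1)) + 1)) ?_ (by omega) fun m' h => h
    refine WP.seq (WP.instr (WP.branch ?_ ?_))
    · intro hmark
      simp only [Test.holds, Instr.step, Function.update_self] at hmark
      rw [Function.update_of_ne (by norm_num), hC'.one, hc, hF'.intArr 0 (by norm_num), hA j hj,
        Nat.lt_one_iff] at hmark
      have hjA : j ∉ A := by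
        intro hjA; rw [if_pos hjA] at hmark; omega
      refine WP.seq (WP.block _ _ (WP.branch (c := 2) ?_ ?_))
      · intro hlt
        refine WP.block _ _ (.inr ?_)
        simp only [Test.holds, exec, Instr.step, Function.update_apply] at hlt ⊢
        norm_num at hlt ⊢
        rw [hc, hC'.zero, hF'.realArr 3 (by norm_num)] at hlt ⊢
        rw [hC'.rzero]
        refine ⟨by rw [add_zero, add_zero, sq], by omega, by simpa using hjA, fun l hl hlA => ?_⟩
        rcases hl.lt_or_eq with hl' | rfl
        · right
          rcases hI with ⟨_, hI⟩ | ⟨h9, h12, h12A, hI⟩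
          · exact absurd (hI l hl') hlA
          · have hb : Beats (m.realArr 3 0) j (m'.int 15) := .inl (by rw [← h9, sq]; exact hlt)
            rcases hI l hl' hlA with rfl | h'
            · exact hb
            · exact hb.trans h'
        · exact .inl rfl
      · intro hlt
        refine (WP.instr (.inr ?_)).mono (by norm_num) fun m' h => h
        simp only [Test.holds, exec, Instr.step, Function.update_apply] at hlt ⊢
        norm_num at hlt ⊢
        rw [hc, hC'.zero, hF'.realArr 3 (by norm_num)] at hlt
        rcases hI with ⟨h9, _⟩ | ⟨h9, h12, h12A, hI⟩
        · exfalso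
          rw [h9] at hlt
          nlinarith [mul_self_nonneg (m.realArr 3 0 j)]
        · refine ⟨h9, by omega, h12A, fun l hl hlA => ?_⟩
          rcases hl.lt_or_eq with hl' | rfl
          · exact hI l hl' hlA
          · right
            rw [h9, ← sq] at hlt
            -- The program's test is strict, so on a tie the earlier index is kept.
            rcases hlt.lt_or_eq with h' | h'
            · exact .inl h'
            · exact .inr ⟨h', h12⟩
    · intro hmark
      refine (WP.instr ?_).mono (by norm_num) fun m' h => h
      simp only [Test.holds, Instr.step, Function.update_self] at hmark
      rw [Function.update_of_ne (by norm_num), hC'.one, hc, hF'.intArr 0 (by norm_num), hA j hj,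
        Nat.lt_one_iff] at hmark
      have hjA : j ∈ A := by
        by_contra hjA; rw [if_neg hjA] at hmark; exact hmark rfl
      simp only [Instr.step, Function.update_apply]
      norm_num
      rcases hI with ⟨h9, hI⟩ | ⟨h9, h12, h12A, hI⟩
      · left
        refine ⟨h9, fun l hl => ?_⟩
        rcases hl.lt_or_eq with hl' | rfl
        · exact hI l hl'
        · exact hjA
      · right
        refine ⟨h9, by omega, h12A, fun l hl hlA => ?_⟩
        rcases hl.lt_or_eq with hl' | rfl
        · exact hI l hl' hlA
        · exact absurd hjA hlA
  · rintro m' ⟨_, ⟨_, hI⟩ | ⟨_, h12, h12A, hI⟩⟩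
    · obtain ⟨j, hj, hjA⟩ := hAd
      exact absurd (hI j hj) hjA
    · exact ⟨h12, h12A, hI⟩

/-- Mark the first `r` coordinates. -/
def selectProg : Prog := forLoop 11 2 (.seq findProg (.instr (.istore 0 15 5)))

theorem wp_selectProg {m : RAMState} (h : Consts m) (hA : ∀ j < m.int 1, m.intArr 0 j = 0)
    (hr : m.int 2 ≤ m.int 1) :
    WP selectProg (m.int 2 * (9 * m.int 1 + 7) + 2) (fun m' => Frame 11 7 100 0 m m' ∧
      ∃ A : Finset ℕ, A.card = m.int 2 ∧ IsSelection (m.int 1) (m.realArr 3 0) A ∧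
        Marked (m.int 1) m' A) m := by
  refine (WP.forLoop (a := 11) (b := 7) (ra := 100) (ia := 0) (c := 9 * m.int 1 + 5)
    (N := m.int 2) (fun J m' => ∃ A : Finset ℕ, A.card = J ∧
      IsSelection (m.int 1) (m.realArr 3 0) A ∧ Marked (m.int 1) m' A) rfl rfl
    (by norm_num) (by norm_num) h.one rfl (fun _ _ _ h => h)
    ⟨∅, rfl, ⟨by simp, by simp⟩, fun j hj => by simpa using hA j hj⟩ ?_).mono le_rfl fun m' h => h
  rintro J hJ m' hF - ⟨A, hAJ, hS, hM⟩
  have hC := h.frame hF (by norm_num) (by norm_num)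
  have hd : m'.int 1 = m.int 1 := hF.int _ (by norm_num)
  have hex : ∃ j < m'.int 1, j ∉ A := by
    by_contra hcon
    push Not at hcon
    have := Finset.card_le_card (s := Finset.range (m'.int 1)) (t := A)
      fun j hj => hcon j (Finset.mem_range.1 hj)
    rw [Finset.card_range] at this
    omega
  refine (WP.seq ((wp_findProg hC (A := A) (by rwa [hd]) hex).mono le_rfl
    (Q' := fun m'' => WP _ 1 _ m'') ?_)).mono (by rw [hd]) fun m' h => h
  rintro m₁ ⟨hF₁, hb, hbA, hmax⟩
  rw [hd] at hb hmax
  rw [hF.realArr 3 (by norm_num)] at hmax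
  refine WP.instr ⟨insert (m₁.int 15) A, by rw [Finset.card_insert_of_notMem hbA, hAJ],
    hS.insert hb hbA hmax, fun j hj => ?_⟩
  simp only [Instr.step, Function.update_apply]
  rw [if_pos trivial, hF₁.int 5 (by norm_num), hC.one, hF₁.intArr 0 (by norm_num)]
  by_cases hj15 : j = m₁.int 15
  · simp [hj15]
  · rw [Function.update_of_ne hj15, hM j hj]
    simp [hj15]

/-! ### The truncation map of the program -/

theorem exists_isSelection (y : ℕ → ℝ) {r d : ℕ} (hr : r ≤ d) :
    ∃ A : Finset ℕ, A.card = r ∧ IsSelection d y A := by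
  induction r with
  | zero => exact ⟨∅, rfl, by simp, by simp⟩
  | succ r ih =>
    obtain ⟨A, hAr, hA⟩ := ih (by omega)
    have hne : (Finset.range d \ A).Nonempty := by
      rw [← Finset.card_pos]
      have := Finset.le_card_sdiff A (Finset.range d)
      rw [Finset.card_range] at this
      omega
    -- The lexicographic order with reversed indices realises `Beats`.
    obtain ⟨b, hb, hmax⟩ := Finset.exists_max_image _
      (fun j => toLex (y j ^ 2, OrderDual.toDual j)) hne
    rw [Finset.mem_sdiff, Finset.mem_range] at hb
    refine ⟨insert b A, by rw [Finset.card_insert_of_notMem hb.2, hAr],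
      hA.insert hb.1 hb.2 fun j hj hjA => ?_⟩
    have h := hmax j (Finset.mem_sdiff.2 ⟨Finset.mem_range.2 hj, hjA⟩)
    rw [Prod.Lex.toLex_le_toLex] at h
    rcases h with h | ⟨h, h'⟩
    · exact .inr (.inl h)
    · rcases (OrderDual.toDual_le_toDual.1 h').lt_or_eq with h' | h'
      · exact .inr (.inr ⟨h, h'⟩)
      · exact .inl h'.symm

section TopSet

variable {d : ℕ}

open scoped Classical in
/-- The first `r` coordinates of `v` in the order `Beats`. -/
def topSet (r : ℕ) (v : Vec d) : Finset (Fin d) :=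
  Finset.univ.filter fun i => (Finset.univ.filter fun j => Beats v.ofLp j i).card < r

/-- A selection is determined by ranks: whatever beats a member of `A` is another member, and all of
`A` beats a nonmember. This links the successive marking with a definition whose measurability is
evident. -/
theorem IsSelection.eq_map_topSet {y : ℕ → ℝ} {A : Finset ℕ} (hA : IsSelection d y A) {v : Vec d}
    (hy : ∀ j : Fin d, y j = v j) : A = (topSet A.card v).map Fin.valEmbedding := by
  classical
  have hB : ∀ i j : Fin d, Beats v.ofLp j i ↔ Beats y j i := fun i j => by
    simp only [Beats, hy]; rfl
  have key : ∀ i : Fin d, (i : ℕ) ∈ A ↔ i ∈ topSet A.card v := by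
    intro i
    simp only [topSet, Finset.mem_filter, Finset.mem_univ, true_and, hB]
    rw [← Finset.card_map Fin.valEmbedding]
    constructor
    · intro hi
      refine Finset.card_lt_card ((Finset.ssubset_iff_of_subset ?_).2 ⟨i, hi, ?_⟩)
      · intro j hj
        simp only [Finset.mem_map, Finset.mem_filter, Finset.mem_univ, true_and,
          Fin.valEmbedding_apply] at hj
        obtain ⟨j, hj, rfl⟩ := hj
        by_contra hjA
        exact hj.not_symm (hA.beats i hi j j.2 hjA)
      · simp only [Finset.mem_map, Finset.mem_filter, Finset.mem_univ, true_and,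
          Fin.valEmbedding_apply, not_exists, not_and]
        rintro j hj hji
        rw [hji] at hj
        exact hj.not_symm hj
    · intro hi
      by_contra hiA
      refine absurd (Finset.card_le_card fun j hj => ?_) (not_le.2 hi)
      simp only [Finset.mem_map, Finset.mem_filter, Finset.mem_univ, true_and,
        Fin.valEmbedding_apply]
      exact ⟨⟨j, hA.lt j hj⟩, hA.beats j hj i i.2 hiA, rfl⟩
  ext j
  simp only [Finset.mem_map, Fin.valEmbedding_apply]
  constructor
  · intro hj
    exact ⟨⟨j, hA.lt j hj⟩, (key ⟨j, hA.lt j hj⟩).1 hj, rfl⟩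
  · rintro ⟨i, hi, rfl⟩
    exact (key i).2 hi

theorem measurableSet_beats (i j : Fin d) : MeasurableSet {v : Vec d | Beats v.ofLp j i} := by
  have h : ∀ i : Fin d, Measurable fun v : Vec d => v i ^ 2 := fun i => by fun_prop
  exact (measurableSet_lt (h i) (h j)).union ((measurableSet_eq_fun (h i) (h j)).inter (.const _))

theorem measurableSet_mem_topSet (r : ℕ) (i : Fin d) :
    MeasurableSet {v : Vec d | i ∈ topSet r v} := by
  classical
  have h : Measurable fun v : Vec d => ∑ j, if Beats v.ofLp j i then (1 : ℕ) else 0 :=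
    Finset.measurable_sum _ fun j _ =>
      Measurable.ite (measurableSet_beats i j) measurable_const measurable_const
  convert measurableSet_lt h (measurable_const (a := r)) using 1
  ext v
  simp [topSet]

/-- The truncation map that breaks ties in favour of smaller indices. -/
def topVec (r : ℕ) (v : Vec d) : Vec d := WithLp.toLp 2 fun i => if i ∈ topSet r v then v i else 0

theorem isTopRule_topVec {r : ℕ} (hr : r ≤ d) : IsTopRule r (topVec (d := d) r) := by
  constructor
  · refine (WithLp.measurable_toLp 2 _).comp (measurable_pi_lambda _ fun i => ?_)
    exact Measurable.ite (measurableSet_mem_topSet r i) (by fun_prop) measurable_const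
  · intro v
    obtain ⟨A, hAr, hA⟩ := exists_isSelection (fun j => if h : j < d then v ⟨j, h⟩ else 0) hr
    have hT := hA.eq_map_topSet (v := v) fun j => by simp
    rw [hAr] at hT
    refine ⟨topSet r v, by rw [← Finset.card_map, ← hT, hAr], fun i hi j hj => ?_, fun i => rfl⟩
    have hm : ∀ l : Fin d, (l : ℕ) ∈ A ↔ l ∈ topSet r v := by
      intro l; rw [hT]; exact Finset.mem_map' Fin.valEmbedding
    have hb := hA.beats i ((hm i).2 hi) j j.2 (mt (hm j).1 hj)
    simp only [Beats, Fin.is_lt, dite_true, Fin.eta] at hb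
    exact sq_le_sq.1 (hb.elim le_of_lt fun h => h.1.le)

end TopSet

/-! ### One iteration -/

/-- Store the normalised truncation of the image as the new iterate. -/
def normaliseProg : Prog :=
  .seq (.instr (.ofInt 10 6)) (.seq (forLoop 13 1 (.seq (.instr (.iload 14 0 13))
    (.branch (.ilt 14 5) (.instr (.rstore 2 6 13 0))
      (block (.rload 7 3 6 13) [.rstore 2 6 13 7, .rmul 7 7 7, .radd 10 10 7]))))
    (.seq (.instr (.rsqrt 10 10))
      (forLoop 13 1 (block (.rload 7 2 6 13) [.rdiv 7 7 10, .rstore 2 6 13 7]))))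

/-- If all kept entries vanish, the division 0/0 yields 0, in accordance with the convention for
vanishing iterates. -/
theorem wp_normaliseProg {m : RAMState} (h : Consts m) {A : Finset ℕ} (hA : Marked (m.int 1) m A)
    {z : ℕ → ℝ} (hz : ∀ j < m.int 1, z j = if j ∈ A then m.realArr 3 0 j else 0) :
    WP normaliseProg (13 * m.int 1 + 6) (fun m' => Frame 13 7 2 100 m m' ∧ ∀ j < m.int 1,
      m'.realArr 2 0 j = z j / √(∑ l ∈ Finset.range (m.int 1), z l ^ 2)) m := by
  refine WP.frame rfl (WP.mono
    (c := 1 + ((m.int 1 * (6 + 2) + 2) + (1 + (m.int 1 * (3 + 2) + 2)))) ?_ (by omega) fun m' h =>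
      h)
  refine WP.seq (WP.instr ?_)
  set m₁ := (Instr.ofInt 10 6).step m with hm₁
  have hF₁ : Frame 13 7 2 100 m m₁ := Instr.frame_step rfl m
  have hF₁' : Frame 13 7 100 100 m m₁ := Instr.frame_step rfl m
  have hC := h.frame hF₁ (by norm_num) (by norm_num)
  refine WP.seq ((WP.forLoop (cnt := 13) (bnd := 1) (a := 13) (b := 7) (ra := 2) (ia := 100)
    (c := 6) (N := m.int 1)
    (fun J m' => m'.real 10 = ∑ l ∈ Finset.range J, z l ^ 2 ∧ m'.realArr 3 = m.realArr 3 ∧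
      ∀ j < J, m'.realArr 2 0 j = z j) rfl rfl (by norm_num)
    (by norm_num) hC.one (hF₁.int _ (by norm_num)) (fun _ _ _ h => h) ?_ ?_).mono le_rfl
    ?_)
  · exact ⟨by simp [hm₁, Instr.step, h.zero], hF₁'.realArr 3 (by norm_num), by simp⟩
  · rintro j hj m' hF hc ⟨hs, h3, hI⟩
    have hF' := hF₁.trans hF
    have hC' := h.frame hF' (by norm_num) (by norm_num)
    refine WP.mono (c := 1 + (4 + 1)) ?_ (by omega) fun m' h => h
    refine WP.seq (WP.instr (WP.branch ?_ ?_))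
    · intro hmark
      simp only [Test.holds, Instr.step, Function.update_self] at hmark
      rw [Function.update_of_ne (by norm_num), hC'.one, hc, hF'.intArr 0 (by norm_num), hA j hj,
        Nat.lt_one_iff] at hmark
      have hjA : j ∉ A := by
        intro hjA; rw [if_pos hjA] at hmark; omega
      have hzj := hz j hj
      rw [if_neg hjA] at hzj
      refine (WP.instr ?_).mono (by norm_num) fun m' h => h
      simp only [Instr.step, Function.update_apply]
      norm_num
      rw [hc, hC'.zero, hC'.rzero]
      refine ⟨by rw [Finset.sum_range_succ, hs, hzj]; ring, h3, fun l hl => ?_⟩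
      by_cases hlj : l = j
      · simp [hlj, hzj]
      · rw [Function.update_self, Function.update_of_ne hlj, hI l (by omega)]
    · intro hmark
      simp only [Test.holds, Instr.step, Function.update_self] at hmark
      rw [Function.update_of_ne (by norm_num), hC'.one, hc, hF'.intArr 0 (by norm_num), hA j hj,
        Nat.lt_one_iff] at hmark
      have hjA : j ∈ A := by
        by_contra hjA; rw [if_neg hjA] at hmark; exact hmark rfl
      have hzj := hz j hj
      rw [if_pos hjA] at hzj
      refine WP.block _ _ ?_
      simp only [exec, Instr.step, Function.update_apply]
      norm_num
      rw [hc, hC'.zero, h3]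
      refine ⟨by rw [Finset.sum_range_succ, hs, hzj]; ring, rfl, fun l hl => ?_⟩
      by_cases hlj : l = j
      · simp [hlj, hzj]
      · rw [Function.update_self, Function.update_of_ne hlj, hI l (by omega)]
  · rintro m₂ ⟨hF₂, hs, -, hI⟩
    refine WP.seq (WP.instr ?_)
    set m₃ := (Instr.rsqrt 10 10).step m₂ with hm₃
    have hF₃ : Frame 13 7 2 100 m m₃ := (hF₁.trans hF₂).trans (Instr.frame_step rfl m₂)
    have hC₃ := h.frame hF₃ (by norm_num) (by norm_num)
    have h10 : m₃.real 10 = √(∑ l ∈ Finset.range (m.int 1), z l ^ 2) := by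
      simp [hm₃, Instr.step, hs]
    have hz3 : ∀ j < m.int 1, m₃.realArr 2 0 j = z j := hI
    refine (WP.forLoop (cnt := 13) (bnd := 1) (a := 13) (b := 7) (ra := 2) (ia := 100) (c := 3)
      (N := m.int 1) (fun J m' => m'.real 10 = m₃.real 10 ∧ ∀ j, m'.realArr 2 0 j =
        if j < J then m₃.realArr 2 0 j / m₃.real 10 else m₃.realArr 2 0 j) rfl rfl
      (by norm_num) (by norm_num) hC₃.one (hF₃.int _ (by norm_num)) (fun _ _ _ h => h) (by simp)
      ?_).mono le_rfl fun m' h' j hj => by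
        rw [h'.2.2, if_pos hj, hz3 j hj, h10]
    rintro j hj m' hF hc ⟨h10', hI'⟩
    have hC' := hC₃.frame hF (by norm_num) (by norm_num)
    refine WP.block _ _ ?_
    simp only [exec, Instr.step, Function.update_apply]
    norm_num
    rw [hC'.zero, hc, h10', hI']
    refine ⟨rfl, fun l => ?_⟩
    by_cases hlj : l = j
    · simp [hlj]
    · rw [Function.update_self, Function.update_of_ne hlj, hI']
      exact if_congr (by omega) rfl rfl

theorem matVec_empCov_apply {n d : ℕ} (x : Fin n → Vec d) (J : Finset (Fin n)) (u : Vec d)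
    (j : Fin d) : matVec (empCov x J) u j =
      (∑ l ∈ J, (∑ i, x l i * u i) * x l j) / J.card := by
  rw [matVec_apply]
  simp only [empCov, Matrix.smul_apply, Matrix.sum_apply, Matrix.vecMulVec_apply, smul_eq_mul]
  rw [div_eq_inv_mul, Finset.mul_sum]
  simp only [Finset.mul_sum, Finset.sum_mul]
  rw [Finset.sum_comm]
  exact Finset.sum_congr rfl fun l _ => Finset.sum_congr rfl fun i _ => by ring

section Iteration

variable {n d r T : ℕ} {x : Fin n → Vec d}

/-- The memory holds the input, the constants and the batch size. -/
structure Loaded (x : Fin n → Vec d) (r T : ℕ) (m : RAMState) : Prop where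
  consts : Consts m
  int_n : m.int 0 = n
  int_d : m.int 1 = d
  int_r : m.int 2 = r
  int_T : m.int 3 = T
  int_batch : m.int 4 = n / T
  data : ∀ (i : Fin n) (j : Fin d), m.realArr 0 i j = x i j

theorem Loaded.frame {m m' : RAMState} {a b ra ia : ℕ} (h : Loaded x r T m)
    (hF : Frame a b ra ia m m') (ha : 7 ≤ a) (hb : 2 ≤ b) (hra : 1 ≤ ra) : Loaded x r T m' :=
  ⟨h.consts.frame hF ha hb, by rw [hF.int _ (by omega), h.int_n],
    by rw [hF.int _ (by omega), h.int_d], by rw [hF.int _ (by omega), h.int_r],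
    by rw [hF.int _ (by omega), h.int_T], by rw [hF.int _ (by omega), h.int_batch],
    by rw [hF.realArr _ (by omega)]; exact h.data⟩

/-- The real array `A` holds the vector `u` in its row `0`. -/
def Stores (m : RAMState) (A : ℕ) (u : Vec d) : Prop := ∀ j : Fin d, m.realArr A 0 j = u j

theorem Stores.congr {m m' : RAMState} {A : ℕ} {u : Vec d} (h : Stores m A u)
    (hA : m'.realArr A = m.realArr A) : Stores m' A u := by
  rw [Stores, hA]; exact h

/-- Replace the iterate by the next one. -/
def iterateProg : Prog :=
  .seq clearProg (.seq mulProg (.seq scaleProg (.seq selectProg normaliseProg)))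

theorem wp_iterateProg {m : RAMState} (h : Loaded x r T m) (hr : r ≤ d) {t : ℕ} (ht : t < T)
    (hsample : m.int 10 = n / T * t) (hB : m.real 4 = (n / T : ℕ)) {u : Vec d}
    (hu : Stores m 2 u) :
    WP iterateProg (22 * d + 14 + n / T * (13 * d + 8) + r * (9 * d + 7))
      (fun m' => Frame 9 5 2 0 m m' ∧ m'.int 10 = n / T * (t + 1) ∧
        Stores m' 2 (‖topVec r (matVec (empCov x (batch n T t)) u)‖⁻¹ •
          topVec r (matVec (empCov x (batch n T t)) u))) m := by
  refine WP.frame rfl (WP.mono (c := (4 * d + 2) + ((n / T * (13 * d + 8) + 2) +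
    ((5 * d + 2) + ((r * (9 * d + 7) + 2) + (13 * d + 6))))) ?_ (by omega) fun m' h => h)
  have hc := wp_clearProg h.consts
  rw [h.int_d] at hc
  refine WP.seq (hc.mono le_rfl ?_)
  rintro m₁ ⟨hF₁, hclear⟩
  have h₁ := h.frame hF₁ (by norm_num) (by norm_num) (by norm_num)
  have hm := wp_mulProg h₁.consts
  rw [h₁.int_d, h₁.int_batch] at hm
  refine WP.seq (hm.mono le_rfl ?_)
  rintro m₂ ⟨hF₂, h10, hy⟩
  have h₂ := h₁.frame hF₂ (by norm_num) (by norm_num) (by norm_num)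
  have hs := wp_scaleProg h₂.consts
  rw [h₂.int_d] at hs
  refine WP.seq (hs.mono le_rfl ?_)
  rintro m₃ ⟨hF₃, hscale⟩
  have h₃ := h₂.frame hF₃ (by norm_num) (by norm_num) (by norm_num)
  have hsel := wp_selectProg h₃.consts (by
    rw [h₃.int_d]
    intro j hj
    rw [hF₃.intArr 0 (by norm_num), hF₂.intArr 0 (by norm_num), (hclear j hj).2])
    (by rwa [h₃.int_r, h₃.int_d])
  rw [h₃.int_d, h₃.int_r] at hsel
  refine WP.seq (hsel.mono le_rfl ?_)
  rintro m₄ ⟨hF₄, A, hAr, hA, hmark⟩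
  have h₄ := h₃.frame hF₄ (by norm_num) (by norm_num) (by norm_num)
  set y := matVec (empCov x (batch n T t)) u with hy_def
  -- A batch is a contiguous block of samples, all of it below `n`, so the sample counter can simply
  -- run on from batch to batch.
  have hsum : ∀ F : ℕ → ℝ, ∑ l ∈ batch n T t, F l = ∑ l ∈ Finset.range (n / T), F (n / T * t + l)
    := by
    intro F
    have h1 := Finset.sum_map (batch n T t) Fin.valEmbedding F
    rw [map_batch ht, Finset.sum_Ico_eq_sum_range] at h1
    rw [Nat.mul_succ, Nat.add_sub_cancel_left] at h1
    exact h1.symm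
  have hy3 : ∀ j : Fin d, m₃.realArr 3 0 j = y j := by
    intro j
    rw [hscale j j.2, hy j j.2, (hclear j j.2).1, zero_add, hF₂.real 4 (by norm_num),
      hF₁.real 4 (by norm_num), hB, hy_def, matVec_empCov_apply, card_batch ht,
      hF₁.int 10 (by norm_num), hsample, hF₁.realArr 0 (by norm_num), hF₁.realArr 2 (by norm_num)]
    congr 1
    rw [← hsum fun l => (∑ i ∈ Finset.range d, m.realArr 0 l i * m.realArr 2 0 i) * m.realArr 0 l j]
    refine Finset.sum_congr rfl fun l _ => ?_
    rw [h.data, Finset.sum_range]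
    simp only [h.data, hu _]
  have hAeq := hA.eq_map_topSet hy3
  rw [hAr] at hAeq
  have hw : ∀ j : Fin d, (if (j : ℕ) ∈ A then m₃.realArr 3 0 j else 0) = topVec r y j := by
    intro j
    rw [hy3]
    refine if_congr ?_ rfl rfl
    rw [hAeq]
    exact Finset.mem_map' Fin.valEmbedding
  have hn := wp_normaliseProg h₄.consts (A := A) (by rwa [h₄.int_d])
    (z := fun j => if j ∈ A then m₃.realArr 3 0 j else 0)
    fun j _ => by rw [hF₄.realArr 3 (by norm_num)]
  rw [h₄.int_d] at hn
  refine hn.mono le_rfl ?_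
  rintro m₅ ⟨hF₅, hz⟩
  constructor
  · rw [hF₅.int 10 (by norm_num), hF₄.int 10 (by norm_num), hF₃.int 10 (by norm_num), h10,
      hF₁.int 10 (by norm_num), hsample, Nat.mul_succ]
  · intro j
    rw [hz j j.2, Finset.sum_range]
    simp only [hw]
    rw [EuclideanSpace.norm_eq, PiLp.smul_apply, smul_eq_mul, div_eq_inv_mul]
    simp only [Real.norm_eq_abs, sq_abs]

/-- All iterations of one restart. -/
def restartProg : Prog := .seq (.instr (.iconst 10 0)) (forLoop 8 3 iterateProg)

theorem wp_restartProg {m : RAMState} (h : Loaded x r T m) (hr : r ≤ d)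
    (hB : m.real 4 = (n / T : ℕ)) {i : Fin d} (hu : Stores m 2 (EuclideanSpace.single i (1 : ℝ))) :
    WP restartProg (T * (22 * d + 16 + n / T * (13 * d + 8) + r * (9 * d + 7)) + 3)
      (fun m' => Frame 8 5 2 0 m m' ∧ Stores m' 2 (iterate (topVec r) x T i T)) m := by
  refine WP.frame rfl (WP.mono (c := 1 + (T * ((22 * d + 14 + n / T * (13 * d + 8) +
    r * (9 * d + 7)) + 2) + 2)) ?_ (le_of_eq (by ring)) fun m' h => h)
  refine WP.seq (WP.instr ?_)
  set m₁ := (Instr.iconst 10 0).step m with hm₁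
  have hF₁ : Frame 8 5 2 0 m m₁ := Instr.frame_step rfl m
  have h₁ := h.frame hF₁ (by norm_num) (by norm_num) (by norm_num)
  refine (WP.forLoop (cnt := 8) (bnd := 3) (a := 8) (b := 5) (ra := 2) (ia := 0) (N := T)
    (fun t m' => m'.int 10 = n / T * t ∧ Stores m' 2 (iterate (topVec r) x T i t)) rfl rfl
    (by norm_num) (by norm_num) h₁.consts.one h₁.int_T (fun _ _ _ h => h)
      ⟨by simp [hm₁, Instr.step], hu⟩
    ?_).mono le_rfl fun m' h => h.2.2
  rintro t ht m' hF - ⟨h10, hu'⟩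
  exact (wp_iterateProg (h₁.frame hF (by norm_num) (by norm_num) (by norm_num)) hr ht h10
    (by rw [hF.real 4 (by norm_num), hF₁.real 4 (by norm_num), hB]) hu').mono le_rfl
    fun m'' h'' => h''.2

/-- The Rayleigh objective of the iterate. -/
def rayleighProg : Prog :=
  .seq (.instr (.ofInt 5 6)) (.seq (forLoop 10 0 (.seq dotProg (block (.rmul 7 6 6) [.radd 5 5 7])))
    (.instr (.rdiv 5 5 3)))

theorem wp_rayleighProg {m : RAMState} (h : Loaded x r T m) (hn : m.real 3 = n) {u : Vec d}
    (hu : Stores m 2 u) :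
    WP rayleighProg (n * (6 * d + 7) + 4)
      (fun m' => Frame 8 5 3 0 m m' ∧ m'.real 5 = rayleigh x u) m := by
  refine WP.frame rfl (WP.mono (c := 1 + ((n * ((6 * d + 3 + 2) + 2) + 2) + 1)) ?_
    (le_of_eq (by ring))
    fun m' h => h)
  refine WP.seq (WP.instr ?_)
  set m₁ := (Instr.ofInt 5 6).step m with hm₁
  have hF₁ : Frame 8 5 100 0 m m₁ := Instr.frame_step rfl m
  have h₁ := h.frame hF₁ (by norm_num) (by norm_num) (by norm_num)
  refine WP.seq ((WP.forLoop (cnt := 10) (bnd := 0) (a := 8) (b := 5) (ra := 100) (ia := 0)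
    (c := 6 * d + 3 + 2) (N := n)
    (fun q m' => m'.real 5 = ∑ l ∈ Finset.range q,
      (∑ j ∈ Finset.range d, m.realArr 0 l j * m.realArr 2 0 j) ^ 2) rfl rfl
    (by norm_num) (by norm_num) h₁.consts.one h₁.int_n (fun _ _ _ h => h)
    (by simp [hm₁, Instr.step, h.consts.zero]) ?_).mono le_rfl ?_)
  · intro q hq m' hF hc hI
    have hF' := hF₁.trans hF
    have h' := h.frame hF' (by norm_num) (by norm_num) (by norm_num)
    have hd := wp_dotProg h'.consts
    rw [h'.int_d] at hd
    refine WP.seq (hd.mono le_rfl ?_)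
    rintro m'' ⟨hF'', hdot⟩
    refine WP.block _ _ ?_
    simp only [exec, Instr.step, Function.update_apply]
    norm_num
    rw [hF''.real 5 (by norm_num), hI, hdot, hc, Finset.sum_range_succ,
      hF'.realArr 0 (by norm_num), hF'.realArr 2 (by norm_num), sq]
  · rintro m₂ ⟨hF₂, hI⟩
    refine WP.instr ?_
    simp only [Instr.step, Function.update_self]
    rw [hI, hF₂.real 3 (by norm_num), hF₁.real 3 (by norm_num), hn]
    change _ = quad (empCov x Finset.univ) u
    rw [quad_empCov, Finset.card_univ, Fintype.card_fin, div_eq_inv_mul, Finset.sum_range]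
    congr 1
    refine Finset.sum_congr rfl fun l _ => ?_
    rw [inner_eq_sum, Finset.sum_range]
    congr 1
    refine Finset.sum_congr rfl fun j _ => ?_
    rw [h.data, hu j, mul_comm]

end Iteration

/-! ### The complete program and its running time. -/

section Main

variable {n d r T : ℕ} {x : Fin n → Vec d}

/-- Store the start vector of the current restart. -/
def startProg : Prog :=
  .seq (forLoop 13 1 (.instr (.rstore 2 6 13 0))) (.instr (.rstore 2 6 7 1))

theorem wp_startProg {m : RAMState} (h : Loaded x r T m) {i : Fin d} (hi : m.int 7 = i) :
    WP startProg (3 * d + 3) (fun m' => Frame 13 100 2 0 m m' ∧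
      Stores m' 2 (EuclideanSpace.single i (1 : ℝ))) m := by
  refine WP.frame rfl (WP.mono (c := (d * (1 + 2) + 2) + 1) ?_ (by omega) fun m' h => h)
  refine WP.seq ((WP.forLoop (cnt := 13) (bnd := 1) (a := 13) (b := 100) (ra := 2) (ia := 0)
    (c := 1) (N := d) (fun J m' => ∀ j < J, m'.realArr 2 0 j = 0) rfl rfl
    (by norm_num) (by norm_num) h.consts.one h.int_d (fun _ _ _ h => h) (by simp) ?_).mono le_rfl
      ?_)
  · intro j hj m' hF hc hI
    have hC := h.consts.frame hF (by norm_num) (by norm_num)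
    refine WP.instr fun l hl => ?_
    simp only [Instr.step, Function.update_self]
    rw [hC.zero, hC.rzero, hc, Function.update_self]
    by_cases hlj : l = j
    · simp [hlj]
    · rw [Function.update_of_ne hlj, hI l (by omega)]
  · rintro m₁ ⟨hF, hI⟩
    have hC := h.consts.frame hF (by norm_num) (by norm_num)
    refine WP.instr fun j => ?_
    simp only [Instr.step, Function.update_self]
    rw [hC.zero, hC.rone, hF.int 7 (by norm_num), hi, Function.update_self]
    by_cases hji : j = i
    · simp [hji]
    · rw [Function.update_of_ne (by simpa [Fin.ext_iff] using hji), hI j j.2]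
      simp [hji]

/-- Keep the current iterate if it beats the best one so far. -/
def compareProg : Prog :=
  .branch (.rlt 2 5) (.seq (.instr (.radd 2 5 0))
    (forLoop 13 1 (block (.rload 7 2 6 13) [.rstore 1 6 13 7]))) (.instr (.iconst 13 0))

theorem wp_compareProg {m : RAMState} (h : Loaded x r T m) {u : Vec d} (hu : Stores m 2 u) :
    WP compareProg (4 * d + 4) (fun m' => Frame 13 2 1 0 m m' ∧ m'.real 3 = m.real 3 ∧
      m'.real 4 = m.real 4 ∧ ((m.real 2 < m.real 5 ∧ m'.real 2 = m.real 5 ∧ Stores m' 1 u) ∨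
        (m.real 5 ≤ m.real 2 ∧ m'.real 2 = m.real 2 ∧ m'.realArr 1 = m.realArr 1))) m := by
  refine WP.frame rfl (WP.mono (c := (1 + (d * (2 + 2) + 2)) + 1) ?_ (by omega) fun m' h => h)
  refine WP.branch (fun hlt => WP.seq (WP.instr ?_)) fun hle => ?_
  · set m₁ := (Instr.radd 2 5 0).step m with hm₁
    have hF₁ : Frame 13 2 1 0 m m₁ := Instr.frame_step rfl m
    have h₁ := h.frame hF₁ (by norm_num) (by norm_num) (by norm_num)
    refine (WP.forLoop (cnt := 13) (bnd := 1) (a := 13) (b := 7) (ra := 1) (ia := 0)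
      (c := 2) (N := d) (fun J m' => m'.realArr 2 = m.realArr 2 ∧
        ∀ j < J, m'.realArr 1 0 j = m.realArr 2 0 j) rfl rfl
      (by norm_num) (by norm_num) h₁.consts.one h₁.int_d (fun _ _ _ h => h) ⟨rfl, by simp⟩ ?_).mono
      le_rfl ?_
    · rintro j hj m' hF hc ⟨h2, hI⟩
      have hC := h₁.consts.frame hF (by norm_num) (by norm_num)
      refine WP.block _ _ ?_
      simp only [exec, Instr.step, Function.update_apply]
      norm_num
      rw [hC.zero, hc, h2]
      refine ⟨rfl, fun l hl => ?_⟩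
      by_cases hlj : l = j
      · simp [hlj]
      · rw [Function.update_self, Function.update_of_ne hlj, hI l (by omega)]
    · rintro m₂ ⟨hF₂, -, hI⟩
      refine ⟨hF₂.real 3 (by norm_num), hF₂.real 4 (by norm_num), .inl ⟨hlt, ?_, fun j => ?_⟩⟩
      · rw [hF₂.real 2 (by norm_num)]
        simp [hm₁, Instr.step, h.consts.rzero]
      · rw [hI j j.2, hu j]
  · exact (WP.instr ⟨rfl, rfl, .inr ⟨not_lt.1 hle, rfl, rfl⟩⟩).mono (by omega) fun m' h => h

/-- All restarts. -/
def restartsProg : Prog :=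
  forLoop 7 1 (.seq startProg (.seq restartProg (.seq rayleighProg compareProg)))

theorem rayleigh_nonneg (x : Fin n → Vec d) (u : Vec d) : 0 ≤ rayleigh x u := by
  change 0 ≤ quad (empCov x Finset.univ) u
  rw [quad_empCov]
  positivity

theorem wp_restartsProg {m : RAMState} (h : Loaded x r T m) (hr : r ≤ d) (hd : 1 ≤ d)
    (hbest : m.real 2 = -1) (hn : m.real 3 = n) (hB : m.real 4 = (n / T : ℕ)) :
    WP restartsProg (d * (7 * d + 16 + T * (22 * d + 16 + n / T * (13 * d + 8) +
      r * (9 * d + 7)) + n * (6 * d + 7)) + 2)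
      (fun m' => IsOutput (topVec r) x T (outputVec d m')) m := by
  set f : Fin d → Vec d := fun i => iterate (topVec r) x T i T with hf
  refine (WP.forLoop (cnt := 7) (bnd := 1) (a := 7) (b := 2) (ra := 1) (ia := 0)
    (c := (3 * d + 3) + ((T * (22 * d + 16 + n / T * (13 * d + 8) + r * (9 * d + 7)) + 3) +
      ((n * (6 * d + 7) + 4) + (4 * d + 4)))) (N := d)
    -- The objective is nonnegative, so the initial record -1 is beaten by the first restart and the
    -- output row is always filled.
    (fun i m' => (m'.real 3 = n ∧ m'.real 4 = (n / T : ℕ)) ∧ ((i = 0 ∧ m'.real 2 = -1) ∨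
      ∃ b : Fin d, m'.real 2 = rayleigh x (f b) ∧ Stores m' 1 (f b) ∧
        ∀ j : Fin d, (j : ℕ) < i → rayleigh x (f j) ≤ rayleigh x (f b))) rfl rfl
    (by norm_num) (by norm_num) h.consts.one h.int_d (fun _ _ _ h => h)
    ⟨⟨hn, hB⟩, .inl ⟨rfl, hbest⟩⟩ ?_).mono (le_of_eq (by ring)) ?_
  · rintro i hi m' hF hc ⟨⟨hn', hB'⟩, hI⟩
    have h' := h.frame hF (by norm_num) (by norm_num) (by norm_num)
    obtain ⟨i, rfl⟩ : ∃ i' : Fin d, (i' : ℕ) = i := ⟨⟨i, hi⟩, rfl⟩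
    refine WP.seq ((wp_startProg h' hc).mono le_rfl ?_)
    rintro m₁ ⟨hF₁, hu₁⟩
    have h₁ := h'.frame hF₁ (by norm_num) (by norm_num) (by norm_num)
    refine WP.seq ((wp_restartProg h₁ hr (by rw [hF₁.real 4 (by norm_num), hB']) hu₁).mono le_rfl
      ?_)
    rintro m₂ ⟨hF₂, hu₂⟩
    have h₂ := h₁.frame hF₂ (by norm_num) (by norm_num) (by norm_num)
    refine WP.seq ((wp_rayleighProg h₂ (by
      rw [hF₂.real 3 (by norm_num), hF₁.real 3 (by norm_num), hn']) hu₂).mono le_rfl ?_)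
    rintro m₃ ⟨hF₃, hray⟩
    have h₃ := h₂.frame hF₃ (by norm_num) (by norm_num) (by norm_num)
    refine (wp_compareProg h₃ (hu₂.congr (hF₃.realArr 2 (by norm_num)))).mono le_rfl ?_
    rintro m₄ ⟨-, hn₄, hB₄, hcmp⟩
    have hbest₃ : m₃.real 2 = m'.real 2 := by
      rw [hF₃.real 2 (by norm_num), hF₂.real 2 (by norm_num), hF₁.real 2 (by norm_num)]
    have hout₃ : m₃.realArr 1 = m'.realArr 1 := by
      rw [hF₃.realArr 1 (by norm_num), hF₂.realArr 1 (by norm_num), hF₁.realArr 1 (by norm_num)]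
    refine ⟨⟨?_, ?_⟩, .inr ?_⟩
    · rw [hn₄, hF₃.real 3 (by norm_num), hF₂.real 3 (by norm_num), hF₁.real 3 (by norm_num), hn']
    · rw [hB₄, hF₃.real 4 (by norm_num), hF₂.real 4 (by norm_num), hF₁.real 4 (by norm_num), hB']
    rw [hbest₃, hray, hout₃] at hcmp
    rcases hcmp with ⟨hlt, hb, hs⟩ | ⟨hle, hb, hs⟩
    · refine ⟨i, hb, hs, fun j hj => ?_⟩
      rcases (Nat.le_of_lt_succ hj).lt_or_eq with hji | hji
      · rcases hI with ⟨h0, -⟩ | ⟨b, hb', -, hmax⟩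
        · omega
        · rw [hb'] at hlt
          exact (hmax j hji).trans hlt.le
      · rw [Fin.ext hji]
    · rcases hI with ⟨-, hb'⟩ | ⟨b, hb', hsb, hmax⟩
      · rw [hb'] at hle
        linarith [rayleigh_nonneg x (iterate (topVec r) x T i T)]
      · refine ⟨b, hb.trans hb', hsb.congr hs, fun j hj => ?_⟩
        rcases (Nat.le_of_lt_succ hj).lt_or_eq with hji | hji
        · exact hmax j hji
        · rw [Fin.ext hji, ← hb']
          exact hle
  · rintro m' ⟨-, -, ⟨h0, -⟩ | ⟨b, -, hs, hmax⟩⟩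
    · omega
    · exact ⟨b, by ext j; exact hs j, fun j => hmax j j.2⟩

/-- Store the constants and the batch size, which is computed by repeated subtraction. -/
def initProg : Prog :=
  .seq (block (.iconst 5 1) [.ofInt 1 5, .ofInt 3 0, .rsub 2 0 1, .iadd 7 0 5])
    (.seq (.loop (.ilt 3 7) (block (.isub 7 7 3) [.iadd 4 4 5])) (.instr (.ofInt 4 4)))

theorem wp_initProg (x : Fin n → Vec d) (r : ℕ) (hT : 1 ≤ T) :
    WP initProg (3 * (n / T) + 7) (fun m => Loaded x r T m ∧ m.real 2 = -1 ∧ m.real 3 = n ∧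
      m.real 4 = (n / T : ℕ)) (inputState x r T) := by
  refine WP.mono (c := 5 + ((n / T * (2 + 1) + 1) + 1)) ?_ (by omega) fun m' h => h
  refine WP.seq (WP.block _ _ ?_)
  set m := exec (.iconst 5 1) [.ofInt 1 5, .ofInt 3 0, .rsub 2 0 1, .iadd 7 0 5]
    (inputState x r T) with hm
  have h0 : m.int 0 = n := by simp [hm, exec, Instr.step, inputState]
  have h1 : m.int 1 = d := by simp [hm, exec, Instr.step, inputState]
  have h2 : m.int 2 = r := by simp [hm, exec, Instr.step, inputState]
  have h3 : m.int 3 = T := by simp [hm, exec, Instr.step, inputState]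
  have h4 : m.int 4 = 0 := by simp [hm, exec, Instr.step, inputState]
  have h5 : m.int 5 = 1 := by simp [hm, exec, Instr.step, inputState]
  have h6 : m.int 6 = 0 := by simp [hm, exec, Instr.step, inputState]
  have h7 : m.int 7 = n + 1 := by simp [hm, exec, Instr.step, inputState]
  have r0 : m.real 0 = 0 := by simp [hm, exec, Instr.step, inputState]
  have r1 : m.real 1 = 1 := by simp [hm, exec, Instr.step, inputState]
  have r2 : m.real 2 = -1 := by simp [hm, exec, Instr.step, inputState]
  have r3 : m.real 3 = n := by simp [hm, exec, Instr.step, inputState]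
  have hX : ∀ (i : Fin n) (j : Fin d), m.realArr 0 i j = x i j := by
    simp [hm, exec, Instr.step, inputState]
  -- Since register 7 starts at n + 1, the test T < n + 1 - Tj means T(j + 1) ≤ n, and the loop runs
  -- exactly ⌊n/T⌋ times.
  refine WP.seq ((WP.loop (c := 2) (N := n / T)
    (fun j m' => m'.int 7 = n + 1 - T * j ∧ m'.int 4 = j ∧
    (∀ a, a ≠ 7 → a ≠ 4 → m'.int a = m.int a) ∧ m'.real = m.real ∧ m'.realArr = m.realArr)
    ?_ ?_ ⟨h7, h4, fun _ _ _ => rfl, rfl, rfl⟩).mono le_rfl ?_)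
  · rintro j hj m' ⟨hr7, hr4, hint, hreal, hArr⟩
    have hle : T * (j + 1) ≤ n := (Nat.mul_le_mul_left _ hj).trans (Nat.mul_div_le n T)
    rw [Nat.mul_succ] at hle
    constructor
    · change m'.int 3 < m'.int 7
      rw [hint 3 (by norm_num) (by norm_num), h3, hr7]
      omega
    · refine WP.block _ _ ⟨?_, ?_, fun a ha ha' => ?_, hreal, hArr⟩
      · simp only [exec, Instr.step, Function.update_apply]
        norm_num
        rw [hr7, hint 3 (by norm_num) (by norm_num), h3, Nat.mul_succ]
        omega
      · simp only [exec, Instr.step, Function.update_apply]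
        norm_num
        rw [hr4, hint 5 (by norm_num) (by norm_num), h5]
      · simp only [exec, Instr.step, Function.update_apply]
        rw [if_neg ha', if_neg ha, hint a ha ha']
  · rintro m' ⟨hr7, -, hint, -, -⟩
    change ¬ m'.int 3 < m'.int 7
    rw [hint 3 (by norm_num) (by norm_num), h3, hr7]
    have := Nat.lt_mul_div_succ n (show 0 < T by omega)
    rw [Nat.mul_succ] at this
    omega
  · rintro m' ⟨-, hr4, hint, hreal, hArr⟩
    have hF : Frame 100 4 100 100 m' ((Instr.ofInt 4 4).step m') := Instr.frame_step rfl m'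
    refine WP.instr ⟨⟨⟨?_, ?_, ?_, ?_⟩, ?_, ?_, ?_, ?_, ?_, ?_⟩, ?_, ?_, ?_⟩
    · exact (hint 5 (by norm_num) (by norm_num)).trans h5
    · exact (hint 6 (by norm_num) (by norm_num)).trans h6
    · rw [hF.real 0 (by norm_num), hreal, r0]
    · rw [hF.real 1 (by norm_num), hreal, r1]
    · exact (hint 0 (by norm_num) (by norm_num)).trans h0
    · exact (hint 1 (by norm_num) (by norm_num)).trans h1
    · exact (hint 2 (by norm_num) (by norm_num)).trans h2
    · exact (hint 3 (by norm_num) (by norm_num)).trans h3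
    · exact hr4
    · rw [hF.realArr 0 (by norm_num), hArr]
      exact hX
    · rw [hF.real 2 (by norm_num), hreal, r2]
    · rw [hF.real 3 (by norm_num), hreal, r3]
    · simp [Instr.step, hr4]

/-- A program for the restarted truncated power method. -/
def rtpmProg : Prog := .seq initProg restartsProg

/-- Selection takes `r` rounds of O(d), so one restart costs O(Td + T⌊n/T⌋d + rTd + nd), which is
O(nd) because T⌊n/T⌋ ≤ n and rT ≤ n. The `d` restarts give the factor d. -/
theorem computesWithin_rtpmProg (x : Fin n → Vec d) (hT : 1 ≤ T) (hr1 : 1 ≤ r) (hr : r ≤ d)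
    (hn : r * T ≤ n) :
    ComputesWithin rtpmProg (topVec r) x r T (123 * ((n : ℝ) * (d : ℝ) ^ 2)) := by
  obtain ⟨c, m, hrun, hc, hout⟩ := WP.seq ((wp_initProg x r hT).mono le_rfl fun m h =>
    wp_restartsProg h.1 hr (hr1.trans hr) h.2.1 h.2.2.1 h.2.2.2)
  refine ⟨c, m, hrun, ?_, hout⟩
  have hd : 1 ≤ d := hr1.trans hr
  have hTn : T ≤ n := (Nat.le_mul_of_pos_left T hr1).trans hn
  have hB : T * (n / T) ≤ n := Nat.mul_div_le n T
  have hBn : n / T ≤ n := Nat.div_le_self n T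
  have hn1 : 1 ≤ n := hT.trans hTn
  have hnd : 1 ≤ n * d := Nat.mul_pos hn1 hd
  have hdn : d ≤ n * d := Nat.le_mul_of_pos_left d hn1
  have e1 : T * (22 * d + 16) ≤ n * (38 * d) := Nat.mul_le_mul hTn (by omega)
  have e2 : T * (n / T) * (13 * d + 8) ≤ n * (21 * d) := Nat.mul_le_mul hB (by omega)
  have e3 : r * T * (9 * d + 7) ≤ n * (16 * d) := Nat.mul_le_mul hn (by omega)
  have e4 : n * (6 * d + 7) ≤ n * (13 * d) := Nat.mul_le_mul le_rfl (by omega)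
  have e5 : 7 * d + 16 + T * (22 * d + 16 + n / T * (13 * d + 8) + r * (9 * d + 7)) +
      n * (6 * d + 7) ≤ 111 * (n * d) := by
    have : T * (22 * d + 16 + n / T * (13 * d + 8) + r * (9 * d + 7)) =
      T * (22 * d + 16) + T * (n / T) * (13 * d + 8) + r * T * (9 * d + 7) := by ring
    rw [this]
    linarith
  have e6 : n ≤ n * d ^ 2 := Nat.le_mul_of_pos_right n (by positivity)
  have e7 := Nat.mul_le_mul (le_refl d) e5
  have e8 : d * (111 * (n * d)) = 111 * (n * d ^ 2) := by ring
  have : c ≤ 123 * (n * d ^ 2) := by omega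
  exact_mod_cast this

end Main

/-! ### One component and constant gap -/

/-- It suffices that 100 ≤ 2⁷ ≤ s⁷. -/
theorem log_hundred_mul_le {s : ℝ} (hs : 2 ≤ s) : Real.log (100 * s) ≤ 8 * Real.log s := by
  have h : 100 * s ≤ s ^ 8 := by
    have h7 : (2 : ℝ) ^ 7 ≤ s ^ 7 := pow_le_pow_left₀ (by norm_num) hs 7
    nlinarith [mul_le_mul_of_nonneg_right h7 (show 0 ≤ s by linarith)]
  have h2 := Real.log_le_log (by linarith) h
  rwa [Real.log_pow] at h2

/-- Since log s ≤ d/δ, the argument is at most 16000K(d/δ)². The constant log(16000K) ≤ 16000K is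
absorbed by log(d/δ) ≥ 1/2, which gives 32000K + 2 ≤ 32002K. -/
theorem log_mul_div_le {s d T δ K : ℝ} (hs : 2 ≤ s) (hsd : s ≤ d) (hT0 : 0 < T) (hδ0 : 0 < δ)
    (hδ1 : δ < 1) (hK : 1 ≤ K) (hT : T ≤ K * (16000 * Real.log s)) :
    Real.log (d * T / δ) ≤ 32002 * K * Real.log (d / δ) := by
  have hd : 2 ≤ d := hs.trans hsd
  have hd0 : 0 < d := by linarith
  have hdδ : d ≤ d / δ := by rw [le_div_iff₀ hδ0]; nlinarith
  have hlog : Real.log s ≤ d / δ := (Real.log_le_self (by linarith)).trans (hsd.trans hdδ)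
  have h1 : d * T / δ ≤ 16000 * K * (d / δ) ^ 2 := by
    have hT' : T ≤ 16000 * K * (d / δ) := by nlinarith
    have h := mul_le_mul_of_nonneg_left hT' (show 0 ≤ d / δ by positivity)
    calc d * T / δ = d / δ * T := by ring
      _ ≤ d / δ * (16000 * K * (d / δ)) := h
      _ = _ := by ring
  have h2 := Real.log_le_log (by positivity) h1
  rw [Real.log_mul (by positivity) (by positivity), Real.log_pow] at h2
  have h3 : Real.log (16000 * K) ≤ 16000 * K := Real.log_le_self (by positivity)
  have h4 : 1 / 2 ≤ Real.log (d / δ) := half_le_log (hd.trans hdδ)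
  push_cast at h2
  nlinarith

theorem special_sample_size_le {s a X L₁ l₁ L₂ l₂ K n : ℝ} (hl₁ : 0 ≤ l₁) (hL₂ : 0 ≤ L₂)
    (hK : 1 ≤ K) (h₁ : L₁ ≤ 32002 * K * l₁) (h₂ : L₂ ≤ 8 * l₂) (hX : 0 ≤ X)
    (hn : 10 ^ 15 * (8 * K) ^ 2 * X * (32002 * K) * 8 * (a ^ 2 * s ^ 2 * l₂ * l₁) ≤ n) :
    10 ^ 15 * (8 * K) ^ 2 * (a ^ 2 * s ^ 2 * X * L₁ * L₂) ≤ n := by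
  refine le_trans ?_ hn
  have h : L₁ * L₂ ≤ 32002 * K * l₁ * (8 * l₂) :=
    mul_le_mul h₁ h₂ hL₂ (by positivity)
  have h' := mul_le_mul_of_nonneg_left h
    (show 0 ≤ 10 ^ 15 * (8 * K) ^ 2 * (a ^ 2 * s ^ 2 * X) by positivity)
  calc _ = 10 ^ 15 * (8 * K) ^ 2 * (a ^ 2 * s ^ 2 * X) * (L₁ * L₂) := by ring
    _ ≤ _ := h'
    _ = _ := by ring

end SparsePCA

end

theorem mainTheorem1 :
    ∃ (prog : SparsePCA.Prog) (τ : (d r : ℕ) → SparsePCA.Vec d → SparsePCA.Vec d) (Ctime : ℝ),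
      (∀ d r : ℕ, r ≤ d → SparsePCA.IsTopRule r (τ d r)) ∧ 0 < Ctime ∧
      -- general `k`, `γ`, `Δ`
      (∃ Cr CT : ℝ, 0 < Cr ∧ 0 < CT ∧ ∀ K : ℝ, 1 ≤ K → ∃ Cn : ℝ, 0 < Cn ∧
        ∀ (s d n k r T : ℕ) (γ σ Δ δ : ℝ) (D : MeasureTheory.Measure (SparsePCA.Vec d))
          (Sig : Matrix (Fin d) (Fin d) ℝ) (v : Fin k → SparsePCA.Vec d),
          SparsePCA.Model s d k γ σ D Sig v →
          0 < Δ → Δ < 1 → 0 < δ → δ < 1 → r ≤ d →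
          Cr * ((s : ℝ) ^ 2 * (k : ℝ) ^ 2 / (Δ ^ 2 * γ ^ 2)) ≤ (r : ℝ) →
          (r : ℝ) ≤ K * (Cr * ((s : ℝ) ^ 2 * (k : ℝ) ^ 2 / (Δ ^ 2 * γ ^ 2))) →
          CT * ((k : ℝ) * Real.log ((s : ℝ) / (Δ * γ)) / (Δ * γ)) ≤ (T : ℝ) →
          (T : ℝ) ≤ K * (CT * ((k : ℝ) * Real.log ((s : ℝ) / (Δ * γ)) / (Δ * γ))) →
          Cn * ((σ ^ 2 / SparsePCA.eigval Sig k) ^ 2 * (s : ℝ) ^ 2 *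
            ((k : ℝ) ^ 5 / (Δ ^ 6 * γ ^ 6) + (k : ℝ) ^ 2 / (Δ ^ 2 * γ ^ 6)) *
            Real.log ((d : ℝ) * (T : ℝ) / δ) * Real.log ((s : ℝ) / (Δ * γ))) ≤ (n : ℝ) →
          (∀ x : Fin n → SparsePCA.Vec d,
            SparsePCA.ComputesWithin prog (τ d r) x r T (Ctime * ((n : ℝ) * (d : ℝ) ^ 2))) ∧
          (∀ top : SparsePCA.Vec d → SparsePCA.Vec d, SparsePCA.IsTopRule r top →
            ENNReal.ofReal (1 - δ) ≤
              (MeasureTheory.Measure.pi fun _ : Fin n => D)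
                (SparsePCA.successEvent top r T v Δ))) ∧
      -- the case `k = 1`, `γ = Δ = 1/10`
      (∃ Cr CT : ℝ, 0 < Cr ∧ 0 < CT ∧ ∀ K : ℝ, 1 ≤ K → ∃ Cn : ℝ, 0 < Cn ∧
        ∀ (s d n r T : ℕ) (σ δ : ℝ) (D : MeasureTheory.Measure (SparsePCA.Vec d))
          (Sig : Matrix (Fin d) (Fin d) ℝ) (v : SparsePCA.Vec d),
          SparsePCA.Model s d 1 (1 / 10) σ D Sig (fun _ => v) →
          2 ≤ s → 0 < δ → δ < 1 → r ≤ d →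
          Cr * (s : ℝ) ^ 2 ≤ (r : ℝ) → (r : ℝ) ≤ K * (Cr * (s : ℝ) ^ 2) →
          CT * Real.log (s : ℝ) ≤ (T : ℝ) → (T : ℝ) ≤ K * (CT * Real.log (s : ℝ)) →
          Cn * ((σ ^ 2 / SparsePCA.eigval Sig 1) ^ 2 * (s : ℝ) ^ 2 * Real.log (s : ℝ) *
            Real.log ((d : ℝ) / δ)) ≤ (n : ℝ) →
          (∀ x : Fin n → SparsePCA.Vec d,
            SparsePCA.ComputesWithin prog (τ d r) x r T (Ctime * ((n : ℝ) * (d : ℝ) ^ 2))) ∧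
          (∀ top : SparsePCA.Vec d → SparsePCA.Vec d, SparsePCA.IsTopRule r top →
            ENNReal.ofReal (1 - δ) ≤
              (MeasureTheory.Measure.pi fun _ : Fin n => D)
                {x | ∀ u, SparsePCA.IsOutput top x T u →
                  SparsePCA.nnz u ≤ r ∧ ‖u‖ = 1 ∧ 9 / 10 ≤ (inner ℝ v u) ^ 2})) := by
  refine ⟨SparsePCA.rtpmProg, fun d r => SparsePCA.topVec r, 123,
    fun d r hr => SparsePCA.isTopRule_topVec hr, by norm_num,
    ⟨16384, 20, by norm_num, by norm_num, fun K hK => ⟨10 ^ 15 * K ^ 2, by positivity, ?_⟩⟩,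
    -- Here 1/(Δγ)² = 10⁴ and 16000 = 8·2000, where 2000 = 20/(Δγ) and the 8 comes from log(100s) ≤
    -- 8 log s.
    ⟨16384 * 10 ^ 4, 16000, by norm_num, by norm_num, fun K hK =>
      ⟨10 ^ 15 * (8 * K) ^ 2 * (10 ^ 12 + 10 ^ 8) * (32002 * K) * 8, by positivity, ?_⟩⟩⟩
  · intro s d n k r T γ σ Δ δ D Sig v h hΔ0 hΔ1 hδ0 hδ1 hrd hr1 hr2 hT1 hT2 hn
    obtain ⟨hT, hr, hrT, -⟩ := h.sizes hK hΔ0 hΔ1 hδ0 hδ1 hrd hr1 hr2 hT1 hT2 hn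
    exact ⟨fun x => SparsePCA.computesWithin_rtpmProg x hT hr hrd hrT,
      fun top htop => h.accuracy hK hΔ0 hΔ1 hδ0 hδ1 hrd hr1 hr2 hT1 hT2 hn htop⟩
  · intro s d n r T σ δ D Sig v h hs hδ0 hδ1 hrd hr1 hr2 hT1 hT2 hn
    have hs' : (2 : ℝ) ≤ s := by exact_mod_cast hs
    have hsd : (s : ℝ) ≤ d := by exact_mod_cast h.s_le
    have hs0 : (0 : ℝ) < s := by linarith
    have hlog : 1 / 2 ≤ Real.log s := SparsePCA.half_le_log hs'
    have hT0 : (0 : ℝ) < T := by linarith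
    have hlog1 := SparsePCA.log_hundred_mul_le hs'
    have hlog2 : Real.log s ≤ Real.log (100 * s) := Real.log_le_log hs0 (by linarith)
    -- The lower bound on `T` has used the factor 8, so the upper bounds are met with `8 * K` in the
    -- role of `K`.
    have hK8 : 1 ≤ 8 * K := by linarith
    have e1 : (s : ℝ) / (1 / 10 * (1 / 10)) = 100 * s := by ring
    have e2 : 20 * (((1 : ℕ) : ℝ) * Real.log (100 * s) / (1 / 10 * (1 / 10))) =
        2000 * Real.log (100 * s) := by
      push_cast
      ring
    have hr1' : 16384 * ((s : ℝ) ^ 2 * ((1 : ℕ) : ℝ) ^ 2 / ((1 / 10) ^ 2 * (1 / 10) ^ 2)) ≤ r := by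
      refine le_trans (le_of_eq ?_) hr1
      push_cast
      ring
    have hr2' : r ≤ 8 * K *
        (16384 * ((s : ℝ) ^ 2 * ((1 : ℕ) : ℝ) ^ 2 / ((1 / 10) ^ 2 * (1 / 10) ^ 2))) := by
      refine hr2.trans (le_trans (b := 8 * (K * (16384 * 10 ^ 4 * (s : ℝ) ^ 2))) ?_ (le_of_eq ?_))
      · have : 0 ≤ K * (16384 * 10 ^ 4 * (s : ℝ) ^ 2) := by positivity
        linarith
      · push_cast
        ring
    have hT1' : 20 * (((1 : ℕ) : ℝ) * Real.log (s / (1 / 10 * (1 / 10))) / (1 / 10 * (1 / 10))) ≤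
        (T : ℝ) := by
      rw [e1, e2]
      linarith
    have hT2' : (T : ℝ) ≤ 8 * K *
        (20 * (((1 : ℕ) : ℝ) * Real.log (s / (1 / 10 * (1 / 10))) / (1 / 10 * (1 / 10)))) := by
      rw [e1, e2]
      have := mul_le_mul_of_nonneg_left hlog2 (show 0 ≤ K by linarith)
      linarith
    have hX : ((1 : ℕ) : ℝ) ^ 5 / ((1 / 10) ^ 6 * (1 / 10) ^ 6) +
        ((1 : ℕ) : ℝ) ^ 2 / ((1 / 10) ^ 2 * (1 / 10) ^ 6) = 10 ^ 12 + 10 ^ 8 := by norm_num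
    have hn' : 10 ^ 15 * (8 * K) ^ 2 * ((σ ^ 2 / SparsePCA.eigval Sig 1) ^ 2 * (s : ℝ) ^ 2 *
        (((1 : ℕ) : ℝ) ^ 5 / ((1 / 10) ^ 6 * (1 / 10) ^ 6) +
          ((1 : ℕ) : ℝ) ^ 2 / ((1 / 10) ^ 2 * (1 / 10) ^ 6)) *
        Real.log (d * T / δ) * Real.log (s / (1 / 10 * (1 / 10)))) ≤ n := by
      rw [hX, e1]
      refine SparsePCA.special_sample_size_le (Real.log_nonneg ?_) (by linarith) hK
        (SparsePCA.log_mul_div_le hs' hsd hT0 hδ0 hδ1 hK hT2) hlog1 (by positivity) hn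
      rw [le_div_iff₀ hδ0]
      linarith
    have hΔ0 : (0 : ℝ) < 1 / 10 := by norm_num
    have hΔ1 : (1 / 10 : ℝ) < 1 := by norm_num
    obtain ⟨hT, hr, hrT, -⟩ := h.sizes hK8 hΔ0 hΔ1 hδ0 hδ1 hrd hr1' hr2' hT1' hT2' hn'
    refine ⟨fun x => SparsePCA.computesWithin_rtpmProg x hT hr hrd hrT, fun top htop =>
      (h.accuracy hK8 hΔ0 hΔ1 hδ0 hδ1 hrd hr1' hr2' hT1' hT2' hn' htop).trans
        (MeasureTheory.measure_mono fun x hx u hu => ?_)⟩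
    obtain ⟨hu1, hu2, hu3⟩ := hx u hu
    refine ⟨hu1, hu2, ?_⟩
    rw [Fin.sum_univ_one] at hu3
    linarith
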